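/- **Setting.** Let $R=\mathbb{Q}(t^{1/2})$. For a finite label set $L$ let $\mathcal V_L=R[[e_l,f_l : l\in L]]$ (commuting variables), the normal ordered form of the tensor power, with factors labelled by $L$, of the Weyl algebra with $FE-EF=1$: the monomial $\prod_l e_l^{a_l}f_l^{b_l}$ stands for the tensor with entry $E^{a_l}F^{b_l}$ in factor $l$. For $i\ne j$ in $L$ let $m_k^{ij}(g)$ be obtained from $g\in\mathcal V_L$ by removing the factors $i,j$ and placing their product, in this order and brought to normal order by $F^bE^c=\sum_r r!\binom br\binom cr E^{c-r}F^{b-r}$, in factor $k$; it is defined whenever the resulting series for the coefficients converge $(t^{1/2}-1)$-adically in $R$. A snarl diagram with label set $L$ consists of oriented paths (components) labelled by $L$ that run through signed crossings, each crossing being passed exactly once as over-strand and once as under-strand, together with an integer rotation number on every edge. Every snarl diagram is assembled, by disjoint union and by stitching ($m_k^{ij}$ joins the end of component $i$ to the start of component $j$, adds the rotation numbers of the two edges that merge, and calls the result $k$), from crossings $X_{ij}^{\sigma}$ ($\sigma=\pm1$, over-strand $i$, under-strand $j$, all rotation numbers $0$) and single edges $\alpha_i^r$ with rotation number $r$. The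 Weyl algebra snarl invariant $Z_{\mathcal W}$ is determined by $$Z_{\mathcal W}(X_{ij}^{\sigma})=t^{\sigma/2}\,\mathbf e^{(1-t^{\sigma})(e_i-e_j)f_j},\qquad Z_{\mathcal W}(\alpha_i^{r})=t^{r/2},$$ and by sending disjoint unions to products and stitchings $m_k^{ij}$ to the operations $m_k^{ij}$. Let $\beta_\tau:B_n\to GL(n)$, $n\ge1$, be the Burau representation, where $\beta_\tau(\sigma_k)$ is the identity matrix except for the block $\begin{pmatrix}1-\tau&\tau\\1&0\end{pmatrix}$ in rows and columns $k,k+1$. Here $\sigma_k$ is the positive crossing whose over-strand runs from position $k$ at the bottom to position $k+1$ at the top, in a product $b'b$ the braid $b'$ is placed on top of $b$, and the strands of a braid are labelled by their positions at the bottom. **Theorem 4.** On the following diagrams $Z_{\mathcal W}$ exists and is well-defined, that is, independent of how the diagram is assembled. 1. For every braid $b\in B_n$ and every braid diagram (braid word) representing it, with writhe $w$ (the signed number of crossings), all rotation numbers being $0$, $$Z_{\mathcal W}(b)=t^{w/2}\,\mathbf e^{e(\beta_t(b)^T\beta_1(b)-I)f},$$ where $eQf=\sum_{i,j}e_iQ_{ij}f_j$.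 2. Let $K$ be a long knot, viewed as a snarl by means of any planar Morse diagram of $K$ in which both strands at each crossing point upwards and both ends point upwards; the rotation numbers count the points of an edge at which the tangent vector points to the right, with sign $+1$ at local minima and $-1$ at local maxima. Then $K$ has a unique normalized Alexander polynomial $\Delta_K\in\mathbb Z[t,t^{-1}]$, i.e. a generator of the ideal of maximal minors of the Alexander matrix (the Fox Jacobian of the Wirtinger presentation) with $\Delta_K(t)=\Delta_K(t^{-1})$ and $\Delta_K(1)=1$, and $$Z_{\mathcal W}(K)=\Delta_K^{-1}.$$ -/

import Mathlib

open scoped LaurentPolynomial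

namespace Snarl

/-! ### Snarl diagrams -/

/-- One passage of a strand through a crossing: the name of the crossing, and whether the strand is
the over-strand there. -/
structure Pass where
  crossing : ℕ
  isOver : Bool
deriving DecidableEq

/-- A component of a snarl diagram, i.e. an oriented path: the rotation number of its first edge,
followed by the crossings that it runs through, each with the rotation number of the edge that
leaves the crossing. -/
structure Strand where
  first : ℤ
  rest : List (Pass × ℤ)

/-- The single edge with rotation number `r`. -/
def Strand.edge (r : ℤ) : Strand := ⟨r, []⟩

/-- Two edges with rotation number `0` and one passage in between. -/
def Strand.ofPass (p : Pass) : Strand := ⟨0, [(p, 0)]⟩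

/-- The passages, each with the rotation number of the edge that leaves it, where `r` is added to
the rotation number of the last one. -/
def addToLast (r : ℤ) : List (Pass × ℤ) → List (Pass × ℤ)
  | [] => []
  | [(p, a)] => [(p, a + r)]
  | x :: y :: l => x :: addToLast r (y :: l)

/-- Joining the end of `a` to the start of `b`. The two edges that meet become one edge, and their
rotation numbers are added. -/
def Strand.append (a b : Strand) : Strand :=
  match a.rest with
  | [] => ⟨a.first + b.first, b.rest⟩
  | l => ⟨a.first, addToLast b.first l ++ b.rest⟩

/-- The passages of a strand in their order along the strand. -/
def Strand.passes (a : Strand) : List Pass := a.rest.map Prod.fst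

/-- The data of a snarl diagram. Components are labelled by natural numbers, with
`strand l = none` if `l` is not in the label set; crossings are named by natural numbers, with
`sign c = 0` if `c` is not the name of a crossing. The graph, with the cyclic order at the crossings,
is recovered from the strands and the signs: the over-strand comes in on the left of the
under-strand exactly at the positive crossings. -/
@[ext]
structure Diagram where
  strand : ℕ → Option Strand
  sign : ℕ → ℤ

/-- The crossing `X_{ij}^σ` named `c`: the over-strand is `i`, the under-strand is `j`, and all
rotation numbers are `0`. -/
def Diagram.crossing (σ : ℤˣ) (c i j : ℕ) : Diagram where
  strand := fun l =>
    if l = i then some (Strand.ofPass ⟨c, true⟩)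
    else if l = j then some (Strand.ofPass ⟨c, false⟩)
    else none
  sign := Pi.single c (σ : ℤ)

/-- The diagram `α_i^r`: a single edge labelled `i` with rotation number `r`. -/
def Diagram.alpha (r : ℤ) (i : ℕ) : Diagram where
  strand := fun l => if l = i then some (Strand.edge r) else none
  sign := 0

/-- No label and no name of a crossing is used twice. -/
def Diagram.Disjoint (D D' : Diagram) : Prop :=
  (∀ l, D.strand l = none ∨ D'.strand l = none) ∧ (∀ c, D.sign c = 0 ∨ D'.sign c = 0)

/-- Disjoint union (of disjoint diagrams). -/
def Diagram.union (D D' : Diagram) : Diagram where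
  strand := fun l => (D.strand l).or (D'.strand l)
  sign := D.sign + D'.sign

/-- Stitching `m_k^{ij}`: `D'` arises from `D` by joining the end of component `i` to the start of
component `j ≠ i` and calling the result `k`, where `k` is not the label of a third component. -/
def Diagram.IsStitch (i j k : ℕ) (D D' : Diagram) : Prop :=
  i ≠ j ∧ (k = i ∨ k = j ∨ D.strand k = none) ∧
    ∃ a b, D.strand i = some a ∧ D.strand j = some b ∧
      D'.sign = D.sign ∧
      D'.strand = fun l =>
        if l = k then some (a.append b) else if l = i ∨ l = j then none else D.strand l

/-! ### The Weyl algebra -/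

/-- The base ring `ℚ(t^{1/2})`. -/
abbrev Base : Type := RatFunc ℚ

/-- The generator `t^{1/2}` of the base ring. -/
noncomputable def sqrtT : Base := RatFunc.X

/-- The element `t` of the base ring. -/
noncomputable def t : Base := sqrtT ^ 2

theorem t_ne_zero : t ≠ 0 := pow_ne_zero 2 RatFunc.X_ne_zero

/-- The element `t` as a unit of the base ring. -/
noncomputable def tUnit : Baseˣ := Units.mk0 t t_ne_zero

/-- Formal power series over the base ring in commuting variables `e_l`, `f_l`, where `l` is a label.
The normal ordered form of the tensor power of the Weyl algebra `F E - E F = 1` with factors labelled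
by a finite set `L` consists of the series in the `e_l`, `f_l` with `l ∈ L`; the monomial
`∏ e_l^{a_l} f_l^{b_l}` stands for the tensor with the entry `E^{a_l} F^{b_l}` in the factor `l`. The
tensor product of elements for disjoint label sets is the product of power series. -/
abbrev Series : Type := MvPowerSeries (ℕ ⊕ ℕ) Base

/-- The variable `e_l`. -/
noncomputable def e (l : ℕ) : Series := MvPowerSeries.X (Sum.inl l)

/-- The variable `f_l`. -/
noncomputable def f (l : ℕ) : Series := MvPowerSeries.X (Sum.inr l)

/-- The coefficient of `E^{c-r} F^{b-r}` in the normal ordered form of `F^b E^c`. -/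
def normalOrderCoeff (b c r : ℕ) : ℕ := r.factorial * b.choose r * c.choose r

/-- Normal ordering in the Weyl algebra: it holds for any two elements with `F E - E F = 1`. -/
theorem pow_mul_pow_eq_sum {A : Type*} [Ring A] {E F : A} (h : F * E = E * F + 1) (b c : ℕ) :
    F ^ b * E ^ c =
      ∑ r ∈ Finset.range (b + 1), normalOrderCoeff b c r • (E ^ (c - r) * F ^ (b - r)) := by
  have h1 : ∀ m : ℕ, F * E ^ m = E ^ m * F + m • E ^ (m - 1) := by
    intro m
    induction m with
    | zero => simp
    | succ m ih =>
      rw [pow_succ, ← mul_assoc, ih, add_mul, mul_assoc, h, mul_add, mul_one, smul_mul_assoc]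
      rcases m with _ | m
      · simp
      · rw [Nat.add_sub_cancel, Nat.add_sub_cancel, ← pow_succ, add_smul (m + 1) 1, one_smul,
          ← mul_assoc]
        abel
  have h2 : ∀ b r : ℕ, normalOrderCoeff (b + 1) c (r + 1) =
      normalOrderCoeff b c (r + 1) + normalOrderCoeff b c r * (c - r) := by
    intro b r
    have := Nat.choose_succ_right_eq c r
    simp only [normalOrderCoeff, Nat.choose_succ_succ, Nat.factorial_succ]
    linear_combination (r.factorial * b.choose r) * this
  induction b with
  | zero => simp [normalOrderCoeff]
  | succ b ih =>
    have h3 : ∀ r ∈ Finset.range (b + 1),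
        F * (normalOrderCoeff b c r • (E ^ (c - r) * F ^ (b - r))) =
          normalOrderCoeff b c r • (E ^ (c - r) * F ^ (b + 1 - r)) +
          (normalOrderCoeff b c r * (c - r)) • (E ^ (c - (r + 1)) * F ^ (b + 1 - (r + 1))) := by
      intro r hr
      have hr' : b + 1 - r = (b - r) + 1 := by
        have := Finset.mem_range.1 hr
        omega
      rw [mul_smul_comm, ← mul_assoc, h1, add_mul, smul_add, hr', pow_succ' F (b - r), mul_smul,
        smul_mul_assoc, ← mul_assoc, Nat.sub_sub, Nat.add_sub_add_right]
    rw [pow_succ', mul_assoc, ih, Finset.mul_sum, Finset.sum_congr rfl h3,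
      Finset.sum_add_distrib, Finset.sum_range_succ' _ (b + 1)]
    simp only [h2, add_smul, Finset.sum_add_distrib]
    have h4 : normalOrderCoeff b c (b + 1) = 0 := by simp [normalOrderCoeff]
    have h5 : normalOrderCoeff (b + 1) c 0 = normalOrderCoeff b c 0 := by simp [normalOrderCoeff]
    rw [Finset.sum_range_succ' _ b,
      Finset.sum_range_succ (fun x => normalOrderCoeff b c (x + 1) •
        (E ^ (c - (x + 1)) * F ^ (b + 1 - (x + 1)))) b, h4, h5, zero_smul, add_zero]
    abel

/-- Convergence in the base ring in the `(t^{1/2} - 1)`-adic topology, that is, in the local ring of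
rational functions in `t^{1/2}` that have no pole at `t^{1/2} = 1`. -/
def ConvergesTo (u : ℕ → Base) (x : Base) : Prop :=
  ∀ N : ℕ, ∃ M : ℕ, ∀ m, M ≤ m → ∃ p q : Polynomial ℚ, q.eval 1 ≠ 0 ∧
    (x - u m) * algebraMap (Polynomial ℚ) Base q =
      algebraMap (Polynomial ℚ) Base ((Polynomial.X - 1) ^ N * p)

/-- The contribution of `r` contractions to the coefficient of the monomial `μ` in `m_k^{ij}(g)`.
With `A` and `B` the exponents of `e_k` and `f_k` in `μ`, these are the terms
`E^a F^b E^c F^d` of `g` (with `E^a F^b` in factor `i` and `E^c F^d` in factor `j`) for which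
`a + c - r = A` and `b + d - r = B`. -/
noncomputable def stitchTerm (i j k : ℕ) (g : Series) (μ : ℕ ⊕ ℕ →₀ ℕ) (r : ℕ) : Base :=
  let A := μ (Sum.inl k)
  let B := μ (Sum.inr k)
  let ν := (μ.erase (Sum.inl k)).erase (Sum.inr k)
  ∑ a ∈ Finset.range (A + 1), ∑ d ∈ Finset.range (B + 1),
    (normalOrderCoeff (B - d + r) (A - a + r) r : Base) *
      MvPowerSeries.coeff
        (ν + Finsupp.single (Sum.inl i) a + Finsupp.single (Sum.inr i) (B - d + r)
          + Finsupp.single (Sum.inl j) (A - a + r) + Finsupp.single (Sum.inr j) d) g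

/-- `g' = m_k^{ij}(g)`: the factors `i` and `j` are removed, and their product, in this order, is
placed in factor `k`. The product of two series in normal order is an infinite sum in every
coefficient, which has to converge. -/
def IsMul (i j k : ℕ) (g g' : Series) : Prop :=
  ∀ μ : ℕ ⊕ ℕ →₀ ℕ,
    ((∃ l, (l = i ∨ l = j) ∧ l ≠ k ∧ (μ (Sum.inl l) ≠ 0 ∨ μ (Sum.inr l) ≠ 0)) →
      MvPowerSeries.coeff μ g' = 0) ∧
    ((∀ l, (l = i ∨ l = j) → l ≠ k → μ (Sum.inl l) = 0 ∧ μ (Sum.inr l) = 0) →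
      ConvergesTo (fun N => ∑ r ∈ Finset.range N, stitchTerm i j k g μ r)
        (MvPowerSeries.coeff μ g'))

/-- The exponential of a power series without constant term. -/
noncomputable def exp (q : Series) : Series := (PowerSeries.exp ℚ).subst q

/-- `exp (∑ e_i Q_{ij} f_j)` for a matrix `Q` with rows and columns labelled `0, …, n - 1`. -/
noncomputable def expQuadratic {n : ℕ} (Q : Matrix (Fin n) (Fin n) Base) : Series :=
  exp (∑ i, ∑ j, MvPowerSeries.C (Q i j) * e i * f j)

/-- The relation `Z_𝒲(D) = g`, where `Z_𝒲` is the Weyl algebra snarl invariant: it is given on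
crossings and on single edges, takes disjoint unions to tensor products, and stitchings to
multiplications. -/
inductive ZValue : Diagram → Series → Prop
  | crossing (σ : ℤˣ) (c i j : ℕ) (hij : i ≠ j) :
      ZValue (Diagram.crossing σ c i j)
        (MvPowerSeries.C (sqrtT ^ (σ : ℤ)) *
          exp (MvPowerSeries.C (1 - t ^ (σ : ℤ)) * (e i - e j) * f j))
  | alpha (r : ℤ) (i : ℕ) : ZValue (Diagram.alpha r i) (MvPowerSeries.C (sqrtT ^ r))
  | union {D D' : Diagram} {g g' : Series} (hD : D.Disjoint D') (h : ZValue D g)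
      (h' : ZValue D' g') : ZValue (D.union D') (g * g')
  | stitch {D D' : Diagram} {g g' : Series} (i j k : ℕ) (hD : D.IsStitch i j k D')
      (h : ZValue D g) (hg : IsMul i j k g g') : ZValue D' g'

/-! ### Planar diagrams -/

/-- The elementary pieces of a planar Morse diagram, read from bottom to top. Positions are counted
from the left, starting at `0`. -/
inductive Slice
  /-- A crossing of sign `σ` of the strands at positions `k` and `k + 1`, both oriented upwards. At a
  positive crossing, the over-strand runs from the left to the right. -/
  | cross (k : ℕ) (σ : ℤˣ)
  /-- A local minimum, whose two ends are at positions `k` and `k + 1`. It is run through from left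
  to right if `right` is true. -/
  | cup (k : ℕ) (right : Bool)
  /-- A local maximum that joins the strands at positions `k` and `k + 1`. It is run through from
  left to right if `right` is true. -/
  | cap (k : ℕ) (right : Bool)

/-- What has been drawn up to a given height: the snarl diagram of this part; the strands at this
height from left to right, each given by the label of the component it belongs to and by its
direction (`true` for upwards: the component ends here; `false` for downwards: it starts here); and
unused names for the next component and for the next crossing. -/
structure Stage where
  diagram : Diagram
  ends : List (ℕ × Bool)
  nextLabel : ℕ
  nextCrossing : ℕ

/-- The beginning: `n` vertical strands, oriented upwards and labelled `0, …, n - 1`. -/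
def Stage.init (n : ℕ) : Stage where
  diagram := { strand := fun l => if l < n then some (Strand.edge 0) else none, sign := 0 }
  ends := (List.range n).map fun l => (l, true)
  nextLabel := n
  nextCrossing := 0

/-- Component `a` is extended at its end. -/
def Diagram.extend (D : Diagram) (a : ℕ) (x : Strand) : Diagram :=
  { D with strand := Function.update D.strand a ((D.strand a).map fun y => y.append x) }

/-- The end of component `a` is joined to the start of component `b` by an edge with rotation number
`r`, and the result is called `a`. -/
def Diagram.joinBy (D : Diagram) (a : ℕ) (r : ℤ) (b : ℕ) : Diagram :=
  { D with
    strand := Function.update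
      (Function.update D.strand a
        ((D.strand a).bind fun x => (D.strand b).map fun y => (x.append (Strand.edge r)).append y))
      b none }

/-- Replacing the label `b` by `a`. -/
def renameEnds (a b : ℕ) (l : List (ℕ × Bool)) : List (ℕ × Bool) :=
  l.map fun x => (if x.1 = b then a else x.1, x.2)

/-- Adding a slice on top, if it fits. Rotation numbers are obtained by counting the points where the
tangent vector points to the right: a minimum run through from left to right counts `1`, a maximum
run through from left to right counts `-1`. A maximum may not create a closed component. -/
def Stage.step (S : Stage) : Slice → Option Stage
  | .cross k σ =>
    match S.ends.drop k with
    | (a, true) :: (b, true) :: l =>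
      let D := (S.diagram.extend a (Strand.ofPass ⟨S.nextCrossing, decide (σ = 1)⟩)).extend b
        (Strand.ofPass ⟨S.nextCrossing, decide (σ = -1)⟩)
      some
        { diagram := { D with sign := Function.update D.sign S.nextCrossing (σ : ℤ) }
          ends := S.ends.take k ++ (b, true) :: (a, true) :: l
          nextLabel := S.nextLabel
          nextCrossing := S.nextCrossing + 1 }
    | _ => none
  | .cup k right =>
    if k ≤ S.ends.length then
      some
        { diagram :=
            { S.diagram with
              strand := Function.update S.diagram.strand S.nextLabel
                (some (Strand.edge (if right then 1 else 0))) }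
          ends := S.ends.take k ++
            (S.nextLabel, !right) :: (S.nextLabel, right) :: S.ends.drop k
          nextLabel := S.nextLabel + 1
          nextCrossing := S.nextCrossing }
    else none
  | .cap k right =>
    match S.ends.drop k, right with
    | (a, true) :: (b, false) :: l, true =>
      if a = b then none
      else some
        { S with
          diagram := S.diagram.joinBy a (-1) b
          ends := renameEnds a b (S.ends.take k ++ l) }
    | (b, false) :: (a, true) :: l, false =>
      if a = b then none
      else some
        { S with
          diagram := S.diagram.joinBy a 0 b
          ends := renameEnds a b (S.ends.take k ++ l) }
    | _, _ => none

/-- Adding the slices of a list one after the other, the head of the list first. -/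
def Stage.run : Stage → List Slice → Option Stage
  | S, [] => some S
  | S, x :: l => (S.step x).bind fun S' => S'.run l

/-- `D` is a planar (Morse) diagram of a long knot, viewed as a snarl diagram with one component, which
is labelled `0`: it starts from one strand, oriented upwards, and it ends with one strand, oriented
upwards. -/
def IsLongKnot (D : Diagram) : Prop :=
  ∃ (w : List Slice) (S : Stage), (Stage.init 1).run w = some S ∧ S.ends = [(0, true)] ∧
    S.diagram = D

/-! ### Braids and the Burau representation -/

/-- The defining relations of the braid group on `n + 1` strands. -/
def braidRels (n : ℕ) : Set (FreeGroup (Fin n)) :=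
  {x | ∃ i j : Fin n, (i : ℕ) + 1 < j ∧
      x = .of i * .of j * (.of i)⁻¹ * (.of j)⁻¹} ∪
  {x | ∃ i j : Fin n, (i : ℕ) + 1 = j ∧
      x = .of i * .of j * .of i * (.of j * .of i * .of j)⁻¹}

/-- The braid group on `n + 1` strands. -/
abbrev BraidGroup (n : ℕ) : Type := PresentedGroup (braidRels n)

/-- The braid of a word in the generators and their inverses. -/
def braidOfWord {n : ℕ} (w : List (Fin n × ℤˣ)) : BraidGroup n :=
  (w.map fun x => (PresentedGroup.of x.1 : BraidGroup n) ^ (x.2 : ℤ)).prod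

/-- The signed number of crossings. -/
def writhe {n : ℕ} (w : List (Fin n × ℤˣ)) : ℤ := (w.map fun x => (x.2 : ℤ)).sum

/-- The braid diagram of a word, from bottom to top. In a product `b' b`, the braid `b'` is on top of
`b`. -/
def braidSlices {n : ℕ} (w : List (Fin n × ℤˣ)) : List Slice :=
  w.reverse.map fun x => .cross x.1 x.2

section Burau

variable {K : Type*} [Field K] {n : ℕ}

/-- The Burau matrix of the generator `σ_k`: the identity matrix, except for the block with rows
`1 - τ, τ` and `1, 0` in the rows and columns `k`, `k + 1`. -/
def burauMatrix (τ : K) (k : Fin n) : Matrix (Fin (n + 1)) (Fin (n + 1)) K :=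
  1 - τ • Matrix.single k.castSucc k.castSucc 1 + τ • Matrix.single k.castSucc k.succ 1
    + Matrix.single k.succ k.castSucc 1 - Matrix.single k.succ k.succ 1

/-- The column factor of `burauMatrix τ k - 1`. -/
def burauCol (τ : K) (k : Fin n) : Fin (n + 1) → K :=
  Pi.single k.succ 1 - τ • Pi.single k.castSucc 1

/-- The row factor of `burauMatrix τ k - 1`. -/
def burauRow (k : Fin n) : Fin (n + 1) → K := Pi.single k.castSucc 1 - Pi.single k.succ 1

theorem burauMatrix_eq (τ : K) (k : Fin n) :
    burauMatrix τ k = 1 + Matrix.vecMulVec (burauCol τ k) (burauRow k) := by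
  ext a b
  simp only [burauMatrix, burauCol, burauRow, Matrix.vecMulVec_apply, Matrix.add_apply,
    Matrix.sub_apply, Matrix.smul_apply, Matrix.single_apply, Pi.sub_apply, Pi.smul_apply,
    Pi.single_apply, smul_eq_mul]
  have hk : k.castSucc ≠ k.succ := k.castSucc_lt_succ.ne
  by_cases h1 : a = k.castSucc <;> by_cases h2 : a = k.succ <;> by_cases h3 : b = k.castSucc <;>
    by_cases h4 : b = k.succ <;> subst_vars <;> simp_all [eq_comm]; ring

theorem burauRow_dot_burauCol (τ : K) (i j : Fin n) :
    burauRow i ⬝ᵥ burauCol τ j =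
      (if (i : ℕ) = j + 1 then 1 else 0) - (if i = j then 1 + τ else 0)
        + (if (i : ℕ) + 1 = j then τ else 0) := by
  simp only [burauRow, burauCol, sub_dotProduct, single_one_dotProduct, Pi.sub_apply,
    Pi.smul_apply, Pi.single_apply, smul_eq_mul, Fin.ext_iff, Fin.val_succ, Fin.val_castSucc]
  split_ifs <;> first | omega | ring

theorem burau_mul (τ : K) (i j k l : Fin n) :
    Matrix.vecMulVec (burauCol τ i) (burauRow j) * Matrix.vecMulVec (burauCol τ k) (burauRow l) =
      (burauRow j ⬝ᵥ burauCol τ k) • Matrix.vecMulVec (burauCol τ i) (burauRow l) := by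
  rw [Matrix.vecMulVec_mul_vecMulVec, Matrix.vecMulVec_smul]

theorem burau_mul_self (τ : K) (k : Fin n) :
    Matrix.vecMulVec (burauCol τ k) (burauRow k) * Matrix.vecMulVec (burauCol τ k) (burauRow k) =
      (-(1 + τ)) • Matrix.vecMulVec (burauCol τ k) (burauRow k) := by
  rw [burau_mul, burauRow_dot_burauCol]
  simp

/-- The Burau matrix of `σ_k` as an invertible matrix. -/
def burauUnit (τ : Kˣ) (k : Fin n) : GL (Fin (n + 1)) K where
  val := burauMatrix (τ : K) k
  inv := 1 + (τ : K)⁻¹ • Matrix.vecMulVec (burauCol (τ : K) k) (burauRow k)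
  val_inv := by
    have h : (τ : K) ≠ 0 := τ.ne_zero
    rw [burauMatrix_eq]
    simp only [add_mul, mul_add, one_mul, mul_one, Matrix.mul_smul, burau_mul_self]
    match_scalars <;> field_simp <;> ring
  inv_val := by
    have h : (τ : K) ≠ 0 := τ.ne_zero
    rw [burauMatrix_eq]
    simp only [add_mul, mul_add, one_mul, mul_one, Matrix.smul_mul, burau_mul_self]
    match_scalars <;> field_simp <;> ring

theorem burau_comm (τ : Kˣ) {i j : Fin n} (h : (i : ℕ) + 1 < j) :
    burauUnit τ i * burauUnit τ j = burauUnit τ j * burauUnit τ i := by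
  ext1
  change burauMatrix (τ : K) i * burauMatrix (τ : K) j =
    burauMatrix (τ : K) j * burauMatrix (τ : K) i
  have h1 : burauRow i ⬝ᵥ burauCol (τ : K) j = 0 := by
    rw [burauRow_dot_burauCol, if_neg (by omega), if_neg (by omega), if_neg (by omega)]
    simp
  have h2 : burauRow j ⬝ᵥ burauCol (τ : K) i = 0 := by
    rw [burauRow_dot_burauCol, if_neg (by omega), if_neg (by omega), if_neg (by omega)]
    simp
  simp only [burauMatrix_eq, add_mul, mul_add, one_mul, mul_one, burau_mul, h1, h2, zero_smul]
  abel

theorem burau_braid (τ : Kˣ) {i j : Fin n} (h : (i : ℕ) + 1 = j) :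
    burauUnit τ i * burauUnit τ j * burauUnit τ i =
      burauUnit τ j * burauUnit τ i * burauUnit τ j := by
  ext1
  change burauMatrix (τ : K) i * burauMatrix (τ : K) j * burauMatrix (τ : K) i =
    burauMatrix (τ : K) j * burauMatrix (τ : K) i * burauMatrix (τ : K) j
  have h1 : burauRow i ⬝ᵥ burauCol (τ : K) j = (τ : K) := by
    rw [burauRow_dot_burauCol, if_neg (by omega), if_neg (by omega), if_pos h]
    simp
  have h2 : burauRow j ⬝ᵥ burauCol (τ : K) i = 1 := by
    rw [burauRow_dot_burauCol, if_pos (by omega), if_neg (by omega), if_neg (by omega)]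
    simp
  simp only [burauMatrix_eq, add_mul, mul_add, one_mul, mul_one, burau_mul_self, burau_mul, h1, h2,
    Matrix.smul_mul, smul_smul]
  module

/-- The Burau representation `β_τ : B_{n+1} → GL(n + 1)`. -/
def burau (n : ℕ) (τ : Kˣ) : BraidGroup n →* GL (Fin (n + 1)) K :=
  PresentedGroup.toGroup (f := burauUnit τ) (by
    rintro x (⟨i, j, h, rfl⟩ | ⟨i, j, h, rfl⟩)
    · simp only [map_mul, map_inv, FreeGroup.lift_apply_of, burau_comm τ h]
      group
    · simp only [map_mul, map_inv, FreeGroup.lift_apply_of, burau_braid τ h]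
      group)

end Burau

/-! ### The Alexander polynomial -/

/-- The number of under-passages in a list of passages. -/
def underCount (l : List Pass) : ℕ := l.countP fun p => !p.isOver

/-- The crossings that a strand passes under, in their order along the strand. -/
def underCrossings (l : List Pass) : List ℕ := (l.filter fun p => !p.isOver).map Pass.crossing

/-- The arc of a strand that passes over the crossing `c`. The arcs run from one under-passage to the
next, and they are numbered `0, 1, 2, …` along the strand. -/
def overArc (l : List Pass) (c : ℕ) : ℕ := underCount (l.takeWhile fun p => p ≠ ⟨c, true⟩)

/-- The Alexander matrix of a diagram of a long knot that runs through the passages `l`, where `sign`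
gives the signs of the crossings. It is the Fox Jacobian, with all meridians sent to `T`, of the
Wirtinger presentation of the knot group: the generators `x_0, x_1, …` belong to the arcs, and the
relations are `x_{r+1} = x_a^σ x_r x_a^{-σ}` if the `r`-th under-passage is below the arc `a` at a
crossing of sign `σ`. -/
noncomputable def alexanderMatrix (l : List Pass) (sign : ℕ → ℤ) :
    Matrix (Fin (underCrossings l).length) (Fin ((underCrossings l).length + 1)) ℤ[T;T⁻¹] :=
  fun r j =>
    let c := (underCrossings l).get r
    (if (j : ℕ) = overArc l c then 1 - LaurentPolynomial.T (sign c) else 0)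
      + (if j = r.castSucc then LaurentPolynomial.T (sign c) else 0)
      - (if j = r.succ then 1 else 0)

/-- The ideal generated by the maximal minors of the Alexander matrix (the first elementary ideal of
the Alexander module). -/
noncomputable def alexanderIdeal (l : List Pass) (sign : ℕ → ℤ) : Ideal ℤ[T;T⁻¹] :=
  Ideal.span (Set.range fun s : Fin (underCrossings l).length → Fin ((underCrossings l).length + 1) =>
    ((alexanderMatrix l sign).submatrix id s).det)

/-- `Δ` is the normalized Alexander polynomial of the long knot with diagram `D`: it generates the
first elementary ideal, is invariant under `T ↦ T⁻¹`, and takes the value `1` at `T = 1`. -/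
def IsAlexanderPolynomial (D : Diagram) (Δ : ℤ[T;T⁻¹]) : Prop :=
  (∃ a, D.strand 0 = some a ∧ alexanderIdeal a.passes D.sign = Ideal.span {Δ}) ∧
    LaurentPolynomial.invert Δ = Δ ∧ LaurentPolynomial.eval₂ (RingHom.id ℤ) 1 Δ = 1

/-- The value of a Laurent polynomial with integer coefficients at the element `t` of the base
ring. -/
noncomputable def atT : ℤ[T;T⁻¹] →+* Base :=
  LaurentPolynomial.eval₂ (Int.castRingHom Base) tUnit

end Snarl

/-!
# The Weyl algebra snarl invariant of braids and of long knots

A Gaussian series `ω exp (∑ G_{ll'} e_l f_{l'})` is characterized by linear differential equations in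
the variables `e_l` and by its constant term (`IsGaussian`). Since `∂/∂E` is a derivation of the Weyl
algebra and `F` can be moved past a factor at the cost of such a derivative, multiplication takes
Gaussian series to Gaussian series (`IsGaussian.isMul`): stitching `i` to `j` divides `ω` by
`1 - G_{ji}` and changes `G` by a matrix of rank one. The constant term is a geometric series, and
all sums converge because `G` vanishes at `t^{1/2} = 1`; this property is kept, so the invariant exists
on every assembled diagram.

The value does not depend on how a diagram is assembled (`ZValue.unique`), because it has a formula in
terms of the diagram (`ZValue.isGaussianOn`). Let `K` be the matrix indexed by the crossings whose
entry at `(c', c)` is `1 - t^{σ_c}`, multiplied by the number (`0` or `1`) of times that the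
under-passage of `c'` precedes the over-passage of `c` on a component, minus the number of times that
it precedes the under-passage of `c`. Then
`ω = t^{(writhe + rotation) / 2} / det (1 - K)`, and `G` is obtained from `(1 - K)⁻¹` and from the
vectors that record the components through each crossing. Stitching subtracts a matrix of rank one from
`1 - K`, so the matrix determinant lemma and the Sherman-Morrison formula reproduce the effect of the
multiplication (`diagram_stitch`).

For braids, adding a crossing on top of a diagram multiplies `1 + G`, with columns sorted by the
positions at the top, by a Burau matrix (`run_braidSlices`).

For long knots, each crossing is passed by the only component both above and below, so `G = 0` and the
value is the constant `ω = t^{k/2} / det (1 - K)`. Column operations turn the Fox Jacobian without its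
first column into the transpose of `K - 1`, so `d = det (1 - K)` generates the ideal of maximal minors,
and `d = 1` at `t = 1` (`span_minors_foxMatrix`, `ZValue.exists_arcMatrix`). It remains to be shown that
`t^{k/2} / d` is the inverse of a Laurent polynomial that is symmetric under `t ↦ t⁻¹`. The diagram is
drawn slice by slice. The colours that the Burau representations at `t` and at `t⁻¹` give to the strands
at a given height are paired by a sesquilinear form that no slice changes (`PreservesForm`). By
induction on the slices, the ratio of the conjugate of `ω` and `ω` is the determinant of this form
(`Stage.IsBalanced`); the rotation numbers account for the factors `t` at minima and maxima. At the top
of a long knot this determinant is `1`, so `ω` is symmetric. Hence `d = T^k d(T⁻¹)`, and `k` is even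
because `d(-1)` is odd; therefore `T^{-k/2} d` is the normalized Alexander polynomial, and it is unique
because the only symmetric unit with value `1` at `1` is `1` (`exists_normalized`).
-/

namespace Snarl

/-! ### The local ring at `t^{1/2} = 1` -/

/-- `x` lies in the `N`-th power of the maximal ideal of the local ring of rational functions in
`t^{1/2}` without pole at `t^{1/2} = 1`. -/
def IsSmall (N : ℕ) (x : Base) : Prop :=
  ∃ p q : Polynomial ℚ, q.eval 1 ≠ 0 ∧
    x * algebraMap (Polynomial ℚ) Base q =
      algebraMap (Polynomial ℚ) Base ((Polynomial.X - 1) ^ N * p)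

theorem IsSmall.of_polynomial (p : Polynomial ℚ) : IsSmall 0 (algebraMap (Polynomial ℚ) Base p) :=
  ⟨p, 1, by simp, by simp⟩

theorem IsSmall.zero (N : ℕ) : IsSmall N 0 := ⟨0, 1, by simp, by simp⟩

theorem IsSmall.one : IsSmall 0 1 := ⟨1, 1, by simp, by simp⟩

theorem IsSmall.add {N : ℕ} {x y : Base} (hx : IsSmall N x) (hy : IsSmall N y) :
    IsSmall N (x + y) := by
  obtain ⟨p, q, hq, h⟩ := hx
  obtain ⟨p', q', hq', h'⟩ := hy
  refine ⟨p * q' + p' * q, q * q', by simp [hq, hq'], ?_⟩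
  simp only [map_mul, map_add] at h h' ⊢
  linear_combination (algebraMap (Polynomial ℚ) Base q') * h +
    (algebraMap (Polynomial ℚ) Base q) * h'

theorem IsSmall.mul {M N : ℕ} {x y : Base} (hx : IsSmall M x) (hy : IsSmall N y) :
    IsSmall (M + N) (x * y) := by
  obtain ⟨p, q, hq, h⟩ := hx
  obtain ⟨p', q', hq', h'⟩ := hy
  refine ⟨p * p', q * q', by simp [hq, hq'], ?_⟩
  rw [map_mul, mul_mul_mul_comm, h, h', ← map_mul]
  congr 1
  ring

theorem IsSmall.mul_left {N : ℕ} {x y : Base} (hx : IsSmall 0 x) (hy : IsSmall N y) :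
    IsSmall N (x * y) := by
  simpa using hx.mul hy

theorem IsSmall.natCast (n : ℕ) : IsSmall 0 (n : Base) := by
  simpa using IsSmall.of_polynomial (n : Polynomial ℚ)

theorem IsSmall.neg {N : ℕ} {x : Base} (hx : IsSmall N x) : IsSmall N (-x) := by
  have : IsSmall 0 (-1 : Base) := by simpa using IsSmall.of_polynomial (-1 : Polynomial ℚ)
  simpa using this.mul_left hx

theorem IsSmall.sub {N : ℕ} {x y : Base} (hx : IsSmall N x) (hy : IsSmall N y) :
    IsSmall N (x - y) := sub_eq_add_neg x y ▸ hx.add hy.neg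

theorem IsSmall.mono {M N : ℕ} (h : M ≤ N) {x : Base} (hx : IsSmall N x) : IsSmall M x := by
  obtain ⟨p, q, hq, hx⟩ := hx
  refine ⟨(Polynomial.X - 1) ^ (N - M) * p, q, hq, ?_⟩
  rw [hx, ← mul_assoc, ← pow_add, Nat.add_sub_cancel' h]

theorem IsSmall.sum {ι : Type*} {N : ℕ} (s : Finset ι) (x : ι → Base)
    (h : ∀ i ∈ s, IsSmall N (x i)) : IsSmall N (∑ i ∈ s, x i) :=
  Finset.sum_induction _ _ (fun _ _ => IsSmall.add) (IsSmall.zero N) h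

theorem IsSmall.pow {x : Base} (hx : IsSmall 1 x) (n : ℕ) : IsSmall n (x ^ n) := by
  induction n with
  | zero => simpa using IsSmall.one
  | succ n ih => exact pow_succ x n ▸ ih.mul hx

/-- The local ring is Hausdorff in the adic topology. -/
theorem eq_zero_of_isSmall {x : Base} (h : ∀ N, IsSmall N x) : x = 0 := by
  induction x using RatFunc.induction_on with
  | f a b hb =>
    have hb' : algebraMap (Polynomial ℚ) Base b ≠ 0 := RatFunc.algebraMap_ne_zero hb
    have key : ∀ N, (Polynomial.X - Polynomial.C (1 : ℚ)) ^ N ∣ a := by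
      intro N
      obtain ⟨p, q, hq, h⟩ := h N
      have h1 : a * q = (Polynomial.X - 1) ^ N * (p * b) := by
        apply IsFractionRing.injective (Polynomial ℚ) Base
        rw [div_mul_eq_mul_div, div_eq_iff hb', ← map_mul, ← map_mul] at h
        rw [h, mul_assoc]
      have h2 : IsCoprime ((Polynomial.X - Polynomial.C (1 : ℚ)) ^ N) q := by
        apply IsCoprime.pow_left
        refine ((Polynomial.irreducible_X_sub_C (1 : ℚ)).coprime_iff_not_dvd).2 ?_
        rwa [Polynomial.dvd_iff_isRoot]
      exact h2.dvd_of_dvd_mul_right ⟨p * b, by simpa using h1⟩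
    have ha : a = 0 := by
      by_contra ha
      have := Polynomial.degree_le_of_dvd (key (a.natDegree + 1)) ha
      rw [Polynomial.degree_pow, Polynomial.degree_X_sub_C, Polynomial.degree_eq_natDegree ha,
        nsmul_one] at this
      norm_cast at this
      omega
    simp [ha]

/-- A small element is not a unit, hence `1 - x` is a unit of the local ring. -/
theorem IsSmall.one_sub_ne_zero {x : Base} (hx : IsSmall 1 x) : 1 - x ≠ 0 := by
  intro h
  obtain ⟨p, q, hq, hx⟩ := hx
  rw [← sub_eq_zero.1 h, one_mul] at hx
  have := IsFractionRing.injective (Polynomial ℚ) Base hx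
  apply hq
  rw [this]
  simp

theorem IsSmall.inv_one_sub {x : Base} (hx : IsSmall 1 x) : IsSmall 0 (1 - x)⁻¹ := by
  have h0 := hx.one_sub_ne_zero
  obtain ⟨p, q, hq, hx⟩ := hx
  refine ⟨q, q - (Polynomial.X - 1) * p, by simpa using hq, ?_⟩
  rw [pow_one] at hx
  rw [map_sub, ← hx, pow_zero, one_mul]
  field_simp

theorem sqrtT_ne_zero : sqrtT ≠ 0 := RatFunc.X_ne_zero

theorem isSmall_sqrtT : IsSmall 0 sqrtT := by
  simpa [sqrtT] using IsSmall.of_polynomial Polynomial.X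

theorem isSmall_sqrtT_inv : IsSmall 0 sqrtT⁻¹ := by
  refine ⟨1, Polynomial.X, by simp, ?_⟩
  rw [sqrtT, RatFunc.algebraMap_X, inv_mul_cancel₀ RatFunc.X_ne_zero]
  simp

theorem IsSmall.pow_zero {x : Base} (hx : IsSmall 0 x) (n : ℕ) : IsSmall 0 (x ^ n) := by
  induction n with
  | zero => simpa using IsSmall.one
  | succ n ih => rw [pow_succ]; exact ih.mul_left hx

theorem isSmall_sqrtT_zpow (n : ℤ) : IsSmall 0 (sqrtT ^ n) := by
  cases n with
  | ofNat n => simpa using isSmall_sqrtT.pow_zero n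
  | negSucc n => rw [zpow_negSucc, ← inv_pow]; exact isSmall_sqrtT_inv.pow_zero _

theorem isSmall_one_sub_sqrtT : IsSmall 1 (1 - sqrtT) := by
  refine ⟨-1, 1, by simp, ?_⟩
  rw [map_one, mul_one, pow_one, mul_neg_one, neg_sub, map_sub, map_one, RatFunc.algebraMap_X,
    sqrtT]

theorem isSmall_one_sub_t : IsSmall 1 (1 - t) := by
  have h : 1 - t = (1 + sqrtT) * (1 - sqrtT) := by rw [t]; ring
  rw [h]
  exact (IsSmall.one.add isSmall_sqrtT).mul_left isSmall_one_sub_sqrtT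

theorem isSmall_one_sub_t_zpow (σ : ℤˣ) : IsSmall 1 (1 - t ^ (σ : ℤ)) := by
  rcases Int.units_eq_one_or σ with rfl | rfl
  · simpa using isSmall_one_sub_t
  · have h : 1 - t⁻¹ = -(sqrtT⁻¹ * sqrtT⁻¹) * (1 - t) := by
      have := sqrtT_ne_zero
      rw [t]
      field_simp
      ring
    rw [Units.val_neg, Units.val_one, zpow_neg, zpow_one, h]
    exact (isSmall_sqrtT_inv.mul isSmall_sqrtT_inv).neg.mul_left isSmall_one_sub_t

/-! ### Convergence in the base ring -/

/-- Limits are unique, because the local ring is Hausdorff. -/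
theorem ConvergesTo.unique {u : ℕ → Base} {x y : Base} (hx : ConvergesTo u x)
    (hy : ConvergesTo u y) : x = y := by
  refine sub_eq_zero.1 (eq_zero_of_isSmall fun N => ?_)
  obtain ⟨M, hM⟩ := hx N
  obtain ⟨M', hM'⟩ := hy N
  have h1 : IsSmall N (x - u (max M M')) := hM _ (le_max_left _ _)
  have h2 : IsSmall N (y - u (max M M')) := hM' _ (le_max_right _ _)
  simpa using h1.sub h2

theorem ConvergesTo.const (x : Base) : ConvergesTo (fun _ => x) x :=
  fun N => ⟨0, fun _ _ => by
    have := IsSmall.zero N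
    rwa [← sub_self x] at this⟩

theorem ConvergesTo.add {u v : ℕ → Base} {x y : Base} (hx : ConvergesTo u x)
    (hy : ConvergesTo v y) : ConvergesTo (fun m => u m + v m) (x + y) := by
  intro N
  obtain ⟨M, hM⟩ := hx N
  obtain ⟨M', hM'⟩ := hy N
  refine ⟨max M M', fun m hm => ?_⟩
  have h1 : IsSmall N (x - u m) := hM _ (le_of_max_le_left hm)
  have h2 : IsSmall N (y - v m) := hM' _ (le_of_max_le_right hm)
  have := h1.add h2
  rwa [sub_add_sub_comm] at this

theorem ConvergesTo.mul_left {u : ℕ → Base} {x c : Base} (hc : IsSmall 0 c)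
    (hx : ConvergesTo u x) : ConvergesTo (fun m => c * u m) (c * x) := by
  intro N
  obtain ⟨M, hM⟩ := hx N
  refine ⟨M, fun m hm => ?_⟩
  have h1 : IsSmall N (x - u m) := hM _ hm
  have := hc.mul_left h1
  rwa [mul_sub] at this

theorem ConvergesTo.sum {ι : Type*} (s : Finset ι) {u : ι → ℕ → Base} {x : ι → Base}
    (h : ∀ i ∈ s, ConvergesTo (u i) (x i)) :
    ConvergesTo (fun m => ∑ i ∈ s, u i m) (∑ i ∈ s, x i) := by
  classical
  induction s using Finset.induction_on with
  | empty => simpa using ConvergesTo.const 0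
  | insert a s ha ih =>
    simp only [Finset.sum_insert ha]
    exact (h a (by simp)).add (ih fun i hi => h i (by simp [hi]))

/-- The geometric series. -/
theorem convergesTo_geometric {x : Base} (hx : IsSmall 1 x) :
    ConvergesTo (fun N => ∑ r ∈ Finset.range N, x ^ r) (1 - x)⁻¹ := by
  intro N
  refine ⟨N, fun m hm => ?_⟩
  have h0 := hx.one_sub_ne_zero
  have h1 : (1 - x)⁻¹ - ∑ r ∈ Finset.range m, x ^ r = (1 - x)⁻¹ * x ^ m := by
    rw [geom_sum_eq (fun h => h0 (by rw [h, sub_self]))]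
    have : x - 1 ≠ 0 := fun h => h0 (by linear_combination -h)
    field_simp
    ring
  rw [h1]
  exact (hx.inv_one_sub.mul_left (hx.pow m)).mono hm

/-! ### Gaussian series -/

section

open MvPowerSeries

/-- The degree of a monomial in the variables `e_l`. -/
noncomputable def eDegree : (ℕ ⊕ ℕ →₀ ℕ) →+ ℕ := Finsupp.weight (Sum.elim 1 0)

/-- The degree of a monomial in the variables `f_l`. -/
noncomputable def fDegree : (ℕ ⊕ ℕ →₀ ℕ) →+ ℕ := Finsupp.weight (Sum.elim 0 1)

@[simp] theorem eDegree_single_inl (l n : ℕ) : eDegree (Finsupp.single (Sum.inl l) n) = n := by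
  simp [eDegree, Finsupp.weight_single]

@[simp] theorem eDegree_single_inr (l n : ℕ) : eDegree (Finsupp.single (Sum.inr l) n) = 0 := by
  simp [eDegree, Finsupp.weight_single]

@[simp] theorem fDegree_single_inl (l n : ℕ) : fDegree (Finsupp.single (Sum.inl l) n) = 0 := by
  simp [fDegree, Finsupp.weight_single]

@[simp] theorem fDegree_single_inr (l n : ℕ) : fDegree (Finsupp.single (Sum.inr l) n) = n := by
  simp [fDegree, Finsupp.weight_single]

theorem eDegree_eq_zero_iff {μ : ℕ ⊕ ℕ →₀ ℕ} : eDegree μ = 0 ↔ ∀ l, μ (Sum.inl l) = 0 := by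
  rw [eDegree, Finsupp.weight_apply, Finsupp.sum, Finset.sum_eq_zero_iff]
  constructor
  · intro h l
    by_contra h0
    exact h0 (by simpa using h (Sum.inl l) (by simpa using h0))
  · rintro h (l | l) -
    · simp [h l]
    · simp

theorem fDegree_eq_zero_iff {μ : ℕ ⊕ ℕ →₀ ℕ} : fDegree μ = 0 ↔ ∀ l, μ (Sum.inr l) = 0 := by
  rw [fDegree, Finsupp.weight_apply, Finsupp.sum, Finset.sum_eq_zero_iff]
  constructor
  · intro h l
    by_contra h0
    exact h0 (by simpa using h (Sum.inr l) (by simpa using h0))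
  · rintro h (l | l) -
    · simp
    · simp [h l]

/-- A linear form in the variables `f_l`. -/
noncomputable def fForm (L : Finset ℕ) (c : ℕ → Base) : Series := ∑ l ∈ L, C (c l) * f l

theorem coeff_f_mul (l : ℕ) (g : Series) (μ : ℕ ⊕ ℕ →₀ ℕ) :
    coeff μ (f l * g) =
      if μ (Sum.inr l) = 0 then 0 else coeff (μ - Finsupp.single (Sum.inr l) 1) g := by
  rw [f, X, coeff_monomial_mul, one_mul]
  by_cases h : μ (Sum.inr l) = 0
  · rw [if_pos h, if_neg]
    simp [h]
  · rw [if_neg h, if_pos]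
    rw [Finsupp.single_le_iff]
    exact Nat.one_le_iff_ne_zero.2 h

theorem coeff_fForm_mul (L : Finset ℕ) (c : ℕ → Base) (g : Series) (μ : ℕ ⊕ ℕ →₀ ℕ) :
    coeff μ (fForm L c * g) = ∑ l ∈ L, c l *
      (if μ (Sum.inr l) = 0 then 0 else coeff (μ - Finsupp.single (Sum.inr l) 1) g) := by
  simp only [fForm, Finset.sum_mul, map_sum, mul_assoc, coeff_C_mul, coeff_f_mul]

theorem fForm_add (L : Finset ℕ) (c c' : ℕ → Base) :
    fForm L (fun l => c l + c' l) = fForm L c + fForm L c' := by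
  simp [fForm, add_mul, Finset.sum_add_distrib]

theorem fForm_mul_left (L : Finset ℕ) (x : Base) (c : ℕ → Base) :
    fForm L (fun l => x * c l) = C x * fForm L c := by
  simp [fForm, mul_assoc, Finset.mul_sum]

theorem fForm_mono {L L' : Finset ℕ} (h : L ⊆ L') {c : ℕ → Base} (hc : ∀ l, l ∉ L → c l = 0) :
    fForm L' c = fForm L c :=
  (Finset.sum_subset h fun l _ hl => by simp [hc l hl]).symm

/-- `g = ω exp (∑ G_{ll'} e_l f_{l'})`, where `G_{ll'} = 0` unless `l, l' ∈ L`, characterized by the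
differential equations for the variables `e_l` and the initial condition at `e = 0`. -/
structure IsGaussian (L : Finset ℕ) (ω : Base) (G : ℕ → ℕ → Base) (g : Series) : Prop where
  row_eq_zero : ∀ l l', l ∉ L → G l l' = 0
  col_eq_zero : ∀ l l', l' ∉ L → G l l' = 0
  coeff_zero : coeff 0 g = ω
  coeff_of_eDegree_eq_zero : ∀ μ, eDegree μ = 0 → μ ≠ 0 → coeff μ g = 0
  pderiv_eq : ∀ l, pderiv Base (Sum.inl l) g = fForm L (G l) * g

theorem exists_eq_add_single {μ : ℕ ⊕ ℕ →₀ ℕ} (h : eDegree μ ≠ 0) :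
    ∃ l ν, μ = ν + Finsupp.single (Sum.inl l) 1 := by
  rw [Ne, eDegree_eq_zero_iff, not_forall] at h
  obtain ⟨l, hl⟩ := h
  refine ⟨l, μ - Finsupp.single (Sum.inl l) 1, (tsub_add_cancel_of_le ?_).symm⟩
  rw [Finsupp.single_le_iff]
  exact Nat.one_le_iff_ne_zero.2 hl

theorem eDegree_sub_single {μ : ℕ ⊕ ℕ →₀ ℕ} (l : ℕ) :
    eDegree (μ - Finsupp.single (Sum.inr l) 1) = eDegree μ := by
  by_cases h : μ (Sum.inr l) = 0
  · rw [show μ - Finsupp.single (Sum.inr l) 1 = μ by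
      ext x; by_cases hx : x = Sum.inr l <;> simp [hx, h]]
  · have h1 : μ - Finsupp.single (Sum.inr l) 1 + Finsupp.single (Sum.inr l) 1 = μ :=
      tsub_add_cancel_of_le (by rw [Finsupp.single_le_iff]; exact Nat.one_le_iff_ne_zero.2 h)
    conv_rhs => rw [← h1]
    simp

theorem fDegree_sub_single {μ : ℕ ⊕ ℕ →₀ ℕ} {l : ℕ} (h : μ (Sum.inr l) ≠ 0) :
    fDegree (μ - Finsupp.single (Sum.inr l) 1) + 1 = fDegree μ := by
  have h1 : μ - Finsupp.single (Sum.inr l) 1 + Finsupp.single (Sum.inr l) 1 = μ :=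
    tsub_add_cancel_of_le (by rw [Finsupp.single_le_iff]; exact Nat.one_le_iff_ne_zero.2 h)
  conv_rhs => rw [← h1]
  simp

section

variable {L : Finset ℕ} {ω : Base} {G : ℕ → ℕ → Base} {g : Series}

/-- The recursion for the coefficients of a Gaussian series. -/
theorem IsGaussian.coeff_add_single (h : IsGaussian L ω G g) (l : ℕ) (μ : ℕ ⊕ ℕ →₀ ℕ) :
    coeff (μ + Finsupp.single (Sum.inl l) 1) g = ((μ (Sum.inl l) : Base) + 1)⁻¹ *
      ∑ l' ∈ L, G l l' * (if μ (Sum.inr l') = 0 then 0 else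
        coeff (μ - Finsupp.single (Sum.inr l') 1) g) := by
  have h1 := congrArg (coeff μ) (h.pderiv_eq l)
  rw [coeff_pderiv, coeff_fForm_mul] at h1
  rw [← h1, mul_comm, mul_assoc, mul_inv_cancel₀ (Nat.cast_add_one_ne_zero _), mul_one]

/-- The induction that goes with the recursion for the coefficients of a Gaussian series. -/
theorem monomial_induction {P : (ℕ ⊕ ℕ →₀ ℕ) → Prop}
    (h0 : ∀ μ, eDegree μ = 0 → P μ)
    (h1 : ∀ μ l, (∀ l', μ (Sum.inr l') ≠ 0 → P (μ - Finsupp.single (Sum.inr l') 1)) →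
      P (μ + Finsupp.single (Sum.inl l) 1)) (μ : ℕ ⊕ ℕ →₀ ℕ) : P μ := by
  induction hn : eDegree μ generalizing μ with
  | zero => exact h0 μ hn
  | succ n ih =>
    obtain ⟨l, ν, rfl⟩ := exists_eq_add_single (μ := μ) (by omega)
    rw [map_add, eDegree_single_inl, Nat.add_right_cancel_iff] at hn
    exact h1 ν l fun l' _ => ih _ (by rw [eDegree_sub_single, hn])

theorem IsGaussian.unique {g' : Series} (h : IsGaussian L ω G g) (h' : IsGaussian L ω G g') :
    g = g' := by
  ext μ
  refine monomial_induction (P := fun μ => coeff μ g = coeff μ g') (fun μ hμ => ?_)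
    (fun μ l ih => ?_) μ
  · by_cases h0 : μ = 0
    · rw [h0, h.coeff_zero, h'.coeff_zero]
    · rw [h.coeff_of_eDegree_eq_zero μ hμ h0, h'.coeff_of_eDegree_eq_zero μ hμ h0]
  · rw [h.coeff_add_single, h'.coeff_add_single]
    congr 1
    refine Finset.sum_congr rfl fun l' _ => ?_
    split_ifs with h0
    · rfl
    · rw [ih l' h0]

theorem IsGaussian.mono (h : IsGaussian L ω G g) {L' : Finset ℕ} (hL : L ⊆ L') :
    IsGaussian L' ω G g where
  row_eq_zero l l' hl := h.row_eq_zero l l' fun h => hl (hL h)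
  col_eq_zero l l' hl := h.col_eq_zero l l' fun h => hl (hL h)
  coeff_zero := h.coeff_zero
  coeff_of_eDegree_eq_zero := h.coeff_of_eDegree_eq_zero
  pderiv_eq l := by rw [h.pderiv_eq, fForm_mono hL (h.col_eq_zero l)]

/-- Two Gaussian series with the same data agree, whatever finite set of labels is used. -/
theorem IsGaussian.unique' {L' : Finset ℕ} {g' : Series} (h : IsGaussian L ω G g)
    (h' : IsGaussian L' ω G g') : g = g' :=
  (h.mono Finset.subset_union_left).unique (h'.mono (Finset.subset_union_right (s₁ := L)))

/-- Only the monomials with as many `e` as `f` variables occur. -/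
theorem IsGaussian.coeff_eq_zero (h : IsGaussian L ω G g) (μ : ℕ ⊕ ℕ →₀ ℕ)
    (hμ : eDegree μ ≠ fDegree μ) : coeff μ g = 0 := by
  revert hμ
  refine monomial_induction (P := fun μ => eDegree μ ≠ fDegree μ → coeff μ g = 0)
    (fun μ hμ hne => ?_) (fun μ l ih hne => ?_) μ
  · exact h.coeff_of_eDegree_eq_zero μ hμ (by rintro rfl; simp at hne)
  · rw [h.coeff_add_single, Finset.sum_eq_zero, mul_zero]
    intro l' _
    split_ifs with h0
    · rw [mul_zero]
    · rw [ih l' h0, mul_zero]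
      have := fDegree_sub_single h0
      rw [eDegree_sub_single]
      simp only [map_add, eDegree_single_inl, fDegree_single_inl] at hne
      omega

theorem isSmall_inv_natCast_add_one (n : ℕ) : IsSmall 0 ((n : Base) + 1)⁻¹ := by
  have h : ((n : Base) + 1)⁻¹ =
      algebraMap (Polynomial ℚ) Base (Polynomial.C ((n : ℚ) + 1)⁻¹) := by
    rw [RatFunc.algebraMap_C, map_inv₀]
    simp
  rw [h]
  exact IsSmall.of_polynomial _

/-- If `G` vanishes at `t^{1/2} = 1`, a coefficient vanishes there to the order of its degree. -/
theorem IsGaussian.isSmall_coeff (h : IsGaussian L ω G g) (hω : IsSmall 0 ω)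
    (hG : ∀ l l', IsSmall 1 (G l l')) (μ : ℕ ⊕ ℕ →₀ ℕ) : IsSmall (eDegree μ) (coeff μ g) := by
  refine monomial_induction (P := fun μ => IsSmall (eDegree μ) (coeff μ g))
    (fun μ hμ => ?_) (fun μ l ih => ?_) μ
  · rw [hμ]
    by_cases h0 : μ = 0
    · rwa [h0, h.coeff_zero]
    · rw [h.coeff_of_eDegree_eq_zero μ hμ h0]
      exact IsSmall.zero 0
  · rw [h.coeff_add_single]
    refine (isSmall_inv_natCast_add_one _).mul_left (IsSmall.sum _ _ fun l' _ => ?_)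
    split_ifs with h0
    · rw [mul_zero]
      exact IsSmall.zero _
    · have := (hG l l').mul (ih l' h0)
      rw [eDegree_sub_single, add_comm] at this
      simpa using this

/-- The product of Gaussian series. -/
theorem IsGaussian.mul {L' : Finset ℕ} {ω' : Base} {G' : ℕ → ℕ → Base} {g' : Series}
    (h : IsGaussian L ω G g) (h' : IsGaussian L' ω' G' g') :
    IsGaussian (L ∪ L') (ω * ω') (fun l l' => G l l' + G' l l') (g * g') where
  row_eq_zero l l' hl := by
    rw [h.row_eq_zero l l' (by grind), h'.row_eq_zero l l' (by grind), add_zero]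
  col_eq_zero l l' hl := by
    rw [h.col_eq_zero l l' (by grind), h'.col_eq_zero l l' (by grind), add_zero]
  coeff_zero := by
    rw [← h.coeff_zero, ← h'.coeff_zero]
    simp
  coeff_of_eDegree_eq_zero μ hμ h0 := by
    classical
    rw [coeff_mul]
    refine Finset.sum_eq_zero fun p hp => ?_
    rw [Finset.HasAntidiagonal.mem_antidiagonal] at hp
    rw [← hp, map_add, Nat.add_eq_zero_iff] at hμ
    by_cases h1 : p.1 = 0
    · rw [h'.coeff_of_eDegree_eq_zero _ hμ.2 (by rintro h2; simp [h1, h2] at hp; exact h0 hp.symm),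
        mul_zero]
    · rw [h.coeff_of_eDegree_eq_zero _ hμ.1 h1, zero_mul]
  pderiv_eq l := by
    rw [Derivation.leibniz, h.pderiv_eq, h'.pderiv_eq, fForm_add,
      fForm_mono Finset.subset_union_left (h.col_eq_zero l),
      fForm_mono (Finset.subset_union_right (s₁ := L)) (h'.col_eq_zero l), smul_eq_mul, smul_eq_mul]
    ring

end

theorem isGaussian_C (ω : Base) : IsGaussian ∅ ω (fun _ _ => 0) (C ω) where
  row_eq_zero _ _ _ := rfl
  col_eq_zero _ _ _ := rfl
  coeff_zero := by simp
  coeff_of_eDegree_eq_zero μ _ h0 := by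
    classical
    rw [coeff_C, if_neg h0]
  pderiv_eq l := by simp [fForm]

theorem IsGaussian.eq_C {L : Finset ℕ} {ω : Base} {g : Series}
    (h : IsGaussian L ω (fun _ _ => 0) g) : g = C ω :=
  h.unique' (isGaussian_C ω)

/-! ### The exponential of a series -/

/-- The exponential series has rational coefficients; they act in the same way for every algebra
structure of the base ring over `ℚ`. -/
theorem rat_smul_eq (inst : Algebra ℚ Base) (c : ℚ) (x : Base) :
    @HSMul.hSMul ℚ Base Base (@instHSMul _ _ inst.toSMul) c x = (c : Base) * x := by
  rw [@Algebra.smul_def _ _ _ _ inst, eq_ratCast]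

/-- The coefficients of the exponential are those of its partial sums. -/
theorem coeff_exp {q : Series} (hq : constantCoeff q = 0) {μ : ℕ ⊕ ℕ →₀ ℕ} {N : ℕ}
    (hN : μ.degree < N) :
    coeff μ (exp q) = coeff μ (∑ d ∈ Finset.range N, C ((d.factorial : Base)⁻¹) * q ^ d) := by
  rw [exp, PowerSeries.coeff_subst (PowerSeries.HasSubst.of_constantCoeff_zero hq),
    finsum_eq_sum_of_support_subset (s := Finset.range N), map_sum]
  · refine Finset.sum_congr rfl fun d _ => ?_
    rw [PowerSeries.coeff_exp, coeff_C_mul]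
    refine (rat_smul_eq _ _ _).trans ?_
    simp
  · intro d hd
    by_contra hd'
    have hd' : N ≤ d := by simpa using hd'
    refine hd ?_
    beta_reduce
    rw [coeff_eq_zero_of_constantCoeff_nilpotent (m := 1) (by simpa using hq) (by omega)]
    exact (rat_smul_eq _ _ _).trans (mul_zero _)

theorem pderiv_exp {q : Series} (hq : constantCoeff q = 0) (i : ℕ ⊕ ℕ) :
    pderiv Base i (exp q) = pderiv Base i q * exp q := by
  classical
  ext μ
  have h1 : pderiv Base i (∑ d ∈ Finset.range (μ.degree + 2), C ((d.factorial : Base)⁻¹) * q ^ d) =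
      pderiv Base i q * ∑ d ∈ Finset.range (μ.degree + 1), C ((d.factorial : Base)⁻¹) * q ^ d := by
    rw [map_sum, Finset.sum_range_succ', Finset.mul_sum]
    simp only [Derivation.leibniz, pderiv_C, pderiv_pow, smul_eq_mul, mul_zero, add_zero, pow_zero,
      Nat.add_sub_cancel]
    rw [Nat.factorial_zero, show (pderiv Base i) (1 : Series) = 0 from pderiv_one, mul_zero, add_zero]
    refine Finset.sum_congr rfl fun d _ => ?_
    have h2 : (C (((d + 1).factorial : Base)⁻¹) : Series) * ((d + 1 : ℕ) : Series) =
        C ((d.factorial : Base)⁻¹) := by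
      rw [← map_natCast (C (σ := ℕ ⊕ ℕ) (R := Base)), ← map_mul, Nat.factorial_succ, Nat.cast_mul,
        mul_inv, mul_right_comm, inv_mul_cancel₀ (Nat.cast_ne_zero.2 d.succ_ne_zero), one_mul]
    rw [← h2]
    ring
  rw [coeff_pderiv, coeff_exp hq (N := μ.degree + 2), ← coeff_pderiv, h1, coeff_mul, coeff_mul]
  · refine Finset.sum_congr rfl fun p hp => ?_
    rw [coeff_exp hq]
    rw [Finset.HasAntidiagonal.mem_antidiagonal] at hp
    have : p.1.degree + p.2.degree = μ.degree := by rw [← hp, map_add]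
    omega
  · rw [map_add, Finsupp.degree_single]
    omega

theorem coeff_zero_exp {q : Series} (hq : constantCoeff q = 0) : coeff 0 (exp q) = 1 := by
  rw [coeff_exp hq (N := 1) (by simp)]
  simp

theorem coeff_mul_eq_zero_of_eDegree {p q : Series}
    (hp : ∀ μ, eDegree μ = 0 → coeff μ p = 0) (μ : ℕ ⊕ ℕ →₀ ℕ) (hμ : eDegree μ = 0) :
    coeff μ (p * q) = 0 := by
  classical
  rw [coeff_mul]
  refine Finset.sum_eq_zero fun x hx => ?_
  rw [Finset.HasAntidiagonal.mem_antidiagonal] at hx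
  rw [← hx, map_add, Nat.add_eq_zero_iff] at hμ
  rw [hp _ hμ.1, zero_mul]

theorem coeff_e_mul (l : ℕ) (q : Series) (μ : ℕ ⊕ ℕ →₀ ℕ) (hμ : eDegree μ = 0) :
    coeff μ (e l * q) = 0 := by
  classical
  refine coeff_mul_eq_zero_of_eDegree (fun ν hν => ?_) μ hμ
  rw [e, coeff_X, if_neg]
  rintro rfl
  simp at hν

/-- The exponential of a quadratic form is Gaussian. -/
theorem isGaussian_exp (L : Finset ℕ) (ω : Base) (G : ℕ → ℕ → Base)
    (hrow : ∀ l l', l ∉ L → G l l' = 0) (hcol : ∀ l l', l' ∉ L → G l l' = 0) :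
    IsGaussian L ω G (C ω * exp (∑ l ∈ L, e l * fForm L (G l))) := by
  have hq : ∀ μ, eDegree μ = 0 → coeff μ (∑ l ∈ L, e l * fForm L (G l)) = 0 := fun μ hμ => by
    rw [map_sum]
    exact Finset.sum_eq_zero fun l _ => coeff_e_mul _ _ _ hμ
  have hq0 : constantCoeff (∑ l ∈ L, e l * fForm L (G l)) = 0 := by
    rw [← coeff_zero_eq_constantCoeff_apply]
    exact hq 0 (by simp)
  refine ⟨hrow, hcol, ?_, fun μ hμ h0 => ?_, fun l => ?_⟩
  · rw [coeff_C_mul, coeff_zero_exp hq0, mul_one]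
  · rw [coeff_C_mul, coeff_exp hq0 (N := μ.degree + 1) (by omega), Finset.sum_range_succ', map_add,
      map_sum, Finset.sum_eq_zero fun d _ => ?_]
    · classical
      simp [coeff_one, h0]
    · rw [pow_succ', mul_left_comm]
      exact coeff_mul_eq_zero_of_eDegree hq μ hμ
  · rw [Derivation.leibniz, pderiv_C, smul_zero, add_zero, pderiv_exp hq0, smul_eq_mul]
    have h1 : ∀ m, pderiv Base (Sum.inl l) (fForm L (G m)) = 0 := fun m => by
      rw [fForm, map_sum]
      refine Finset.sum_eq_zero fun l' _ => ?_
      rw [Derivation.leibniz, pderiv_C, smul_zero, add_zero, f,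
        pderiv_X_of_ne (by simp), smul_zero]
    have h2 : pderiv Base (Sum.inl l) (∑ l ∈ L, e l * fForm L (G l)) = fForm L (G l) := by
      rw [map_sum]
      simp only [Derivation.leibniz, h1, smul_zero, zero_add]
      by_cases hl : l ∈ L
      · rw [Finset.sum_eq_single_of_mem l hl fun m _ hm => ?_]
        · simp [e]
        · rw [e, pderiv_X_of_ne (by simpa using hm), smul_zero]
      · rw [Finset.sum_eq_zero fun m hm => ?_]
        · simp [fForm, hrow l _ hl]
        · rw [e, pderiv_X_of_ne (by simpa using fun h : m = l => hl (h ▸ hm)), smul_zero]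
    rw [h2]
    ring

end

/-! ### Stitching of Gaussian series -/

section

open MvPowerSeries

/-- The monomials that may occur after the factors `i` and `j` have been replaced by the factor
`k`. -/
def IsClean (i j k : ℕ) (μ : ℕ ⊕ ℕ →₀ ℕ) : Prop :=
  ∀ l, (l = i ∨ l = j) → l ≠ k → μ (Sum.inl l) = 0 ∧ μ (Sum.inr l) = 0

open Classical in
/-- The part of `m_k^{ij}(g)` with exactly `r` contractions. -/
noncomputable def contraction (i j k r : ℕ) (g : Series) : Series :=
  fun μ => if IsClean i j k μ then stitchTerm i j k g μ r else 0

theorem coeff_contraction_of_isClean {i j k : ℕ} {μ : ℕ ⊕ ℕ →₀ ℕ} (h : IsClean i j k μ) (r : ℕ)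
    (g : Series) : coeff μ (contraction i j k r g) = stitchTerm i j k g μ r := if_pos h

theorem coeff_contraction_of_not_isClean {i j k : ℕ} {μ : ℕ ⊕ ℕ →₀ ℕ} (h : ¬ IsClean i j k μ)
    (r : ℕ) (g : Series) : coeff μ (contraction i j k r g) = 0 := if_neg h

theorem contraction_add (i j k r : ℕ) (g g' : Series) :
    contraction i j k r (g + g') = contraction i j k r g + contraction i j k r g' := by
  ext μ
  by_cases h : IsClean i j k μ
  · simp only [map_add, coeff_contraction_of_isClean h, stitchTerm, mul_add, Finset.sum_add_distrib]
  · simp only [map_add, coeff_contraction_of_not_isClean h, add_zero]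

theorem contraction_C_mul (i j k r : ℕ) (c : Base) (g : Series) :
    contraction i j k r (C c * g) = C c * contraction i j k r g := by
  ext μ
  by_cases h : IsClean i j k μ
  · simp only [coeff_C_mul, coeff_contraction_of_isClean h, stitchTerm, Finset.mul_sum,
      mul_left_comm]
  · simp only [coeff_C_mul, coeff_contraction_of_not_isClean h, mul_zero]

/-- The monomial `E^a F^b` in factor `i` and `E^c F^d` in factor `j`, times `ν`. -/
noncomputable def factorMonomial (i j : ℕ) (ν : ℕ ⊕ ℕ →₀ ℕ) (a b c d : ℕ) : ℕ ⊕ ℕ →₀ ℕ :=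
  ν + Finsupp.single (Sum.inl i) a + Finsupp.single (Sum.inr i) b
    + Finsupp.single (Sum.inl j) c + Finsupp.single (Sum.inr j) d

/-- The part of a monomial outside the factor `k`. -/
noncomputable def eraseFactor (k : ℕ) (μ : ℕ ⊕ ℕ →₀ ℕ) : ℕ ⊕ ℕ →₀ ℕ :=
  (μ.erase (Sum.inl k)).erase (Sum.inr k)

theorem stitchTerm_eq (i j k : ℕ) (g : Series) (μ : ℕ ⊕ ℕ →₀ ℕ) (r : ℕ) :
    stitchTerm i j k g μ r = ∑ a ∈ Finset.range (μ (Sum.inl k) + 1),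
      ∑ d ∈ Finset.range (μ (Sum.inr k) + 1),
        (normalOrderCoeff (μ (Sum.inr k) - d + r) (μ (Sum.inl k) - a + r) r : Base) *
          coeff (factorMonomial i j (eraseFactor k μ) a (μ (Sum.inr k) - d + r)
            (μ (Sum.inl k) - a + r) d) g := rfl

section

variable {i j k : ℕ} {ν μ : ℕ ⊕ ℕ →₀ ℕ} {a b c d : ℕ}

theorem eraseFactor_inl (h : IsClean i j k μ) {l : ℕ} (hl : l = i ∨ l = j) :
    eraseFactor k μ (Sum.inl l) = 0 := by
  by_cases hk : l = k
  · simp [eraseFactor, hk]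
  · simp [eraseFactor, Finsupp.erase_ne, hk, (h l hl hk).1]

theorem eraseFactor_inr (h : IsClean i j k μ) {l : ℕ} (hl : l = i ∨ l = j) :
    eraseFactor k μ (Sum.inr l) = 0 := by
  by_cases hk : l = k
  · simp [eraseFactor, hk]
  · simp [eraseFactor, Finsupp.erase_ne, hk, (h l hl hk).2]

theorem eraseFactor_add_inl : eraseFactor k (μ + Finsupp.single (Sum.inl k) 1) = eraseFactor k μ := by
  ext x
  by_cases h1 : x = Sum.inl k <;> by_cases h2 : x = Sum.inr k <;> simp [eraseFactor, h1, h2]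

theorem eraseFactor_sub_inr : eraseFactor k (μ - Finsupp.single (Sum.inr k) 1) = eraseFactor k μ := by
  ext x
  by_cases h1 : x = Sum.inl k <;> by_cases h2 : x = Sum.inr k <;> simp [eraseFactor, h1, h2]

theorem eraseFactor_add_inl_of_ne {l : ℕ} (h : l ≠ k) :
    eraseFactor k (μ + Finsupp.single (Sum.inl l) 1) =
      eraseFactor k μ + Finsupp.single (Sum.inl l) 1 := by
  ext x
  by_cases h1 : x = Sum.inl k <;> by_cases h2 : x = Sum.inr k <;>
    simp [eraseFactor, h1, h2, h]

theorem eraseFactor_sub_inr_of_ne {l : ℕ} (h : l ≠ k) :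
    eraseFactor k (μ - Finsupp.single (Sum.inr l) 1) =
      eraseFactor k μ - Finsupp.single (Sum.inr l) 1 := by
  ext x
  by_cases h1 : x = Sum.inl k <;> by_cases h2 : x = Sum.inr k <;>
    simp [eraseFactor, h1, h2, h.symm]

theorem eraseFactor_apply_inr_of_ne {l : ℕ} (h : l ≠ k) :
    eraseFactor k μ (Sum.inr l) = μ (Sum.inr l) := by
  simp [eraseFactor, h]

theorem eraseFactor_apply_inl_of_ne {l : ℕ} (h : l ≠ k) :
    eraseFactor k μ (Sum.inl l) = μ (Sum.inl l) := by
  simp [eraseFactor, h]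

theorem factorMonomial_inl_left (hij : i ≠ j) (h : ν (Sum.inl i) = 0) :
    factorMonomial i j ν a b c d (Sum.inl i) = a := by
  simp [factorMonomial, h, hij]

theorem factorMonomial_inl_right (hij : i ≠ j) (h : ν (Sum.inl j) = 0) :
    factorMonomial i j ν a b c d (Sum.inl j) = c := by
  simp [factorMonomial, h, hij.symm]

theorem factorMonomial_inr_left (hij : i ≠ j) (h : ν (Sum.inr i) = 0) :
    factorMonomial i j ν a b c d (Sum.inr i) = b := by
  simp [factorMonomial, h, hij]

theorem factorMonomial_inr_right (hij : i ≠ j) (h : ν (Sum.inr j) = 0) :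
    factorMonomial i j ν a b c d (Sum.inr j) = d := by
  simp [factorMonomial, h, hij.symm]

theorem factorMonomial_inl_of_ne {l : ℕ} (hi : l ≠ i) (hj : l ≠ j) :
    factorMonomial i j ν a b c d (Sum.inl l) = ν (Sum.inl l) := by
  simp [factorMonomial, hi, hj]

theorem factorMonomial_inr_of_ne {l : ℕ} (hi : l ≠ i) (hj : l ≠ j) :
    factorMonomial i j ν a b c d (Sum.inr l) = ν (Sum.inr l) := by
  simp [factorMonomial, hi, hj]

theorem factorMonomial_add_left : factorMonomial i j ν a b c d + Finsupp.single (Sum.inl i) 1 =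
    factorMonomial i j ν (a + 1) b c d := by
  simp only [factorMonomial, Finsupp.single_add]
  abel

theorem factorMonomial_add_right : factorMonomial i j ν a b c d + Finsupp.single (Sum.inl j) 1 =
    factorMonomial i j ν a b (c + 1) d := by
  simp only [factorMonomial, Finsupp.single_add]
  abel

theorem factorMonomial_add (x : ℕ ⊕ ℕ →₀ ℕ) : factorMonomial i j ν a b c d + x =
    factorMonomial i j (ν + x) a b c d := by
  simp only [factorMonomial]
  abel

theorem factorMonomial_sub_left (hb : b ≠ 0) :
    factorMonomial i j ν a b c d - Finsupp.single (Sum.inr i) 1 =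
      factorMonomial i j ν a (b - 1) c d := by
  obtain ⟨b, rfl⟩ := Nat.exists_eq_succ_of_ne_zero hb
  rw [← Nat.add_one, Nat.add_sub_cancel]
  refine tsub_eq_of_eq_add ?_
  simp only [factorMonomial, Finsupp.single_add]
  abel

theorem factorMonomial_sub_right (hd : d ≠ 0) :
    factorMonomial i j ν a b c d - Finsupp.single (Sum.inr j) 1 =
      factorMonomial i j ν a b c (d - 1) := by
  obtain ⟨d, rfl⟩ := Nat.exists_eq_succ_of_ne_zero hd
  rw [← Nat.add_one, Nat.add_sub_cancel]
  refine tsub_eq_of_eq_add ?_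
  simp only [factorMonomial, Finsupp.single_add]
  abel

theorem factorMonomial_sub_of_ne {l : ℕ} (hl : ν (Sum.inr l) ≠ 0) :
    factorMonomial i j ν a b c d - Finsupp.single (Sum.inr l) 1 =
      factorMonomial i j (ν - Finsupp.single (Sum.inr l) 1) a b c d := by
  refine tsub_eq_of_eq_add ?_
  rw [factorMonomial_add, tsub_add_cancel_of_le]
  rw [Finsupp.single_le_iff]
  exact Nat.one_le_iff_ne_zero.2 hl

theorem isClean_add_inl (l : ℕ) (hl : (l ≠ i ∧ l ≠ j) ∨ l = k) :
    IsClean i j k (μ + Finsupp.single (Sum.inl l) 1) ↔ IsClean i j k μ := by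
  refine forall_congr' fun m => imp_congr_right fun hm => imp_congr_right fun hk => ?_
  have : m ≠ l := by rintro rfl; tauto
  simp [this]

theorem isClean_sub_inr (l : ℕ) (hl : (l ≠ i ∧ l ≠ j) ∨ l = k) :
    IsClean i j k (μ - Finsupp.single (Sum.inr l) 1) ↔ IsClean i j k μ := by
  refine forall_congr' fun m => imp_congr_right fun hm => imp_congr_right fun hk => ?_
  have : m ≠ l := by rintro rfl; tauto
  simp [this]

end

theorem normalOrderCoeff_mul_succ (b c r : ℕ) :
    normalOrderCoeff b c r * (c + 1) = normalOrderCoeff b (c + 1) r * (c + 1 - r) := by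
  rw [normalOrderCoeff, normalOrderCoeff, mul_assoc, Nat.choose_mul_succ_eq, ← mul_assoc]

theorem normalOrderCoeff_succ_succ (b c r : ℕ) :
    normalOrderCoeff (b + 1) c (r + 1) =
      normalOrderCoeff b c (r + 1) + normalOrderCoeff b c r * (c - r) := by
  have := Nat.choose_succ_right_eq c r
  simp only [normalOrderCoeff, Nat.choose_succ_succ, Nat.factorial_succ]
  linear_combination (r.factorial * b.choose r) * this

/-- The identity between coefficients behind the Leibniz rule for `∂/∂E` and normal ordering, where
`γ a c` is the coefficient of `E^a F^b` times `E^c F^d`, for fixed `b` and `d`. -/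
theorem sum_normalOrderCoeff_leibniz (A b r : ℕ) (γ : ℕ → ℕ → Base) :
    (∑ a ∈ Finset.range (A + 1 + 1),
      (normalOrderCoeff b (A + 1 - a + r) r : Base) * γ a (A + 1 - a + r)) * ((A : Base) + 1) =
    ∑ a ∈ Finset.range (A + 1), (normalOrderCoeff b (A - a + r) r : Base) *
      (γ (a + 1) (A - a + r) * ((a : Base) + 1) +
        γ a (A - a + r + 1) * (((A - a + r : ℕ) : Base) + 1)) := by
  simp only [mul_add, Finset.sum_add_distrib]
  have h1 : ∑ a ∈ Finset.range (A + 1), (normalOrderCoeff b (A - a + r) r : Base) *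
      (γ (a + 1) (A - a + r) * (a : Base)) +
      ∑ a ∈ Finset.range (A + 1), (normalOrderCoeff b (A - a + r) r : Base) *
      (γ (a + 1) (A - a + r) * 1) = ∑ a ∈ Finset.range (A + 1 + 1),
      (normalOrderCoeff b (A + 1 - a + r) r : Base) * γ a (A + 1 - a + r) * a := by
    rw [Finset.sum_range_succ' _ (A + 1), ← Finset.sum_add_distrib]
    simp only [Nat.cast_zero, mul_zero, add_zero]
    refine Finset.sum_congr rfl fun a _ => ?_
    rw [show A + 1 - (a + 1) = A - a by omega]
    push_cast
    ring
  have h2 : ∑ a ∈ Finset.range (A + 1), (normalOrderCoeff b (A - a + r) r : Base) *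
      (γ a (A - a + r + 1) * ((A - a + r : ℕ) : Base)) +
      ∑ a ∈ Finset.range (A + 1), (normalOrderCoeff b (A - a + r) r : Base) *
      (γ a (A - a + r + 1) * 1) = ∑ a ∈ Finset.range (A + 1 + 1),
      (normalOrderCoeff b (A + 1 - a + r) r : Base) * γ a (A + 1 - a + r) * (A + 1 - a : ℕ) := by
    rw [Finset.sum_range_succ _ (A + 1), ← Finset.sum_add_distrib, Nat.sub_self, Nat.cast_zero,
      mul_zero, add_zero]
    refine Finset.sum_congr rfl fun a ha => ?_
    have ha' : a ≤ A := by simpa [Nat.lt_succ_iff] using ha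
    have h3 := normalOrderCoeff_mul_succ b (A - a + r) r
    rw [show A - a + r + 1 = A + 1 - a + r by omega] at h3 ⊢
    rw [Nat.add_sub_cancel] at h3
    have h4 : (normalOrderCoeff b (A - a + r) r : Base) * (((A - a + r : ℕ) : Base) + 1) =
        normalOrderCoeff b (A + 1 - a + r) r * (A + 1 - a : ℕ) := by
      rw [← Nat.cast_mul, ← h3, ← Nat.cast_one, ← Nat.cast_add, ← Nat.cast_mul]
      congr 2
      omega
    linear_combination γ a (A + 1 - a + r) * h4
  rw [h1, h2, ← Finset.sum_add_distrib, ← mul_add, Finset.sum_mul]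
  refine Finset.sum_congr rfl fun a ha => ?_
  rw [mul_assoc _ _ ((a : ℕ) : Base), mul_assoc _ _ ((A + 1 - a : ℕ) : Base), ← mul_add, ← mul_add,
    ← Nat.cast_add, Nat.add_sub_cancel' (by simpa [Nat.lt_succ_iff] using ha), mul_assoc]
  push_cast
  ring

/-- `∂/∂E (g h) = (∂g/∂E) h + g (∂h/∂E)`. -/
theorem pderiv_contraction_self {i j : ℕ} (hij : i ≠ j) (k r : ℕ) (g : Series) :
    pderiv Base (Sum.inl k) (contraction i j k r g) =
      contraction i j k r (pderiv Base (Sum.inl i) g + pderiv Base (Sum.inl j) g) := by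
  ext μ
  rw [coeff_pderiv]
  by_cases h : IsClean i j k μ
  · have h' := (isClean_add_inl (μ := μ) k (Or.inr rfl)).2 h
    have hi := eraseFactor_inl h (Or.inl rfl)
    have hj := eraseFactor_inl h (Or.inr rfl)
    rw [coeff_contraction_of_isClean h', coeff_contraction_of_isClean h, stitchTerm_eq, stitchTerm_eq,
      eraseFactor_add_inl, Finset.sum_comm, Finset.sum_mul, Finset.sum_comm (s := Finset.range
        (μ (Sum.inl k) + 1))]
    have h1 : (μ + Finsupp.single (Sum.inl k) 1 : ℕ ⊕ ℕ →₀ ℕ) (Sum.inl k) = μ (Sum.inl k) + 1 := by simp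
    have h2 : (μ + Finsupp.single (Sum.inl k) 1 : ℕ ⊕ ℕ →₀ ℕ) (Sum.inr k) = μ (Sum.inr k) := by simp
    rw [h1, h2]
    refine Finset.sum_congr rfl fun d _ => ?_
    rw [sum_normalOrderCoeff_leibniz _ _ _ fun a c => coeff (factorMonomial i j (eraseFactor k μ) a
      (μ (Sum.inr k) - d + r) c d) g]
    refine Finset.sum_congr rfl fun a _ => ?_
    rw [map_add, coeff_pderiv, coeff_pderiv, factorMonomial_add_left, factorMonomial_add_right,
      factorMonomial_inl_left hij hi, factorMonomial_inl_right hij hj]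
  · have h' := mt (isClean_add_inl (μ := μ) k (Or.inr rfl)).1 h
    rw [coeff_contraction_of_not_isClean h', coeff_contraction_of_not_isClean h, zero_mul]

theorem pderiv_contraction_of_ne {i j k l : ℕ} (hi : l ≠ i) (hj : l ≠ j) (hk : l ≠ k) (r : ℕ)
    (g : Series) : pderiv Base (Sum.inl l) (contraction i j k r g) =
      contraction i j k r (pderiv Base (Sum.inl l) g) := by
  ext μ
  rw [coeff_pderiv]
  by_cases h : IsClean i j k μ
  · have h' := (isClean_add_inl (μ := μ) l (Or.inl ⟨hi, hj⟩)).2 h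
    rw [coeff_contraction_of_isClean h', coeff_contraction_of_isClean h, stitchTerm_eq, stitchTerm_eq,
      eraseFactor_add_inl_of_ne hk, Finset.sum_mul]
    have h1 : (μ + Finsupp.single (Sum.inl l) 1 : ℕ ⊕ ℕ →₀ ℕ) (Sum.inl k) = μ (Sum.inl k) := by simp [hk.symm]
    have h2 : (μ + Finsupp.single (Sum.inl l) 1 : ℕ ⊕ ℕ →₀ ℕ) (Sum.inr k) = μ (Sum.inr k) := by simp
    rw [h1, h2]
    refine Finset.sum_congr rfl fun a _ => ?_
    rw [Finset.sum_mul]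
    refine Finset.sum_congr rfl fun d _ => ?_
    rw [coeff_pderiv, factorMonomial_add, factorMonomial_inl_of_ne hi hj,
      eraseFactor_apply_inl_of_ne hk, mul_assoc]
  · have h' := mt (isClean_add_inl (μ := μ) l (Or.inl ⟨hi, hj⟩)).1 h
    rw [coeff_contraction_of_not_isClean h', coeff_contraction_of_not_isClean h, zero_mul]

/-- After the multiplication, the variable `e_l` does not occur if `l ≠ k` is one of the two removed
labels. -/
theorem pderiv_contraction_of_removed {i j k l : ℕ} (hl : l = i ∨ l = j) (hk : l ≠ k) (r : ℕ)
    (g : Series) : pderiv Base (Sum.inl l) (contraction i j k r g) = 0 := by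
  ext μ
  rw [coeff_pderiv, coeff_contraction_of_not_isClean, zero_mul, coeff_zero]
  intro h
  have := (h l hl hk).1
  simp at this

theorem contraction_f_mul_of_ne {i j k l : ℕ} (hi : l ≠ i) (hj : l ≠ j) (hk : l ≠ k) (r : ℕ)
    (g : Series) : contraction i j k r (f l * g) = f l * contraction i j k r g := by
  ext μ
  rw [coeff_f_mul]
  by_cases h : IsClean i j k μ
  · rw [coeff_contraction_of_isClean h,
      coeff_contraction_of_isClean ((isClean_sub_inr (μ := μ) l (Or.inl ⟨hi, hj⟩)).2 h),
      stitchTerm_eq, stitchTerm_eq, eraseFactor_sub_inr_of_ne hk]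
    have h1 : (μ - Finsupp.single (Sum.inr l) 1 : ℕ ⊕ ℕ →₀ ℕ) (Sum.inl k) = μ (Sum.inl k) := by simp
    have h2 : (μ - Finsupp.single (Sum.inr l) 1 : ℕ ⊕ ℕ →₀ ℕ) (Sum.inr k) = μ (Sum.inr k) := by simp [hk.symm]
    rw [h1, h2]
    simp only [coeff_f_mul, factorMonomial_inr_of_ne hi hj, eraseFactor_apply_inr_of_ne hk]
    split_ifs with h0
    · simp
    · have h3 : eraseFactor k μ (Sum.inr l) ≠ 0 := by rwa [eraseFactor_apply_inr_of_ne hk]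
      simp only [factorMonomial_sub_of_ne h3]
  · have h' := mt (isClean_sub_inr (μ := μ) l (Or.inl ⟨hi, hj⟩)).1 h
    rw [coeff_contraction_of_not_isClean h', coeff_contraction_of_not_isClean h, ite_self]

theorem contraction_f_mul_right {i j : ℕ} (hij : i ≠ j) (k r : ℕ) (g : Series) :
    contraction i j k r (f j * g) = f k * contraction i j k r g := by
  ext μ
  rw [coeff_f_mul]
  by_cases h : IsClean i j k μ
  · rw [coeff_contraction_of_isClean h,
      coeff_contraction_of_isClean ((isClean_sub_inr (μ := μ) k (Or.inr rfl)).2 h),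
      stitchTerm_eq, stitchTerm_eq, eraseFactor_sub_inr]
    have h1 : (μ - Finsupp.single (Sum.inr k) 1 : ℕ ⊕ ℕ →₀ ℕ) (Sum.inl k) = μ (Sum.inl k) := by simp
    have h2 : (μ - Finsupp.single (Sum.inr k) 1 : ℕ ⊕ ℕ →₀ ℕ) (Sum.inr k) = μ (Sum.inr k) - 1 := by simp
    rw [h1, h2]
    simp only [coeff_f_mul, factorMonomial_inr_right hij (eraseFactor_inr h (Or.inr rfl))]
    generalize μ (Sum.inr k) = B
    cases B with
    | zero => simp
    | succ B =>
      rw [if_neg B.succ_ne_zero, Nat.add_sub_cancel]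
      refine Finset.sum_congr rfl fun a _ => ?_
      rw [Finset.sum_range_succ', if_pos rfl, mul_zero, add_zero]
      refine Finset.sum_congr rfl fun d _ => ?_
      rw [if_neg d.succ_ne_zero, factorMonomial_sub_right d.succ_ne_zero,
        show B + 1 - (d + 1) = B - d by omega, Nat.succ_sub_one]
  · have h' := mt (isClean_sub_inr (μ := μ) k (Or.inr rfl)).1 h
    rw [coeff_contraction_of_not_isClean h', coeff_contraction_of_not_isClean h, ite_self]

theorem contraction_zero_f_mul_left {i j : ℕ} (hij : i ≠ j) (k : ℕ) (g : Series) :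
    contraction i j k 0 (f i * g) = f k * contraction i j k 0 g := by
  ext μ
  rw [coeff_f_mul]
  by_cases h : IsClean i j k μ
  · rw [coeff_contraction_of_isClean h,
      coeff_contraction_of_isClean ((isClean_sub_inr (μ := μ) k (Or.inr rfl)).2 h),
      stitchTerm_eq, stitchTerm_eq, eraseFactor_sub_inr]
    have h1 : (μ - Finsupp.single (Sum.inr k) 1 : ℕ ⊕ ℕ →₀ ℕ) (Sum.inl k) = μ (Sum.inl k) := by simp
    have h2 : (μ - Finsupp.single (Sum.inr k) 1 : ℕ ⊕ ℕ →₀ ℕ) (Sum.inr k) = μ (Sum.inr k) - 1 := by simp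
    rw [h1, h2]
    simp only [coeff_f_mul, factorMonomial_inr_left hij (eraseFactor_inr h (Or.inl rfl))]
    generalize μ (Sum.inr k) = B
    cases B with
    | zero => simp
    | succ B =>
      rw [if_neg B.succ_ne_zero, Nat.add_sub_cancel]
      refine Finset.sum_congr rfl fun a _ => ?_
      rw [Finset.sum_range_succ, if_pos (by simp), mul_zero, add_zero]
      refine Finset.sum_congr rfl fun d hd => ?_
      have hd' : d ≤ B := by simpa [Nat.lt_succ_iff] using hd
      rw [if_neg (by omega), factorMonomial_sub_left (by omega),
        show B + 1 - d + 0 - 1 = B - d + 0 by omega]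
      simp [normalOrderCoeff]
  · have h' := mt (isClean_sub_inr (μ := μ) k (Or.inr rfl)).1 h
    rw [coeff_contraction_of_not_isClean h', coeff_contraction_of_not_isClean h, ite_self]

/-- In the Weyl algebra, `F` is moved past `h` at the cost of `∂h/∂E`. -/
theorem contraction_succ_f_mul_left {i j : ℕ} (hij : i ≠ j) (k r : ℕ) (g : Series) :
    contraction i j k (r + 1) (f i * g) =
      f k * contraction i j k (r + 1) g + contraction i j k r (pderiv Base (Sum.inl j) g) := by
  ext μ
  rw [map_add, coeff_f_mul]
  by_cases h : IsClean i j k μ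
  · have hj := eraseFactor_inl h (Or.inr rfl)
    rw [coeff_contraction_of_isClean h, coeff_contraction_of_isClean h,
      coeff_contraction_of_isClean ((isClean_sub_inr (μ := μ) k (Or.inr rfl)).2 h),
      stitchTerm_eq, stitchTerm_eq, stitchTerm_eq, eraseFactor_sub_inr]
    have h1 : (μ - Finsupp.single (Sum.inr k) 1 : ℕ ⊕ ℕ →₀ ℕ) (Sum.inl k) = μ (Sum.inl k) := by simp
    have h2 : (μ - Finsupp.single (Sum.inr k) 1 : ℕ ⊕ ℕ →₀ ℕ) (Sum.inr k) = μ (Sum.inr k) - 1 := by simp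
    rw [h1, h2]
    simp only [coeff_f_mul, factorMonomial_inr_left hij (eraseFactor_inr h (Or.inl rfl)),
      coeff_pderiv, factorMonomial_inl_right hij hj, factorMonomial_add_right]
    generalize μ (Sum.inl k) = A
    generalize μ (Sum.inr k) = B
    have h3 : ∀ a d : ℕ, (normalOrderCoeff (B - d + (r + 1)) (A - a + (r + 1)) (r + 1) : Base) *
        (if B - d + (r + 1) = 0 then 0 else
          coeff (factorMonomial i j (eraseFactor k μ) a (B - d + (r + 1)) (A - a + (r + 1)) d
            - Finsupp.single (Sum.inr i) 1) g) =
        (normalOrderCoeff (B - d + r) (A - a + (r + 1)) (r + 1) : Base) *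
          coeff (factorMonomial i j (eraseFactor k μ) a (B - d + r) (A - a + (r + 1)) d) g +
        (normalOrderCoeff (B - d + r) (A - a + r) r : Base) *
          (coeff (factorMonomial i j (eraseFactor k μ) a (B - d + r) (A - a + r + 1) d) g *
            (((A - a + r : ℕ) : Base) + 1)) := by
      intro a d
      rw [if_neg (by omega), factorMonomial_sub_left (by omega),
        show B - d + (r + 1) - 1 = B - d + r by omega, ← add_assoc, normalOrderCoeff_succ_succ,
        ← add_assoc, ← normalOrderCoeff_mul_succ]
      push_cast
      ring
    simp only [h3, Finset.sum_add_distrib, add_left_inj]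
    cases B with
    | zero => simp [normalOrderCoeff]
    | succ B =>
      rw [if_neg B.succ_ne_zero, Nat.add_sub_cancel]
      refine Finset.sum_congr rfl fun a _ => ?_
      have h4 : normalOrderCoeff (B + 1 - (B + 1) + r) (A - a + (r + 1)) (r + 1) = 0 := by
        simp [normalOrderCoeff]
      rw [Finset.sum_range_succ, h4, Nat.cast_zero, zero_mul, add_zero]
      refine Finset.sum_congr rfl fun d hd => ?_
      have hd' : d ≤ B := by simpa [Nat.lt_succ_iff] using hd
      rw [show B + 1 - d + r = B - d + (r + 1) by omega]
  · have h' := mt (isClean_sub_inr (μ := μ) k (Or.inr rfl)).1 h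
    rw [coeff_contraction_of_not_isClean h', coeff_contraction_of_not_isClean h,
      coeff_contraction_of_not_isClean h, ite_self, add_zero]

end

/-! ### The value after a stitching -/

section

open MvPowerSeries

/-- The effect of the stitching `m_k^{ij}` on a family indexed by labels. -/
def merge {M : Type*} [AddCommMonoid M] (i j k : ℕ) (v : ℕ → M) : ℕ → M :=
  fun l => if l = k then v i + v j else if l = i ∨ l = j then 0 else v l

/-- The quadratic form of `m_k^{ij}(ω exp (∑ G_{ll'} e_l f_{l'}))`. -/
noncomputable def stitchMatrix (i j k : ℕ) (G : ℕ → ℕ → Base) : ℕ → ℕ → Base :=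
  fun l l' => merge i j k (fun p => merge i j k (fun q => G p q + G p i * G j q / (1 - G j i)) l') l

theorem fForm_merge {i j k : ℕ} {L : Finset ℕ} (hk : k = i ∨ k = j ∨ k ∉ L)
    (c : ℕ → Base) :
    fForm (insert k L) (merge i j k c) =
      fForm (L \ {i, j}) c + C (c i + c j) * f k := by
  have h1 : ∀ l ∈ insert k L, l ∉ insert k (L \ {i, j}) → C (merge i j k c l) * f l = 0 := by
    intro l hl hl'
    have : merge i j k c l = 0 := by
      rw [merge, if_neg (by grind), if_pos (by grind)]
    rw [this, map_zero, zero_mul]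
  rw [fForm, ← Finset.sum_subset (Finset.insert_subset_insert k Finset.sdiff_subset) h1,
    Finset.sum_insert (by grind), add_comm, fForm]
  congr 1
  · refine Finset.sum_congr rfl fun l hl => ?_
    rw [merge, if_neg (by grind), if_neg (by grind)]
  · rw [merge, if_pos rfl]

/-- The partial sums of `m_k^{ij}(g)`. -/
noncomputable def partialMul (i j k N : ℕ) (g : Series) : Series :=
  ∑ r ∈ Finset.range N, contraction i j k r g

theorem partialMul_fForm_mul (i j k N : ℕ) (L : Finset ℕ) (c : ℕ → Base) (g : Series) :
    partialMul i j k N (fForm L c * g) = ∑ l ∈ L, C (c l) * partialMul i j k N (f l * g) := by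
  have hadd : ∀ g g', partialMul i j k N (g + g') =
      partialMul i j k N g + partialMul i j k N g' := fun g g' => by
    simp only [partialMul, contraction_add, Finset.sum_add_distrib]
  have hC : ∀ c g, partialMul i j k N (C c * g) = C c * partialMul i j k N g := fun c g => by
    simp only [partialMul, contraction_C_mul, Finset.mul_sum]
  rw [fForm, Finset.sum_mul]
  induction L using Finset.induction_on with
  | empty => simpa using hC 0 0
  | insert a s ha ih => rw [Finset.sum_insert ha, Finset.sum_insert ha, hadd, ih, mul_assoc, hC]

/-- The error in the rule for moving `F` past a series, if only less than `N` contractions are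
counted. -/
noncomputable def lastContraction (i j k : ℕ) (g : Series) : ℕ → Series
  | 0 => 0
  | N + 1 => contraction i j k N (pderiv Base (Sum.inl j) g)

/-- In the product, `F` is moved from the end of the first factor past the second factor. -/
theorem partialMul_f_mul_left {i j : ℕ} (hij : i ≠ j) (k N : ℕ) (g : Series) :
    partialMul i j k N (f i * g) = f k * partialMul i j k N g +
      partialMul i j k N (pderiv Base (Sum.inl j) g) - lastContraction i j k g N := by
  cases N with
  | zero => simp [partialMul, lastContraction]
  | succ N =>
    rw [partialMul, Finset.sum_range_succ', contraction_zero_f_mul_left hij, partialMul,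
      Finset.sum_range_succ', partialMul, Finset.sum_range_succ _ N, lastContraction]
    simp only [contraction_succ_f_mul_left hij, Finset.sum_add_distrib, ← Finset.mul_sum]
    ring

theorem eDegree_eraseFactor (k : ℕ) (μ : ℕ ⊕ ℕ →₀ ℕ) :
    eDegree μ = eDegree (eraseFactor k μ) + μ (Sum.inl k) := by
  have : μ = eraseFactor k μ + Finsupp.single (Sum.inl k) (μ (Sum.inl k)) +
      Finsupp.single (Sum.inr k) (μ (Sum.inr k)) := by
    ext x
    by_cases h1 : x = Sum.inl k <;> by_cases h2 : x = Sum.inr k <;> simp [eraseFactor, h1, h2]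
  conv_lhs => rw [this]
  simp

/-- A term with `r` contractions comes from a coefficient of degree at least `r`, so it vanishes at
`t^{1/2} = 1` to this order. -/
theorem isSmall_stitchTerm {i j k : ℕ} {g : Series}
    (hg : ∀ μ, IsSmall (eDegree μ) (coeff μ g)) (μ : ℕ ⊕ ℕ →₀ ℕ) (r : ℕ) :
    IsSmall r (stitchTerm i j k g μ r) := by
  rw [stitchTerm_eq]
  refine IsSmall.sum _ _ fun a _ => IsSmall.sum _ _ fun d _ => ?_
  refine (IsSmall.natCast _).mul_left ((hg _).mono ?_)
  simp only [factorMonomial, map_add, eDegree_single_inl, eDegree_single_inr]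
  omega

theorem convergesTo_lastContraction {i j k : ℕ} {g : Series}
    (hg : ∀ μ, IsSmall (eDegree μ) (coeff μ g)) (μ : ℕ ⊕ ℕ →₀ ℕ) :
    ConvergesTo (fun N => coeff μ (lastContraction i j k g N)) 0 := by
  intro n
  refine ⟨n + 1, fun N hN => ?_⟩
  obtain ⟨N, rfl⟩ : ∃ M, N = M + 1 := ⟨N - 1, by omega⟩
  have : IsSmall n (coeff μ (lastContraction i j k g (N + 1))) := by
    rw [lastContraction]
    by_cases h : IsClean i j k μ
    · rw [coeff_contraction_of_isClean h]
      refine (isSmall_stitchTerm (fun ν => ?_) μ N).mono (by omega)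
      rw [coeff_pderiv, mul_comm]
      refine IsSmall.mul_left ?_ ((hg _).mono (by rw [map_add]; omega))
      exact (IsSmall.natCast _).add IsSmall.one
    · rw [coeff_contraction_of_not_isClean h]
      exact IsSmall.zero n
  have h2 := this.neg
  rwa [← zero_sub] at h2

section

variable {L : Finset ℕ} {ω : Base} {G : ℕ → ℕ → Base} {g : Series}

/-- The contribution of `r` contractions to the constant term is a term of a geometric series. -/
theorem IsGaussian.coeff_pairing (h : IsGaussian L ω G g) {i j : ℕ} (hij : i ≠ j) (r : ℕ) :
    (normalOrderCoeff r r r : Base) * coeff (factorMonomial i j 0 0 r r 0) g = ω * G j i ^ r := by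
  have h0 : ∀ r, normalOrderCoeff r r r = r.factorial := by simp [normalOrderCoeff]
  rw [h0]
  induction r with
  | zero => simp [factorMonomial, h.coeff_zero]
  | succ r ih =>
    rw [← factorMonomial_add_right, h.coeff_add_single, factorMonomial_inl_right hij (by simp),
      Finset.sum_eq_single i]
    · rw [factorMonomial_inr_left hij (by simp), if_neg r.succ_ne_zero,
        factorMonomial_sub_left r.succ_ne_zero, Nat.succ_sub_one, pow_succ, ← mul_assoc ω, ← ih,
        Nat.factorial_succ]
      have : (r : Base) + 1 ≠ 0 := Nat.cast_add_one_ne_zero r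
      push_cast
      field_simp
    · intro l _ hl
      by_cases hj : l = j
      · rw [hj, factorMonomial_inr_right hij (by simp), if_pos rfl, mul_zero]
      · rw [factorMonomial_inr_of_ne hl hj, Finsupp.zero_apply, if_pos rfl, mul_zero]
    · intro hi
      rw [h.col_eq_zero j i hi, zero_mul]

theorem isSmall_stitchMatrix (i j k : ℕ) (hG : ∀ l l', IsSmall 1 (G l l')) (l l' : ℕ) :
    IsSmall 1 (stitchMatrix i j k G l l') := by
  have hH : ∀ p q, IsSmall 1 (G p q + G p i * G j q / (1 - G j i)) := fun p q => by
    rw [div_eq_mul_inv, mul_comm]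
    exact (hG p q).add
      ((hG j i).inv_one_sub.mul_left (((hG p i).mul (hG j q)).mono (by omega)))
  have hm : ∀ v : ℕ → Base, (∀ p, IsSmall 1 (v p)) → ∀ p, IsSmall 1 (merge i j k v p) :=
    fun v hv p => by
      rw [merge]
      split_ifs
      exacts [(hv i).add (hv j), IsSmall.zero 1, hv p]
  exact hm _ (fun p => hm _ (hH p) l') l

theorem merge_eq_zero {M : Type*} [AddCommMonoid M] {i j k : ℕ} {v : ℕ → M} (hv : ∀ p, v p = 0)
    (l : ℕ) : merge i j k v l = 0 := by
  simp [merge, hv]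

theorem stitchMatrix_row_eq_zero (h : IsGaussian L ω G g) (i j k : ℕ) (l l' : ℕ)
    (hl : l ∉ insert k L) : stitchMatrix i j k G l l' = 0 := by
  rw [Finset.mem_insert, not_or] at hl
  rw [stitchMatrix, merge, if_neg hl.1]
  split_ifs
  · rfl
  · exact merge_eq_zero (fun q => by simp [h.row_eq_zero l _ hl.2]) l'

theorem stitchMatrix_col_eq_zero (h : IsGaussian L ω G g) (i j k : ℕ) (l l' : ℕ)
    (hl' : l' ∉ insert k L) : stitchMatrix i j k G l l' = 0 := by
  rw [Finset.mem_insert, not_or] at hl'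
  refine merge_eq_zero (fun p => ?_) l
  simp [merge, hl'.1, h.col_eq_zero _ l' hl'.2]

/-- The partial sums of `m_k^{ij}(g)` satisfy the differential equations of a Gaussian series, up to
an error that tends to zero. -/
theorem IsGaussian.pderiv_partialMul (h : IsGaussian L ω G g) (hG : ∀ l l', IsSmall 1 (G l l'))
    {i j k : ℕ} (hij : i ≠ j) (hi : i ∈ L) (hj : j ∈ L) (hk : k = i ∨ k = j ∨ k ∉ L) (l : ℕ) :
    ∃ c : Base, IsSmall 0 c ∧ ∀ N, pderiv Base (Sum.inl l) (partialMul i j k N g) =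
      fForm (insert k L) (stitchMatrix i j k G l) * partialMul i j k N g +
        C c * lastContraction i j k g N := by
  have hx := (hG j i).one_sub_ne_zero
  have hC : C (1 - G j i)⁻¹ * C (1 - G j i) = (1 : Series) := by
    rw [← map_mul, inv_mul_cancel₀ hx, map_one]
  -- The image of the derivatives, where `f_i` is not yet eliminated.
  have h1 : ∀ p N, partialMul i j k N (pderiv Base (Sum.inl p) g) =
      (fForm (L \ {i, j}) (G p) + C (G p j) * f k) * partialMul i j k N g +
        C (G p i) * partialMul i j k N (f i * g) := by
    intro p N
    rw [h.pderiv_eq, partialMul_fForm_mul, ← Finset.sum_sdiff (s₁ := {i, j}) (by grind),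
      Finset.sum_pair hij, fForm, add_mul, Finset.sum_mul, add_assoc]
    congr 1
    · refine Finset.sum_congr rfl fun l hl => ?_
      rw [mul_assoc]
      congr 1
      simp only [partialMul, Finset.mul_sum]
      refine Finset.sum_congr rfl fun r _ => contraction_f_mul_of_ne ?_ ?_ ?_ r g <;> grind
    · rw [add_comm, mul_assoc]
      congr 2
      simp only [partialMul, Finset.mul_sum, contraction_f_mul_right hij]
  have h2 : ∀ N, partialMul i j k N (f i * g) = C (1 - G j i)⁻¹ *
      ((f k + fForm (L \ {i, j}) (G j) + C (G j j) * f k) * partialMul i j k N g -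
        lastContraction i j k g N) := by
    intro N
    have h3 := partialMul_f_mul_left hij k N g
    rw [h1] at h3
    rw [map_sub, map_one] at hC
    linear_combination (-partialMul i j k N (f i * g)) * hC + C (1 - G j i)⁻¹ * h3
  -- The derivatives in terms of the partial sums alone.
  have h4 : ∀ p N, partialMul i j k N (pderiv Base (Sum.inl p) g) =
      fForm (insert k L) (merge i j k fun q => G p q + G p i * G j q / (1 - G j i)) *
        partialMul i j k N g +
      C (-(G p i * (1 - G j i)⁻¹)) * lastContraction i j k g N := by
    intro p N
    have h5 : (fun q => G p q + G p i * G j q / (1 - G j i)) =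
        fun q => G p q + (G p i * (1 - G j i)⁻¹) * G j q := by
      funext q; ring
    rw [h1, h2, h5, fForm_merge hk, fForm_add, fForm_mul_left]
    simp only [map_add, map_mul, map_neg]
    rw [map_sub, map_one] at hC
    linear_combination (C (G p i) * f k * partialMul i j k N g) * hC
  by_cases hlk : l = k
  · refine ⟨-(G i i * (1 - G j i)⁻¹) + -(G j i * (1 - G j i)⁻¹), ?_, fun N => ?_⟩
    · have := (hG j i).inv_one_sub
      exact (((hG i i).mono (by omega)).mul this).neg.add (((hG j i).mono (by omega)).mul this).neg
    · have h6 : pderiv Base (Sum.inl l) (partialMul i j k N g) =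
          partialMul i j k N (pderiv Base (Sum.inl i) g) +
          partialMul i j k N (pderiv Base (Sum.inl j) g) := by
        rw [hlk]
        simp only [partialMul, map_sum, pderiv_contraction_self hij, contraction_add,
          Finset.sum_add_distrib]
      have h7 : stitchMatrix i j k G l = fun l' =>
          merge i j k (fun q => G i q + G i i * G j q / (1 - G j i)) l' +
          merge i j k (fun q => G j q + G j i * G j q / (1 - G j i)) l' := by
        funext l'
        rw [stitchMatrix, merge, if_pos hlk]
      rw [h6, h4, h4, h7, fForm_add, map_add]
      ring
  · by_cases hl : l = i ∨ l = j
    · refine ⟨0, IsSmall.zero 0, fun N => ?_⟩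
      have h7 : stitchMatrix i j k G l = 0 := by
        funext l'
        rw [stitchMatrix, merge, if_neg hlk, if_pos hl, Pi.zero_apply]
      have h8 : fForm (insert k L) (0 : ℕ → Base) = 0 := by simp [fForm]
      rw [h7, h8, partialMul, map_sum, zero_mul, map_zero, zero_mul, add_zero]
      exact Finset.sum_eq_zero fun r _ => pderiv_contraction_of_removed hl hlk r g
    · refine ⟨-(G l i * (1 - G j i)⁻¹), ?_, fun N => ?_⟩
      · exact (((hG l i).mono (by omega)).mul (hG j i).inv_one_sub).neg
      · have h6 : pderiv Base (Sum.inl l) (partialMul i j k N g) =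
            partialMul i j k N (pderiv Base (Sum.inl l) g) := by
          simp only [partialMul, map_sum]
          refine Finset.sum_congr rfl fun r _ => pderiv_contraction_of_ne ?_ ?_ hlk r g <;> tauto
        have h7 : stitchMatrix i j k G l =
            merge i j k fun q => G l q + G l i * G j q / (1 - G j i) := by
          funext l'
          rw [stitchMatrix, merge, if_neg hlk, if_neg hl]
        rw [h6, h4, h7]

/-- The constant term of the limit is a geometric series, and the other coefficients are found
recursively from the differential equations. -/
theorem IsGaussian.convergesTo_partialMul (h : IsGaussian L ω G g) (hω : IsSmall 0 ω)
    (hG : ∀ l l', IsSmall 1 (G l l')) {i j k : ℕ} (hij : i ≠ j) (hi : i ∈ L) (hj : j ∈ L)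
    (hk : k = i ∨ k = j ∨ k ∉ L) {g' : Series}
    (h' : IsGaussian (insert k L) (ω / (1 - G j i)) (stitchMatrix i j k G) g')
    (μ : ℕ ⊕ ℕ →₀ ℕ) : ConvergesTo (fun N => coeff μ (partialMul i j k N g)) (coeff μ g') := by
  refine monomial_induction
    (P := fun μ => ConvergesTo (fun N => coeff μ (partialMul i j k N g)) (coeff μ g'))
    (fun μ hμ => ?_) (fun μ l ih => ?_) μ
  · have hA : ∀ l, μ (Sum.inl l) = 0 := eDegree_eq_zero_iff.1 hμ
    by_cases h0 : μ = 0
    · subst h0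
      have hclean : IsClean i j k 0 := fun l _ _ => ⟨rfl, rfl⟩
      have h1 : ∀ r, coeff 0 (contraction i j k r g) = ω * G j i ^ r := fun r => by
        rw [coeff_contraction_of_isClean hclean, stitchTerm_eq, ← h.coeff_pairing hij r]
        simp [eraseFactor]
      have h2 := (convergesTo_geometric (hG j i)).mul_left hω
      rw [h'.coeff_zero, div_eq_mul_inv]
      simpa only [partialMul, map_sum, h1, Finset.mul_sum] using h2
    · rw [h'.coeff_of_eDegree_eq_zero μ hμ h0]
      have h1 : ∀ r, coeff μ (contraction i j k r g) = 0 := fun r => by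
        by_cases hc : IsClean i j k μ
        · rw [coeff_contraction_of_isClean hc, stitchTerm_eq, hA k]
          refine Finset.sum_eq_zero fun a ha => Finset.sum_eq_zero fun d hd => ?_
          rw [h.coeff_eq_zero, mul_zero]
          simp only [Finset.mem_range, Nat.lt_succ_iff] at ha hd
          have h2 := eDegree_eraseFactor k μ
          have h3 : fDegree (eraseFactor k μ) + μ (Sum.inr k) ≠ 0 := by
            intro h3
            rw [Nat.add_eq_zero_iff, fDegree_eq_zero_iff] at h3
            refine h0 (Finsupp.ext fun x => ?_)
            rcases x with x | x
            · exact hA x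
            · by_cases hx : x = k
              · rw [hx, h3.2]; rfl
              · rw [← eraseFactor_apply_inr_of_ne hx, h3.1 x]; rfl
          simp only [factorMonomial, map_add, eDegree_single_inl, eDegree_single_inr,
            fDegree_single_inl, fDegree_single_inr]
          omega
        · exact coeff_contraction_of_not_isClean hc r g
      simpa only [partialMul, map_sum, h1, Finset.sum_const_zero] using ConvergesTo.const 0
  · obtain ⟨c, hc, hD⟩ := h.pderiv_partialMul hG hij hi hj hk l
    have hn : ∀ q : Series, coeff (μ + Finsupp.single (Sum.inl l) 1) q =
        ((μ (Sum.inl l) : Base) + 1)⁻¹ * coeff μ (pderiv Base (Sum.inl l) q) := fun q => by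
      rw [coeff_pderiv, mul_comm, mul_assoc, mul_inv_cancel₀ (Nat.cast_add_one_ne_zero _), mul_one]
    simp only [hn, hD, h'.pderiv_eq, map_add, coeff_C_mul, coeff_fForm_mul]
    refine ConvergesTo.mul_left (isSmall_inv_natCast_add_one _) ?_
    have h3 := (convergesTo_lastContraction (i := i) (j := j) (k := k)
      (h.isSmall_coeff hω hG) μ).mul_left hc
    rw [mul_zero] at h3
    refine (?_ : ConvergesTo _ _).add h3 |> fun h => by rwa [add_zero] at h
    refine ConvergesTo.sum _ fun l' _ => ConvergesTo.mul_left ?_ ?_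
    · exact (isSmall_stitchMatrix i j k hG l l').mono (by omega)
    · split_ifs with h0
      · exact ConvergesTo.const 0
      · exact ih l' h0

/-- The multiplication of Gaussian series. -/
theorem IsGaussian.isMul (h : IsGaussian L ω G g) (hω : IsSmall 0 ω)
    (hG : ∀ l l', IsSmall 1 (G l l')) {i j k : ℕ} (hij : i ≠ j) (hi : i ∈ L) (hj : j ∈ L)
    (hk : k = i ∨ k = j ∨ k ∉ L) {g' : Series}
    (h' : IsGaussian (insert k L) (ω / (1 - G j i)) (stitchMatrix i j k G) g') :
    IsMul i j k g g' := by
  intro μ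
  have h1 := h.convergesTo_partialMul hω hG hij hi hj hk h' μ
  refine ⟨fun ⟨l, hl, hlk, h0⟩ => ?_, fun hc => ?_⟩
  · have hc : ¬ IsClean i j k μ := fun hc => by
      obtain ⟨h2, h3⟩ := hc l hl hlk
      tauto
    simp only [partialMul, map_sum, coeff_contraction_of_not_isClean hc,
      Finset.sum_const_zero] at h1
    exact h1.unique (ConvergesTo.const 0)
  · have hc : IsClean i j k μ := hc
    simpa only [partialMul, map_sum, coeff_contraction_of_isClean hc] using h1

end

/-- The result of a multiplication is determined, because limits are unique. -/
theorem IsMul.unique {i j k : ℕ} {g g' g'' : Series} (h' : IsMul i j k g g')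
    (h'' : IsMul i j k g g'') : g' = g'' := by
  ext μ
  by_cases hc : IsClean i j k μ
  · exact ((h' μ).2 hc).unique ((h'' μ).2 hc)
  · have : ∃ l, (l = i ∨ l = j) ∧ l ≠ k ∧ (μ (Sum.inl l) ≠ 0 ∨ μ (Sum.inr l) ≠ 0) := by
      simp only [IsClean, not_forall] at hc
      obtain ⟨l, hl, hlk, h⟩ := hc
      exact ⟨l, hl, hlk, by tauto⟩
    rw [(h' μ).1 this, (h'' μ).1 this]

end

/-! ### Additive functions of diagrams -/

/-- The sum of the rotation numbers of the edges of a strand. -/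
def Strand.rotation (a : Strand) : ℤ := a.first + (a.rest.map Prod.snd).sum

theorem addToLast_passes (r : ℤ) (l : List (Pass × ℤ)) :
    (addToLast r l).map Prod.fst = l.map Prod.fst := by
  induction l with
  | nil => rfl
  | cons x l ih =>
    cases l with
    | nil => rfl
    | cons y l => simp only [addToLast, List.map_cons] at ih ⊢; rw [ih]

theorem addToLast_rotation (r : ℤ) (l : List (Pass × ℤ)) (hl : l ≠ []) :
    ((addToLast r l).map Prod.snd).sum = (l.map Prod.snd).sum + r := by
  induction l with
  | nil => exact absurd rfl hl
  | cons x l ih =>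
    cases l with
    | nil => simp [addToLast]
    | cons y l =>
      have := ih (by simp)
      simp only [addToLast, List.map_cons, List.sum_cons] at this ⊢
      rw [this]
      ring

theorem Strand.passes_append (a b : Strand) : (a.append b).passes = a.passes ++ b.passes := by
  obtain ⟨x, l⟩ := a
  cases l with
  | nil => rfl
  | cons y l => simp [Strand.append, Strand.passes, addToLast_passes]

theorem Strand.rotation_append (a b : Strand) :
    (a.append b).rotation = a.rotation + b.rotation := by
  obtain ⟨x, l⟩ := a
  cases l with
  | nil => simp [Strand.append, Strand.rotation, add_assoc]
  | cons y l =>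
    simp only [Strand.append, Strand.rotation, List.map_append, List.sum_append]
    rw [addToLast_rotation _ _ (by simp)]
    ring

/-- The number of pairs of passages of a list, of which the first is `p` and the second is `q`. -/
def pairCount (p q : Pass) : List Pass → ℤ
  | [] => 0
  | x :: l => (if x = p then (l.count q : ℤ) else 0) + pairCount p q l

theorem pairCount_append (p q : Pass) (l l' : List Pass) :
    pairCount p q (l ++ l') = pairCount p q l + pairCount p q l' + l.count p * l'.count q := by
  induction l with
  | nil => simp [pairCount]
  | cons x l ih =>
    simp only [List.cons_append, pairCount, ih, List.count_append, List.count_cons, beq_iff_eq]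
    split_ifs <;> push_cast <;> ring

theorem pairCount_eq_zero_of_left {p q : Pass} {l : List Pass} (h : p ∉ l) :
    pairCount p q l = 0 := by
  induction l with
  | nil => rfl
  | cons x l ih =>
    rw [List.mem_cons, not_or] at h
    rw [pairCount, if_neg (Ne.symm h.1), ih h.2, add_zero]

theorem pairCount_eq_zero_of_right {p q : Pass} {l : List Pass} (h : q ∉ l) :
    pairCount p q l = 0 := by
  induction l with
  | nil => rfl
  | cons x l ih =>
    rw [List.mem_cons, not_or] at h
    rw [pairCount, List.count_eq_zero_of_not_mem h.2, ih h.2, Nat.cast_zero, ite_self, add_zero]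

/-- The value of a function of strands on the component with a given label. -/
def Diagram.eval (D : Diagram) (F : Strand → ℤ) (l : ℕ) : ℤ := (D.strand l).elim 0 F

/-- The sum of a function of strands over the components of a diagram. -/
noncomputable def Diagram.total (D : Diagram) (F : Strand → ℤ) : ℤ := ∑ᶠ l, D.eval F l

/-- The labels of a diagram. -/
def Diagram.labels (D : Diagram) : Set ℕ := {l | D.strand l ≠ none}

theorem Diagram.eval_of_none {D : Diagram} {l : ℕ} (h : D.strand l = none) (F : Strand → ℤ) :
    D.eval F l = 0 := by rw [Diagram.eval, h]; rfl

theorem Diagram.eval_of_some {D : Diagram} {l : ℕ} {a : Strand} (h : D.strand l = some a)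
    (F : Strand → ℤ) : D.eval F l = F a := by rw [Diagram.eval, h]; rfl

theorem Diagram.hasFiniteSupport_eval {D : Diagram} (hD : D.labels.Finite) (F : Strand → ℤ) :
    (Function.support (D.eval F)).Finite :=
  hD.subset fun _ hl h => hl (Diagram.eval_of_none h F)

theorem Diagram.total_eq_zero {D : Diagram} {F : Strand → ℤ}
    (h : ∀ l a, D.strand l = some a → F a = 0) : D.total F = 0 := by
  rw [Diagram.total, ← finsum_zero (α := ℕ)]
  refine finsum_congr fun l => ?_
  cases hl : D.strand l with
  | none => exact Diagram.eval_of_none hl F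
  | some a => rw [Diagram.eval_of_some hl, h l a hl]

theorem Diagram.total_of_single {D : Diagram} {l : ℕ} {a : Strand} (h : D.strand l = some a)
    (h' : ∀ m, m ≠ l → D.strand m = none) (F : Strand → ℤ) : D.total F = F a := by
  rw [Diagram.total, finsum_eq_single _ l fun m hm => Diagram.eval_of_none (h' m hm) F,
    Diagram.eval_of_some h]

theorem Diagram.eval_union {D D' : Diagram} (h : D.Disjoint D') (F : Strand → ℤ) (l : ℕ) :
    (D.union D').eval F l = D.eval F l + D'.eval F l := by
  rcases h.1 l with h | h
  · simp [Diagram.eval, Diagram.union, h]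
  · simp [Diagram.eval, Diagram.union, h]

theorem Diagram.sign_union (D D' : Diagram) (c : ℕ) :
    (D.union D').sign c = D.sign c + D'.sign c := rfl

theorem Diagram.labels_union (D D' : Diagram) :
    (D.union D').labels = D.labels ∪ D'.labels := by
  ext l
  simp only [Diagram.labels, Diagram.union, Set.mem_union, Set.mem_ofPred_eq]
  cases D.strand l <;> simp

theorem Diagram.total_union {D D' : Diagram} (h : D.Disjoint D') (hD : D.labels.Finite)
    (hD' : D'.labels.Finite) (F : Strand → ℤ) :
    (D.union D').total F = D.total F + D'.total F := by
  rw [Diagram.total, Diagram.total, Diagram.total, ← finsum_add_distrib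
    (Diagram.hasFiniteSupport_eval hD F) (Diagram.hasFiniteSupport_eval hD' F)]
  exact finsum_congr fun l => Diagram.eval_union h F l

section

variable {i j k : ℕ} {D D' : Diagram}

theorem Diagram.IsStitch.labels_eq (h : D.IsStitch i j k D') :
    D'.labels = insert k (D.labels \ {i, j}) := by
  obtain ⟨hij, hk, a, b, ha, hb, hs, hD⟩ := h
  ext l
  simp only [Diagram.labels, hD, Set.mem_insert_iff, Set.mem_sdiff, Set.mem_ofPred_eq,
    Set.mem_singleton_iff]
  split_ifs <;> simp_all

theorem Diagram.IsStitch.finite_labels (h : D.IsStitch i j k D') (hD : D.labels.Finite) :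
    D'.labels.Finite := by
  rw [h.labels_eq]
  exact (hD.subset Set.sdiff_subset).insert k

/-- An additive function changes under stitching like the labels do. -/
theorem Diagram.IsStitch.eval_eq (h : D.IsStitch i j k D') {F : Strand → ℤ}
    (hF : ∀ a b, F (a.append b) = F a + F b) : D'.eval F = merge i j k (D.eval F) := by
  obtain ⟨hij, hk, a, b, ha, hb, hs, hD⟩ := h
  funext l
  rw [Diagram.eval, hD, merge]
  dsimp only
  split_ifs with h1 h2
  · simp [hF, Diagram.eval, ha, hb]
  · rfl
  · rfl

/-- The total of a function that is additive up to the constant `x` for the two strands that are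
joined. -/
theorem Diagram.IsStitch.total_eq (h : D.IsStitch i j k D') (hD : D.labels.Finite)
    {F : Strand → ℤ} {x : ℤ}
    (hF : ∀ a b, D.strand i = some a → D.strand j = some b → F (a.append b) = F a + F b + x) :
    D'.total F = D.total F + x := by
  have hfin := h.finite_labels hD
  obtain ⟨hij, hk, a, b, ha, hb, hs, hD'⟩ := h
  have key : ∀ l, D'.eval F l + Pi.single (M := fun _ => ℤ) i (F a) l
      + Pi.single (M := fun _ => ℤ) j (F b) l =
      D.eval F l + Pi.single (M := fun _ => ℤ) k (F a + F b + x) l := by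
    intro l
    simp only [Diagram.eval, hD', Pi.single_apply]
    by_cases h1 : l = k <;> by_cases h2 : l = i <;> by_cases h3 : l = j <;> simp_all
    · omega
    · omega
  have hsingle : ∀ (m : ℕ) (y : ℤ), ∑ᶠ l, Pi.single (M := fun _ => ℤ) m y l = y := fun m y => by
    rw [finsum_eq_single _ m fun l hl => by rw [Pi.single_eq_of_ne hl], Pi.single_eq_same]
  have hsupp : ∀ (m : ℕ) (y : ℤ), (Function.support (Pi.single (M := fun _ => ℤ) m y)).Finite :=
    fun m y => (Set.finite_singleton m).subset Pi.support_single_subset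
  have h1 := finsum_congr key
  rw [finsum_add_distrib ?_ (hsupp _ _), finsum_add_distrib (Diagram.hasFiniteSupport_eval hfin F)
    (hsupp _ _), finsum_add_distrib (Diagram.hasFiniteSupport_eval hD F) (hsupp _ _), hsingle,
    hsingle, hsingle] at h1
  · rw [Diagram.total, Diagram.total]
    linarith
  · exact ((Diagram.hasFiniteSupport_eval hfin F).union (hsupp i (F a))).subset
      (Function.support_add _ _)

end

theorem Diagram.strand_crossing_left (σ : ℤˣ) (c i j : ℕ) :
    (Diagram.crossing σ c i j).strand i = some (Strand.ofPass ⟨c, true⟩) := if_pos rfl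

theorem Diagram.strand_crossing_right (σ : ℤˣ) (c : ℕ) {i j : ℕ} (hij : i ≠ j) :
    (Diagram.crossing σ c i j).strand j = some (Strand.ofPass ⟨c, false⟩) := by
  simp [Diagram.crossing, hij.symm]

theorem Diagram.strand_crossing_of_ne (σ : ℤˣ) (c : ℕ) {i j l : ℕ} (hi : l ≠ i) (hj : l ≠ j) :
    (Diagram.crossing σ c i j).strand l = none := by
  simp [Diagram.crossing, hi, hj]

theorem Diagram.exists_of_strand_crossing {σ : ℤˣ} {c i j l : ℕ} {a : Strand}
    (h : (Diagram.crossing σ c i j).strand l = some a) : ∃ b, a = Strand.ofPass ⟨c, b⟩ := by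
  rw [Diagram.crossing] at h
  dsimp only at h
  split_ifs at h
  · exact ⟨_, (Option.some.inj h).symm⟩
  · exact ⟨_, (Option.some.inj h).symm⟩

theorem Diagram.labels_crossing (σ : ℤˣ) (c i j : ℕ) :
    (Diagram.crossing σ c i j).labels = {i, j} := by
  ext l
  simp only [Diagram.labels, Diagram.crossing, Set.mem_ofPred_eq, Set.mem_insert_iff,
    Set.mem_singleton_iff]
  split_ifs <;> simp_all

theorem Diagram.labels_alpha (r : ℤ) (i : ℕ) : (Diagram.alpha r i).labels = {i} := by
  ext l
  simp only [Diagram.labels, Diagram.alpha, Set.mem_ofPred_eq, Set.mem_singleton_iff]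
  split_ifs <;> simp_all

theorem Diagram.total_crossing (σ : ℤˣ) (c : ℕ) {i j : ℕ} (hij : i ≠ j) (F : Strand → ℤ) :
    (Diagram.crossing σ c i j).total F =
      F (Strand.ofPass ⟨c, true⟩) + F (Strand.ofPass ⟨c, false⟩) := by
  rw [Diagram.total, finsum_eq_sum_of_support_subset (s := {i, j}), Finset.sum_pair hij,
    Diagram.eval_of_some (Diagram.strand_crossing_left σ c i j),
    Diagram.eval_of_some (Diagram.strand_crossing_right σ c hij)]
  intro l hl
  by_contra h
  refine hl (Diagram.eval_of_none (Diagram.strand_crossing_of_ne σ c ?_ ?_) F) <;> simp_all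

theorem ZValue.finite_labels {D : Diagram} {g : Series} (h : ZValue D g) : D.labels.Finite := by
  induction h with
  | crossing σ c i j hij => rw [Diagram.labels_crossing]; simp
  | alpha r i => rw [Diagram.labels_alpha]; simp
  | union hD _ _ ih ih' => rw [Diagram.labels_union]; exact ih.union ih'
  | stitch i j k hD _ _ ih => exact hD.finite_labels ih

/-- The number of passages of a strand that are equal to `p`. -/
def Strand.count (p : Pass) (a : Strand) : ℤ := a.passes.count p

theorem Strand.count_append (p : Pass) (a b : Strand) :
    (a.append b).count p = a.count p + b.count p := by
  simp [Strand.count, Strand.passes_append]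

theorem ZValue.sign_ne_zero {D : Diagram} {g : Series} (h : ZValue D g) {l : ℕ} {a : Strand}
    (ha : D.strand l = some a) {p : Pass} (hp : p ∈ a.passes) : D.sign p.crossing ≠ 0 := by
  induction h generalizing l a with
  | crossing σ c i j hij =>
    obtain ⟨b, rfl⟩ := Diagram.exists_of_strand_crossing ha
    have hpc : p = ⟨c, b⟩ := by simpa [Strand.ofPass, Strand.passes] using hp
    simp [hpc, Diagram.crossing]
  | alpha r i =>
    rw [Diagram.alpha] at ha
    dsimp only at ha
    split_ifs at ha
    rw [← Option.some.inj ha] at hp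
    simp [Strand.edge, Strand.passes] at hp
  | @union D D' g g' hD _ _ ih ih' =>
    rw [Diagram.union] at ha ⊢
    dsimp only [Pi.add_apply] at ha ⊢
    cases h1 : D.strand l with
    | some b =>
      rw [h1] at ha
      have h2 := ih h1 (by simp at ha; rwa [ha])
      rw [(hD.2 p.crossing).resolve_left h2, add_zero]
      exact h2
    | none =>
      rw [h1] at ha
      have h2 := ih' ha hp
      rw [(hD.2 p.crossing).resolve_right h2, zero_add]
      exact h2
  | stitch i j k hD _ _ ih =>
    obtain ⟨hij, hk, b, b', hb, hb', hs, hD'⟩ := hD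
    rw [hs]
    rw [hD'] at ha
    dsimp only at ha
    split_ifs at ha with h1 h2
    · rw [← Option.some.inj ha, Strand.passes_append, List.mem_append] at hp
      exact hp.elim (ih hb) (ih hb')
    · exact ih ha hp

/-- Every crossing of an assembled diagram is passed exactly once as over-strand and exactly once as
under-strand. -/
theorem ZValue.total_count {D : Diagram} {g : Series} (h : ZValue D g) (p : Pass) :
    D.total (Strand.count p) = if D.sign p.crossing = 0 then 0 else 1 := by
  induction h with
  | crossing σ c i j hij =>
    rw [Diagram.total_crossing σ c hij]
    obtain ⟨d, b⟩ := p
    by_cases hd : d = c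
    · subst hd
      cases b <;> simp [Strand.count, Strand.ofPass, Strand.passes, Diagram.crossing]
    · simp [Strand.count, Strand.ofPass, Strand.passes, Diagram.crossing, hd, Ne.symm hd]
  | alpha r i =>
    rw [Diagram.total_eq_zero, if_pos (by rfl)]
    intro l a ha
    simp only [Diagram.alpha] at ha
    split_ifs at ha
    rw [← Option.some.inj ha]
    rfl
  | union hD h h' ih ih' =>
    rw [Diagram.total_union hD h.finite_labels h'.finite_labels, ih, ih', Diagram.union]
    rcases hD.2 p.crossing with h0 | h0 <;> simp [h0]
  | stitch i j k hD h _ ih =>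
    rw [hD.total_eq h.finite_labels (x := 0) fun a b _ _ => by rw [Strand.count_append, add_zero],
      ih, add_zero, hD.2.2.choose_spec.choose_spec.2.2.1]

/-! ### The invariant takes Gaussian values -/

section

open MvPowerSeries

/-- `g` is a Gaussian series in the variables that belong to the labels of `D`, and its quadratic
form vanishes at `t^{1/2} = 1`. -/
structure IsGaussianOn (D : Diagram) (ω : Base) (G : ℕ → ℕ → Base) (g : Series) : Prop where
  exists_labels : ∃ L : Finset ℕ, (L : Set ℕ) = D.labels ∧ IsGaussian L ω G g
  isSmall_const : IsSmall 0 ω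
  isSmall_form : ∀ l l', IsSmall 1 (G l l')

theorem IsGaussianOn.unique {D : Diagram} {ω : Base} {G : ℕ → ℕ → Base} {g g' : Series}
    (h : IsGaussianOn D ω G g) (h' : IsGaussianOn D ω G g') : g = g' := by
  obtain ⟨L, -, hL⟩ := h.exists_labels
  obtain ⟨L', -, hL'⟩ := h'.exists_labels
  exact hL.unique' hL'

theorem IsGaussianOn.row_eq_zero {D : Diagram} {ω : Base} {G : ℕ → ℕ → Base} {g : Series}
    (h : IsGaussianOn D ω G g) {l : ℕ} (hl : D.strand l = none) (l' : ℕ) : G l l' = 0 := by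
  obtain ⟨L, hL, hg⟩ := h.exists_labels
  refine hg.row_eq_zero l l' fun h0 => ?_
  have : l ∈ D.labels := hL ▸ h0
  exact this hl

theorem IsGaussianOn.col_eq_zero {D : Diagram} {ω : Base} {G : ℕ → ℕ → Base} {g : Series}
    (h : IsGaussianOn D ω G g) {l' : ℕ} (hl : D.strand l' = none) (l : ℕ) : G l l' = 0 := by
  obtain ⟨L, hL, hg⟩ := h.exists_labels
  refine hg.col_eq_zero l l' fun h0 => ?_
  have : l' ∈ D.labels := hL ▸ h0
  exact this hl

theorem IsGaussian.restrict {L L' : Finset ℕ} {ω : Base} {G : ℕ → ℕ → Base} {g : Series}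
    (h : IsGaussian L ω G g) (hr : ∀ l l', l ∉ L' → G l l' = 0)
    (hc : ∀ l l', l' ∉ L' → G l l' = 0) : IsGaussian L' ω G g where
  row_eq_zero := hr
  col_eq_zero := hc
  coeff_zero := h.coeff_zero
  coeff_of_eDegree_eq_zero := h.coeff_of_eDegree_eq_zero
  pderiv_eq l := by
    rw [h.pderiv_eq, ← fForm_mono (Finset.subset_union_left (s₂ := L')) (h.col_eq_zero l),
      fForm_mono (Finset.subset_union_right (s₁ := L)) (hc l)]

/-- The quadratic form of a crossing with over-strand `i` and under-strand `j`. -/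
noncomputable def crossingMatrix (y : Base) (i j : ℕ) : ℕ → ℕ → Base :=
  fun l l' => if l' = j then (if l = i then y else if l = j then -y else 0) else 0

theorem isGaussianOn_crossing (σ : ℤˣ) (c : ℕ) {i j : ℕ} (hij : i ≠ j) :
    IsGaussianOn (Diagram.crossing σ c i j) (sqrtT ^ (σ : ℤ))
      (crossingMatrix (1 - t ^ (σ : ℤ)) i j)
      (C (sqrtT ^ (σ : ℤ)) * exp (C (1 - t ^ (σ : ℤ)) * (e i - e j) * f j)) where
  exists_labels := by
    refine ⟨{i, j}, by rw [Diagram.labels_crossing]; simp, ?_⟩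
    have h := isGaussian_exp {i, j} (sqrtT ^ (σ : ℤ)) (crossingMatrix (1 - t ^ (σ : ℤ)) i j)
      (fun l l' hl => by grind [crossingMatrix]) (fun l l' hl => by grind [crossingMatrix])
    have hq : ∑ l ∈ {i, j}, e l * fForm {i, j} (crossingMatrix (1 - t ^ (σ : ℤ)) i j l) =
        C (1 - t ^ (σ : ℤ)) * (e i - e j) * f j := by
      rw [Finset.sum_pair hij, fForm, fForm, Finset.sum_pair hij, Finset.sum_pair hij]
      simp only [crossingMatrix, if_neg hij, if_neg hij.symm, if_pos, map_zero, map_neg]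
      ring
    rwa [hq] at h
  isSmall_const := isSmall_sqrtT_zpow _
  isSmall_form l l' := by
    have := isSmall_one_sub_t_zpow σ
    rw [crossingMatrix]
    split_ifs
    exacts [this, this.neg, IsSmall.zero 1, IsSmall.zero 1]

theorem isGaussianOn_alpha (r : ℤ) (i : ℕ) :
    IsGaussianOn (Diagram.alpha r i) (sqrtT ^ r) (fun _ _ => 0) (C (sqrtT ^ r)) where
  exists_labels :=
    ⟨{i}, by rw [Diagram.labels_alpha]; simp, (isGaussian_C _).mono (Finset.empty_subset _)⟩
  isSmall_const := isSmall_sqrtT_zpow _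
  isSmall_form _ _ := IsSmall.zero 1

theorem IsGaussianOn.union {D D' : Diagram} {ω ω' : Base} {G G' : ℕ → ℕ → Base} {g g' : Series}
    (h : IsGaussianOn D ω G g) (h' : IsGaussianOn D' ω' G' g') :
    IsGaussianOn (D.union D') (ω * ω') (fun l l' => G l l' + G' l l') (g * g') where
  exists_labels := by
    obtain ⟨L, hL, hg⟩ := h.exists_labels
    obtain ⟨L', hL', hg'⟩ := h'.exists_labels
    exact ⟨L ∪ L', by rw [Diagram.labels_union, Finset.coe_union, hL, hL'], hg.mul hg'⟩
  isSmall_const := h.isSmall_const.mul_left h'.isSmall_const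
  isSmall_form l l' := (h.isSmall_form l l').add (h'.isSmall_form l l')

/-- Stitching is defined on Gaussian series, because the quadratic form vanishes at
`t^{1/2} = 1`. -/
theorem IsGaussianOn.exists_isMul {D D' : Diagram} {ω : Base} {G : ℕ → ℕ → Base} {g : Series}
    (h : IsGaussianOn D ω G g) {i j k : ℕ} (hD : D.IsStitch i j k D') :
    ∃ g', IsMul i j k g g' ∧
      IsGaussianOn D' (ω / (1 - G j i)) (stitchMatrix i j k G) g' := by
  obtain ⟨L, hL, hg⟩ := h.exists_labels
  have hlab := hD.labels_eq
  obtain ⟨hij, hk, a, b, ha, hb, -, -⟩ := hD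
  have hmem : ∀ l, l ∈ L ↔ D.strand l ≠ none := fun l => by
    rw [← Finset.mem_coe, hL]
    rfl
  have hi : i ∈ L := by rw [hmem, ha]; simp
  have hj : j ∈ L := by rw [hmem, hb]; simp
  have hk' : k = i ∨ k = j ∨ k ∉ L := by
    rw [hmem, not_not]
    exact hk
  have hg' := isGaussian_exp (insert k L) (ω / (1 - G j i)) (stitchMatrix i j k G)
    (stitchMatrix_row_eq_zero hg i j k) (stitchMatrix_col_eq_zero hg i j k)
  refine ⟨_, hg.isMul h.isSmall_const h.isSmall_form hij hi hj hk' hg', ?_, ?_,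
    isSmall_stitchMatrix i j k h.isSmall_form⟩
  · refine ⟨insert k (L \ {i, j}), by simp [hlab, hL], hg'.restrict (fun l l' hl => ?_)
      (fun l l' hl => ?_)⟩
    · by_cases h1 : l ∈ insert k L
      · rw [stitchMatrix, merge, if_neg (by grind), if_pos (by grind)]
      · exact stitchMatrix_row_eq_zero hg i j k l l' h1
    · by_cases h1 : l' ∈ insert k L
      · have h2 : ∀ v : ℕ → Base, merge i j k v l' = 0 := fun v => by
          rw [merge, if_neg (by grind), if_pos (by grind)]
        exact merge_eq_zero (fun p => h2 _) l
      · exact stitchMatrix_col_eq_zero hg i j k l l' h1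
  · rw [div_eq_mul_inv]
    exact h.isSmall_const.mul_left (h.isSmall_form j i).inv_one_sub

theorem IsGaussianOn.stitch {D D' : Diagram} {ω : Base} {G : ℕ → ℕ → Base} {g g' : Series}
    (h : IsGaussianOn D ω G g) {i j k : ℕ} (hD : D.IsStitch i j k D') (hg : IsMul i j k g g') :
    IsGaussianOn D' (ω / (1 - G j i)) (stitchMatrix i j k G) g' := by
  obtain ⟨g'', h1, h2⟩ := h.exists_isMul hD
  rwa [hg.unique h1]

/-! ### A formula for the invariant in terms of the diagram -/

section

open Matrix

variable {ι : Type*} (name : ι → ℕ) (D : Diagram)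

/-- The exponent `1 - t^σ` of a crossing; it is `0` if there is no crossing of this name. -/
noncomputable def crossingWeight (c : ι) : Base := 1 - t ^ D.sign (name c)

/-- How often, counted over all components, the under-passage of `c'` precedes the over-passage of
`c`, minus how often it precedes the under-passage of `c`. -/
noncomputable def linkingCount (c' c : ι) : ℤ :=
  D.total (fun a => pairCount ⟨name c', false⟩ ⟨name c, true⟩ a.passes) -
    D.total (fun a => pairCount ⟨name c', false⟩ ⟨name c, false⟩ a.passes)

/-- The contractions between the exponents of the crossings: the `f`-variable of the crossing `c'`
is contracted with the `e`-variables of the crossing `c` that come later on the same component. -/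
noncomputable def linkingMatrix : Matrix ι ι Base :=
  fun c' c => crossingWeight name D c * (linkingCount name D c' c : Base)

theorem linkingMatrix_apply (c' c : ι) : linkingMatrix name D c' c =
    crossingWeight name D c * (linkingCount name D c' c : Base) := rfl

variable {name D} in
theorem linkingMatrix_eq_zero_of_total (h : ∀ p q, D.total (fun a => pairCount p q a.passes) = 0) :
    linkingMatrix name D = 0 := by
  ext c' c
  simp [linkingMatrix, linkingCount, h]

/-- The coefficients of `e_l` in the exponents of the crossings. -/
noncomputable def eVector (l : ℕ) : ι → Base := fun c =>
  crossingWeight name D c * ((D.eval (Strand.count ⟨name c, true⟩) l : Base) -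
    (D.eval (Strand.count ⟨name c, false⟩) l : Base))

/-- The coefficients of `f_l` in the exponents of the crossings. -/
noncomputable def fVector (l : ℕ) : ι → Base := fun c =>
  (D.eval (Strand.count ⟨name c, false⟩) l : Base)

variable [Fintype ι]

/-- The exponent of `t^{1/2}` in the value of the invariant: the writhe plus the total rotation
number. -/
noncomputable def framing : ℤ := ∑ c, D.sign (name c) + D.total Strand.rotation

variable {name D}

theorem merge_dotProduct (i j k : ℕ) (u : ℕ → ι → Base) (v : ι → Base) (l : ℕ) :
    merge i j k u l ⬝ᵥ v = merge i j k (fun p => u p ⬝ᵥ v) l := by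
  rw [merge, merge]
  split_ifs
  · rw [add_dotProduct]
  · rw [zero_dotProduct]
  · rfl

theorem dotProduct_merge (i j k : ℕ) (u : ι → Base) (v : ℕ → ι → Base) (l : ℕ) :
    u ⬝ᵥ merge i j k v l = merge i j k (fun p => u ⬝ᵥ v p) l := by
  simp only [dotProduct_comm u, merge_dotProduct]

theorem mulVec_merge (i j k : ℕ) (A : Matrix ι ι Base) (v : ℕ → ι → Base) (l : ℕ) :
    A *ᵥ merge i j k v l = merge i j k (fun p => A *ᵥ v p) l := by
  rw [merge, merge]
  split_ifs
  · rw [mulVec_add]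
  · rw [mulVec_zero]
  · rfl

variable [DecidableEq ι] (name D)

/-- The constant term of the value of the invariant. -/
noncomputable def diagramConst : Base :=
  sqrtT ^ framing name D / (1 - linkingMatrix name D).det

/-- The quadratic form of the value of the invariant. -/
noncomputable def diagramForm (l l' : ℕ) : Base :=
  eVector name D l ⬝ᵥ ((1 - linkingMatrix name D)⁻¹ *ᵥ fVector name D l')

variable {name D}

/-- Stitching changes the matrix by a matrix of rank one; its determinant and its inverse change
according to the matrix determinant lemma and the Sherman-Morrison formula. -/
theorem diagram_stitch {D' : Diagram} {i j k : ℕ} (hD : D.IsStitch i j k D')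
    (hfin : D.labels.Finite) (hdet : (1 - linkingMatrix name D).det ≠ 0)
    (hx : 1 - diagramForm name D j i ≠ 0) :
    (1 - linkingMatrix name D').det ≠ 0 ∧
    diagramConst name D' = diagramConst name D / (1 - diagramForm name D j i) ∧
    diagramForm name D' = stitchMatrix i j k (diagramForm name D) := by
  have hsign : D'.sign = D.sign := hD.2.2.choose_spec.choose_spec.2.2.1
  have hw : ∀ c, crossingWeight name D' c = crossingWeight name D c := fun c => by
    rw [crossingWeight, crossingWeight, hsign]
  have hcount : ∀ p, D'.eval (Strand.count p) = merge i j k (D.eval (Strand.count p)) :=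
    fun p => hD.eval_eq (Strand.count_append p)
  have hcast : ∀ (v : ℕ → ℤ) l, ((merge i j k v l : ℤ) : Base) =
      merge i j k (fun l => (v l : Base)) l := fun v l => by
    rw [merge, merge]
    split_ifs <;> simp
  have heV : eVector name D' = merge i j k (eVector name D) := by
    funext l c
    rw [eVector, hw, hcount, hcount, hcast, hcast]
    simp only [merge, apply_ite (fun v : ι → Base => v c), Pi.add_apply, Pi.zero_apply, eVector]
    split_ifs <;> ring
  have hfV : fVector name D' = merge i j k (fVector name D) := by
    funext l c
    rw [fVector, hcount, hcast]
    simp only [merge, apply_ite (fun v : ι → Base => v c), Pi.add_apply, Pi.zero_apply, fVector]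
  have hprec : ∀ p q, D'.total (fun a => pairCount p q a.passes) =
      D.total (fun a => pairCount p q a.passes) +
        D.eval (Strand.count p) i * D.eval (Strand.count q) j := fun p q => by
    refine hD.total_eq hfin fun a b ha hb => ?_
    rw [Strand.passes_append, pairCount_append, Diagram.eval_of_some ha, Diagram.eval_of_some hb]
    rfl
  -- The under-passages of `i` now precede the passages of `j`.
  have hK : 1 - linkingMatrix name D' = 1 - linkingMatrix name D -
      vecMulVec (fVector name D i) (eVector name D j) := by
    ext c' c
    simp only [Matrix.sub_apply, vecMulVec_apply, linkingMatrix, linkingCount, hw, hprec, fVector,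
      eVector]
    push_cast
    ring
  have hrot : framing name D' = framing name D := by
    rw [framing, framing, hsign, hD.total_eq hfin (x := 0) fun a b _ _ => by
      rw [Strand.rotation_append, add_zero], add_zero]
  set A := 1 - linkingMatrix name D with hA
  set u := fVector name D i
  set v := eVector name D j
  have hunit : IsUnit A.det := isUnit_iff_ne_zero.2 hdet
  have hx' : diagramForm name D j i = v ⬝ᵥ (A⁻¹ *ᵥ u) := rfl
  have hdet' : (1 - linkingMatrix name D').det = A.det * (1 - diagramForm name D j i) := by
    have h1 : A - vecMulVec u v = A * (1 + replicateCol Unit (-(A⁻¹ *ᵥ u)) * replicateRow Unit v) := by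
      rw [← vecMulVec_eq, mul_add, mul_one, mul_vecMulVec, mulVec_neg, mulVec_mulVec,
        mul_nonsing_inv _ hunit, one_mulVec, neg_vecMulVec, sub_eq_add_neg]
    rw [hK, h1, det_mul, det_one_add_replicateCol_mul_replicateRow, dotProduct_neg, hx',
      sub_eq_add_neg]
  have hinv : (1 - linkingMatrix name D')⁻¹ =
      A⁻¹ + (1 - diagramForm name D j i)⁻¹ • vecMulVec (A⁻¹ *ᵥ u) (v ᵥ* A⁻¹) := by
    refine inv_eq_right_inv ?_
    rw [hK, sub_mul, mul_add, mul_add, mul_nonsing_inv _ hunit, Matrix.mul_smul, Matrix.mul_smul,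
      mul_vecMulVec, mulVec_mulVec, mul_nonsing_inv _ hunit, one_mulVec, vecMulVec_mul,
      vecMulVec_mul_vecMulVec, ← hx', vecMulVec_smul, smul_smul]
    have : (1 - diagramForm name D j i)⁻¹ =
        1 + (1 - diagramForm name D j i)⁻¹ * diagramForm name D j i := by
      field_simp
      ring
    have h2 : (1 - diagramForm name D j i)⁻¹ • vecMulVec u (v ᵥ* A⁻¹) =
        vecMulVec u (v ᵥ* A⁻¹) +
          ((1 - diagramForm name D j i)⁻¹ * diagramForm name D j i) • vecMulVec u (v ᵥ* A⁻¹) := by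
      conv_lhs => rw [this, add_smul, one_smul]
    rw [h2]
    abel
  refine ⟨?_, ?_, ?_⟩
  · rw [hdet']
    exact mul_ne_zero hdet hx
  · rw [diagramConst, diagramConst, hrot, hdet', div_mul_eq_div_div]
  · funext l l'
    rw [diagramForm, hinv, heV, hfV, mulVec_merge, merge_dotProduct, stitchMatrix]
    congr 1
    funext p
    rw [dotProduct_merge]
    congr 1
    funext q
    have h1 : vecMulVec (A⁻¹ *ᵥ u) (v ᵥ* A⁻¹) *ᵥ fVector name D q =
        diagramForm name D j q • (A⁻¹ *ᵥ u) := by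
      rw [vecMulVec_mulVec, ← dotProduct_mulVec, op_smul_eq_smul]
      rfl
    rw [add_mulVec, smul_mulVec, h1, dotProduct_add, dotProduct_smul, dotProduct_smul, smul_eq_mul,
      smul_eq_mul]
    change diagramForm name D p q + _ * (_ * diagramForm name D p i) = _
    ring

/-- The quantities of a disjoint union. The two diagrams are supported on disjoint sets of crossings,
so the matrix is a direct sum. -/
theorem diagram_union {D' : Diagram} (hD : D.Disjoint D') (hfin : D.labels.Finite)
    (hfin' : D'.labels.Finite)
    (hs : ∀ l a, D.strand l = some a → ∀ p ∈ a.passes, D.sign p.crossing ≠ 0)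
    (hs' : ∀ l a, D'.strand l = some a → ∀ p ∈ a.passes, D'.sign p.crossing ≠ 0)
    (hdet : (1 - linkingMatrix name D).det ≠ 0) (hdet' : (1 - linkingMatrix name D').det ≠ 0) :
    (1 - linkingMatrix name (D.union D')).det ≠ 0 ∧
    diagramConst name (D.union D') = diagramConst name D * diagramConst name D' ∧
    diagramForm name (D.union D') =
      fun l l' => diagramForm name D l l' + diagramForm name D' l l' := by
  -- The support of the quantities that belong to one of the diagrams.
  have hw : ∀ (E : Diagram) c, E.sign (name c) = 0 → crossingWeight name E c = 0 := fun E c h => by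
    rw [crossingWeight, h, zpow_zero, sub_self]
  have hev : ∀ E : Diagram, (∀ l a, E.strand l = some a → ∀ p ∈ a.passes, E.sign p.crossing ≠ 0) →
      ∀ p, E.sign p.crossing = 0 → ∀ l, E.eval (Strand.count p) l = 0 := fun E hE p hp l => by
    cases hl : E.strand l with
    | none => exact Diagram.eval_of_none hl _
    | some a =>
      rw [Diagram.eval_of_some hl, Strand.count, List.count_eq_zero_of_not_mem, Nat.cast_zero]
      exact fun h => hE l a hl p h hp
  have htl : ∀ E : Diagram, (∀ l a, E.strand l = some a → ∀ p ∈ a.passes, E.sign p.crossing ≠ 0) →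
      ∀ p q, E.sign p.crossing = 0 → E.total (fun a => pairCount p q a.passes) = 0 :=
    fun E hE p q hp => Diagram.total_eq_zero fun l a hl =>
      pairCount_eq_zero_of_left fun h => hE l a hl p h hp
  have htr : ∀ E : Diagram, (∀ l a, E.strand l = some a → ∀ p ∈ a.passes, E.sign p.crossing ≠ 0) →
      ∀ p q, E.sign q.crossing = 0 → E.total (fun a => pairCount p q a.passes) = 0 :=
    fun E hE p q hq => Diagram.total_eq_zero fun l a hl =>
      pairCount_eq_zero_of_right fun h => hE l a hl q h hq
  have hwu : ∀ c, crossingWeight name (D.union D') c =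
      crossingWeight name D c + crossingWeight name D' c := fun c => by
    rcases hD.2 (name c) with h | h
    · rw [hw D c h, crossingWeight, crossingWeight, Diagram.sign_union, h, zero_add,
        zero_add]
    · rw [hw D' c h, crossingWeight, crossingWeight, Diagram.sign_union, h, add_zero,
        add_zero]
  have hlink : ∀ c' c, linkingCount name (D.union D') c' c =
      linkingCount name D c' c + linkingCount name D' c' c := fun c' c => by
    simp only [linkingCount, Diagram.total_union hD hfin hfin']
    ring
  have hlr : ∀ E : Diagram, (∀ l a, E.strand l = some a → ∀ p ∈ a.passes, E.sign p.crossing ≠ 0) →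
      ∀ c' c, E.sign (name c) = 0 → linkingCount name E c' c = 0 := fun E hE c' c h => by
    rw [linkingCount, htr E hE _ _ h, htr E hE _ _ h, sub_self]
  have hll : ∀ E : Diagram, (∀ l a, E.strand l = some a → ∀ p ∈ a.passes, E.sign p.crossing ≠ 0) →
      ∀ c' c, E.sign (name c') = 0 → linkingCount name E c' c = 0 := fun E hE c' c h => by
    rw [linkingCount, htl E hE _ _ h, htl E hE _ _ h, sub_self]
  have hKu : linkingMatrix name (D.union D') = linkingMatrix name D + linkingMatrix name D' := by
    ext c' c
    simp only [Matrix.add_apply, linkingMatrix, hwu, hlink]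
    rcases hD.2 (name c) with h | h
    · rw [hw D c h, hlr D hs c' c h]; simp
    · rw [hw D' c h, hlr D' hs' c' c h]; simp
  have hEu : ∀ l, eVector name (D.union D') l = eVector name D l + eVector name D' l := fun l => by
    funext c
    simp only [Pi.add_apply, eVector, hwu, Diagram.eval_union hD]
    rcases hD.2 (name c) with h | h
    · rw [hw D c h, hev D hs ⟨name c, true⟩ h, hev D hs ⟨name c, false⟩ h]; simp
    · rw [hw D' c h, hev D' hs' ⟨name c, true⟩ h, hev D' hs' ⟨name c, false⟩ h]; simp
  have hFu : ∀ l, fVector name (D.union D') l = fVector name D l + fVector name D' l := fun l => by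
    funext c
    simp only [Pi.add_apply, fVector, Diagram.eval_union hD]
    push_cast
    rfl
  -- All products of quantities that belong to different diagrams vanish.
  have hKK : linkingMatrix name D * linkingMatrix name D' = 0 := by
    ext c' c
    rw [mul_apply]
    refine Finset.sum_eq_zero fun x _ => ?_
    rcases hD.2 (name x) with h | h
    · rw [linkingMatrix_apply, hw D x h, zero_mul, zero_mul]
    · rw [linkingMatrix_apply name D', hll D' hs' x c h, Int.cast_zero, mul_zero, mul_zero]
  have hKK' : linkingMatrix name D' * linkingMatrix name D = 0 := by
    ext c' c
    rw [mul_apply]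
    refine Finset.sum_eq_zero fun x _ => ?_
    rcases hD.2 (name x) with h | h
    · rw [linkingMatrix_apply name D, hll D hs x c h, Int.cast_zero, mul_zero, mul_zero]
    · rw [linkingMatrix_apply, hw D' x h, zero_mul, zero_mul]
  have hKF : ∀ l, linkingMatrix name D *ᵥ fVector name D' l = 0 := fun l => by
    funext c
    refine Finset.sum_eq_zero fun x _ => ?_
    change linkingMatrix name D c x * fVector name D' l x = 0
    rcases hD.2 (name x) with h | h
    · rw [linkingMatrix_apply, hw D x h, zero_mul, zero_mul]
    · rw [fVector, hev D' hs' ⟨name x, false⟩ h, Int.cast_zero, mul_zero]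
  have hKF' : ∀ l, linkingMatrix name D' *ᵥ fVector name D l = 0 := fun l => by
    funext c
    refine Finset.sum_eq_zero fun x _ => ?_
    change linkingMatrix name D' c x * fVector name D l x = 0
    rcases hD.2 (name x) with h | h
    · rw [fVector, hev D hs ⟨name x, false⟩ h, Int.cast_zero, mul_zero]
    · rw [linkingMatrix_apply, hw D' x h, zero_mul, zero_mul]
  have hEK : ∀ l, eVector name D l ᵥ* linkingMatrix name D' = 0 := fun l => by
    funext c
    refine Finset.sum_eq_zero fun x _ => ?_
    change eVector name D l x * linkingMatrix name D' x c = 0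
    rcases hD.2 (name x) with h | h
    · rw [eVector, hw D x h, zero_mul, zero_mul]
    · rw [linkingMatrix_apply, hll D' hs' x c h, Int.cast_zero, mul_zero, mul_zero]
  have hEK' : ∀ l, eVector name D' l ᵥ* linkingMatrix name D = 0 := fun l => by
    funext c
    refine Finset.sum_eq_zero fun x _ => ?_
    change eVector name D' l x * linkingMatrix name D x c = 0
    rcases hD.2 (name x) with h | h
    · rw [linkingMatrix_apply, hll D hs x c h, Int.cast_zero, mul_zero, mul_zero]
    · rw [eVector, hw D' x h, zero_mul, zero_mul]
  have hEF : ∀ l l', eVector name D l ⬝ᵥ fVector name D' l' = 0 := fun l l' => by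
    refine Finset.sum_eq_zero fun x _ => ?_
    rcases hD.2 (name x) with h | h
    · rw [eVector, hw D x h, zero_mul, zero_mul]
    · rw [fVector, hev D' hs' ⟨name x, false⟩ h, Int.cast_zero, mul_zero]
  have hEF' : ∀ l l', eVector name D' l ⬝ᵥ fVector name D l' = 0 := fun l l' => by
    refine Finset.sum_eq_zero fun x _ => ?_
    rcases hD.2 (name x) with h | h
    · rw [fVector, hev D hs ⟨name x, false⟩ h, Int.cast_zero, mul_zero]
    · rw [eVector, hw D' x h, zero_mul, zero_mul]
  set A := 1 - linkingMatrix name D with hA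
  set A' := 1 - linkingMatrix name D' with hA'
  have hu : IsUnit A.det := isUnit_iff_ne_zero.2 hdet
  have hu' : IsUnit A'.det := isUnit_iff_ne_zero.2 hdet'
  have hprod : 1 - linkingMatrix name (D.union D') = A * A' := by
    rw [hA, hA', hKu, sub_mul, mul_sub, mul_sub, hKK, one_mul, one_mul, mul_one]
    abel
  have hprod' : 1 - linkingMatrix name (D.union D') = A' * A := by
    rw [hA, hA', hKu, sub_mul, mul_sub, mul_sub, hKK', one_mul, one_mul, mul_one]
    abel
  have hinvF : ∀ l, A⁻¹ *ᵥ fVector name D' l = fVector name D' l := fun l => by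
    have : A *ᵥ fVector name D' l = fVector name D' l := by
      rw [hA, sub_mulVec, one_mulVec, hKF, sub_zero]
    conv_lhs => rw [← this, mulVec_mulVec, nonsing_inv_mul _ hu, one_mulVec]
  have hinvF' : ∀ l, A'⁻¹ *ᵥ fVector name D l = fVector name D l := fun l => by
    have : A' *ᵥ fVector name D l = fVector name D l := by
      rw [hA', sub_mulVec, one_mulVec, hKF', sub_zero]
    conv_lhs => rw [← this, mulVec_mulVec, nonsing_inv_mul _ hu', one_mulVec]
  have hEinv : ∀ l, eVector name D l ᵥ* A'⁻¹ = eVector name D l := fun l => by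
    have : eVector name D l ᵥ* A' = eVector name D l := by
      rw [hA', vecMul_sub, vecMul_one, hEK, sub_zero]
    conv_lhs => rw [← this, vecMul_vecMul, mul_nonsing_inv _ hu', vecMul_one]
  have hEinv' : ∀ l, eVector name D' l ᵥ* A⁻¹ = eVector name D' l := fun l => by
    have : eVector name D' l ᵥ* A = eVector name D' l := by
      rw [hA, vecMul_sub, vecMul_one, hEK', sub_zero]
    conv_lhs => rw [← this, vecMul_vecMul, mul_nonsing_inv _ hu, vecMul_one]
  refine ⟨?_, ?_, ?_⟩
  · rw [hprod, det_mul]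
    exact mul_ne_zero hdet hdet'
  · have hfr : framing name (D.union D') = framing name D + framing name D' := by
      simp only [framing, Diagram.total_union hD hfin hfin', Diagram.sign_union,
        Finset.sum_add_distrib]
      ring
    rw [diagramConst, diagramConst, diagramConst, hfr, hprod, det_mul,
      zpow_add₀ sqrtT_ne_zero, mul_div_mul_comm]
  · funext l l'
    have h1 : (A' * A)⁻¹ *ᵥ fVector name D l' = A⁻¹ *ᵥ fVector name D l' := by
      rw [Matrix.mul_inv_rev, ← mulVec_mulVec, hinvF']
    have h2 : (A' * A)⁻¹ *ᵥ fVector name D' l' = A'⁻¹ *ᵥ fVector name D' l' := by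
      rw [← hprod', hprod, Matrix.mul_inv_rev, ← mulVec_mulVec, hinvF]
    rw [diagramForm, hprod', hEu, hFu, mulVec_add, h1, h2, add_dotProduct, dotProduct_add,
      dotProduct_add, dotProduct_mulVec _ A'⁻¹, hEinv, hEF, dotProduct_mulVec (eVector name D' l) A⁻¹,
      hEinv', hEF', add_zero, zero_add]
    rfl

theorem diagram_crossing (hname : Function.Injective name) (σ : ℤˣ) (c₀ : ι) {i j : ℕ}
    (hij : i ≠ j) :
    (1 - linkingMatrix name (Diagram.crossing σ (name c₀) i j)).det ≠ 0 ∧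
    diagramConst name (Diagram.crossing σ (name c₀) i j) = sqrtT ^ (σ : ℤ) ∧
    diagramForm name (Diagram.crossing σ (name c₀) i j) =
      crossingMatrix (1 - t ^ (σ : ℤ)) i j := by
  have hK : linkingMatrix name (Diagram.crossing σ (name c₀) i j) = 0 := by
    refine linkingMatrix_eq_zero_of_total fun p q => ?_
    rw [Diagram.total_crossing σ (name c₀) hij]
    simp [Strand.ofPass, Strand.passes, pairCount]
  have hsign : ∀ c, (Diagram.crossing σ (name c₀) i j).sign (name c) =
      if c = c₀ then (σ : ℤ) else 0 := fun c => by
    simp [Diagram.crossing, Pi.single_apply, hname.eq_iff]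
  have hw : ∀ c, crossingWeight name (Diagram.crossing σ (name c₀) i j) c =
      if c = c₀ then 1 - t ^ (σ : ℤ) else 0 := fun c => by
    rw [crossingWeight, hsign]
    split_ifs <;> simp
  refine ⟨by simp [hK], ?_, ?_⟩
  · rw [diagramConst, hK, sub_zero, det_one, div_one, framing, Diagram.total_crossing σ (name c₀) hij]
    simp [hsign, Strand.rotation, Strand.ofPass]
  · funext l l'
    rw [diagramForm, hK, sub_zero, inv_one, one_mulVec, dotProduct, Finset.sum_eq_single c₀]
    · rw [eVector, hw, if_pos rfl, fVector, crossingMatrix]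
      simp only [Diagram.eval, Diagram.crossing]
      by_cases h1 : l = i <;> by_cases h2 : l = j <;> by_cases h3 : l' = i <;>
        by_cases h4 : l' = j <;> simp_all [Strand.count, Strand.ofPass, Strand.passes]
    · intro c _ hc
      rw [eVector, hw, if_neg hc, zero_mul, zero_mul]
    · simp

theorem diagram_alpha (r : ℤ) (i : ℕ) :
    (1 - linkingMatrix name (Diagram.alpha r i)).det ≠ 0 ∧
    diagramConst name (Diagram.alpha r i) = sqrtT ^ r ∧
    diagramForm name (Diagram.alpha r i) = fun _ _ => 0 := by
  have hi : (Diagram.alpha r i).strand i = some (Strand.edge r) := if_pos rfl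
  have hi' : ∀ m, m ≠ i → (Diagram.alpha r i).strand m = none := fun m hm => if_neg hm
  have hK : linkingMatrix name (Diagram.alpha r i) = 0 :=
    linkingMatrix_eq_zero_of_total fun p q => by rw [Diagram.total_of_single hi hi']; rfl
  refine ⟨by simp [hK], ?_, ?_⟩
  · rw [diagramConst, hK, sub_zero, det_one, div_one, framing, Diagram.total_of_single hi hi']
    simp [Diagram.alpha, Strand.rotation, Strand.edge]
  · funext l l'
    have : eVector name (Diagram.alpha r i) l = 0 := by
      funext c
      rw [eVector, crossingWeight]
      simp [Diagram.alpha]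
    rw [diagramForm, this, zero_dotProduct]

/-- The value of the invariant depends only on the diagram, not on how it is assembled. -/
theorem ZValue.isGaussianOn {D : Diagram} {g : Series} (h : ZValue D g)
    (hname : Function.Injective name) (hcover : ∀ c, D.sign c ≠ 0 → c ∈ Set.range name) :
    (1 - linkingMatrix name D).det ≠ 0 ∧
      IsGaussianOn D (diagramConst name D) (diagramForm name D) g := by
  induction h with
  | crossing σ c i j hij =>
    obtain ⟨c₀, rfl⟩ := hcover c (by simp [Diagram.crossing])
    obtain ⟨h1, h2, h3⟩ := diagram_crossing hname σ c₀ hij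
    rw [h2, h3]
    exact ⟨h1, isGaussianOn_crossing σ (name c₀) hij⟩
  | alpha r i =>
    obtain ⟨h1, h2, h3⟩ := diagram_alpha (name := name) r i
    rw [h2, h3]
    exact ⟨h1, isGaussianOn_alpha r i⟩
  | @union D D' g g' hD h h' ih ih' =>
    have hc : ∀ c, D.sign c ≠ 0 → c ∈ Set.range name := fun c hc => hcover c (by
      rw [Diagram.sign_union, (hD.2 c).resolve_left hc, add_zero]
      exact hc)
    have hc' : ∀ c, D'.sign c ≠ 0 → c ∈ Set.range name := fun c hc => hcover c (by
      rw [Diagram.sign_union, (hD.2 c).resolve_right hc, zero_add]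
      exact hc)
    obtain ⟨h1, h2, h3⟩ := diagram_union hD h.finite_labels h'.finite_labels
      (fun l a ha p hp => h.sign_ne_zero ha hp) (fun l a ha p hp => h'.sign_ne_zero ha hp)
      (ih hc).1 (ih' hc').1
    rw [h2, h3]
    exact ⟨h1, (ih hc).2.union (ih' hc').2⟩
  | stitch i j k hD h hg ih =>
    have hsign := hD.2.2.choose_spec.choose_spec.2.2.1
    rw [hsign] at hcover
    obtain ⟨ih1, ih2⟩ := ih hcover
    obtain ⟨h1, h2, h3⟩ := diagram_stitch hD h.finite_labels ih1
      (ih2.isSmall_form j i).one_sub_ne_zero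
    rw [h2, h3]
    exact ⟨h1, ih2.stitch hD hg⟩

end

theorem ZValue.finite_crossings {D : Diagram} {g : Series} (h : ZValue D g) :
    {c | D.sign c ≠ 0}.Finite := by
  induction h with
  | crossing σ c i j hij =>
    refine (Set.finite_singleton c).subset fun d hd => ?_
    by_contra hne
    exact hd (Pi.single_eq_of_ne hne _)
  | alpha r i => simp [Diagram.alpha]
  | union hD _ _ ih ih' =>
    refine (ih.union ih').subset fun c hc => ?_
    by_contra hne
    simp only [Set.mem_union, Set.mem_ofPred_eq, not_or, not_not] at hne
    exact hc (by simp [Diagram.union, hne])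
  | stitch i j k hD _ _ ih => rwa [hD.2.2.choose_spec.choose_spec.2.2.1]

/-- The invariant is well-defined: both values are given by the formula for the diagram, applied to the
finite set of its crossings. -/
theorem ZValue.unique {D : Diagram} {g g' : Series} (h : ZValue D g) (h' : ZValue D g') :
    g = g' := by
  classical
  have := h.finite_crossings.fintype
  have hcover : ∀ c, D.sign c ≠ 0 → c ∈ Set.range (Subtype.val : {c | D.sign c ≠ 0} → ℕ) :=
    fun c hc => ⟨⟨c, hc⟩, rfl⟩
  exact (h.isGaussianOn Subtype.val_injective hcover).2.unique
    (h'.isGaussianOn Subtype.val_injective hcover).2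

end

/-! ### Drawing a diagram slice by slice -/

/-- The invariant exists on `D`, and its value is the Gaussian series with constant term `ω` and
quadratic form `G`. -/
def HasValue (D : Diagram) (ω : Base) (G : ℕ → ℕ → Base) : Prop :=
  ∃ g, ZValue D g ∧ IsGaussianOn D ω G g

theorem HasValue.row_eq_zero {D : Diagram} {ω : Base} {G : ℕ → ℕ → Base} (h : HasValue D ω G)
    {l : ℕ} (hl : D.strand l = none) (l' : ℕ) : G l l' = 0 := by
  obtain ⟨g, -, hg⟩ := h
  exact hg.row_eq_zero hl l'

theorem HasValue.col_eq_zero {D : Diagram} {ω : Base} {G : ℕ → ℕ → Base} (h : HasValue D ω G)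
    {l' : ℕ} (hl : D.strand l' = none) (l : ℕ) : G l l' = 0 := by
  obtain ⟨g, -, hg⟩ := h
  exact hg.col_eq_zero hl l

theorem HasValue.one_sub_ne_zero {D : Diagram} {ω : Base} {G : ℕ → ℕ → Base} (h : HasValue D ω G)
    (l l' : ℕ) : 1 - G l l' ≠ 0 := by
  obtain ⟨g, -, hg⟩ := h
  exact (hg.isSmall_form l l').one_sub_ne_zero

theorem hasValue_alpha (r : ℤ) (i : ℕ) :
    HasValue (Diagram.alpha r i) (sqrtT ^ r) (fun _ _ => 0) :=
  ⟨_, ZValue.alpha r i, isGaussianOn_alpha r i⟩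

theorem hasValue_crossing (σ : ℤˣ) (c : ℕ) {i j : ℕ} (hij : i ≠ j) :
    HasValue (Diagram.crossing σ c i j) (sqrtT ^ (σ : ℤ))
      (crossingMatrix (1 - t ^ (σ : ℤ)) i j) :=
  ⟨_, ZValue.crossing σ c i j hij, isGaussianOn_crossing σ c hij⟩

theorem HasValue.union {D D' : Diagram} {ω ω' : Base} {G G' : ℕ → ℕ → Base}
    (h : HasValue D ω G) (h' : HasValue D' ω' G') (hD : D.Disjoint D') :
    HasValue (D.union D') (ω * ω') (fun l l' => G l l' + G' l l') := by
  obtain ⟨g, hg, hG⟩ := h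
  obtain ⟨g', hg', hG'⟩ := h'
  exact ⟨_, hg.union hD hg', hG.union hG'⟩

theorem HasValue.stitch {D D' : Diagram} {ω : Base} {G : ℕ → ℕ → Base} (h : HasValue D ω G)
    {i j k : ℕ} (hD : D.IsStitch i j k D') :
    HasValue D' (ω / (1 - G j i)) (stitchMatrix i j k G) := by
  obtain ⟨g, hg, hG⟩ := h
  obtain ⟨g', hg', hG'⟩ := hG.exists_isMul hD
  exact ⟨g', hg.stitch i j k hD hg', hG'⟩

/-- The quadratic form after a crossing has been added at the ends of the components `o` (over) and
`u` (under). -/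
noncomputable def crossForm (y : Base) (o u : ℕ) (G : ℕ → ℕ → Base) : ℕ → ℕ → Base := fun p q =>
  G p q + if q = u then
    y * (((if p = o then 1 else 0) + G p o) - ((if p = u then 1 else 0) + G p u)) else 0

/-- A crossing is added by a disjoint union and two stitchings; `m` and `n` are unused labels for its
components. -/
theorem HasValue.cross {D : Diagram} {ω : Base} {G : ℕ → ℕ → Base} (h : HasValue D ω G) (σ : ℤˣ)
    {c o u m n : ℕ} {x y : Strand} (hou : o ≠ u) (ho : D.strand o = some x)
    (hu : D.strand u = some y) (hm : D.strand m = none) (hn : D.strand n = none) (hmn : m ≠ n)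
    (hc : D.sign c = 0) :
    HasValue
      { strand := fun l => if l = o then some (x.append (Strand.ofPass ⟨c, true⟩))
          else if l = u then some (y.append (Strand.ofPass ⟨c, false⟩)) else D.strand l
        sign := Function.update D.sign c (σ : ℤ) }
      (ω * sqrtT ^ (σ : ℤ)) (crossForm (1 - t ^ (σ : ℤ)) o u G) := by
  have hom : o ≠ m := by rintro rfl; simp [ho] at hm
  have hon : o ≠ n := by rintro rfl; simp [ho] at hn
  have hum : u ≠ m := by rintro rfl; simp [hu] at hm
  have hun : u ≠ n := by rintro rfl; simp [hu] at hn
  set Y := 1 - t ^ (σ : ℤ)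
  have h1 := h.union (hasValue_crossing σ c hmn) ⟨fun l => by
    by_cases h1 : l = m
    · exact Or.inl (h1 ▸ hm)
    by_cases h2 : l = n
    · exact Or.inl (h2 ▸ hn)
    exact Or.inr (by simp [Diagram.crossing, h1, h2]), fun c' => by
    by_cases h1 : c' = c
    · exact Or.inl (h1 ▸ hc)
    exact Or.inr (by simp [Diagram.crossing, h1])⟩
  have h2 := h1.stitch (i := o) (j := m) (k := o)
    (D' := ⟨fun l => if l = o then some (x.append (Strand.ofPass ⟨c, true⟩)) else if l = m then none
        else (D.union (Diagram.crossing σ c m n)).strand l,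
      (D.union (Diagram.crossing σ c m n)).sign⟩)
    ⟨hom, Or.inl rfl, x, _, by simp [Diagram.union, ho],
      by simp [Diagram.union, hm, Diagram.crossing]; rfl, rfl, by
      funext l
      by_cases hl : l = o <;> simp [hl]⟩
  have h3 := h2.stitch (i := u) (j := n) (k := u)
    (D' := ⟨fun l => if l = o then some (x.append (Strand.ofPass ⟨c, true⟩))
        else if l = u then some (y.append (Strand.ofPass ⟨c, false⟩)) else D.strand l,
      Function.update D.sign c (σ : ℤ)⟩)
    ⟨hun, Or.inl rfl, y, Strand.ofPass ⟨c, false⟩,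
      by simp [Diagram.union, hu, hou.symm, hum],
      by simp [Diagram.union, hn, Diagram.crossing, hon.symm, hmn.symm], by
      funext c'
      by_cases h1 : c' = c
      · subst h1; simp [Diagram.union, Diagram.crossing, hc]
      · simp [Diagram.union, Diagram.crossing, h1], by
      funext l
      have h4 : m ≠ u := hum.symm
      have h5 : n ≠ u := hun.symm
      by_cases k1 : l = o
      · subst k1; simp [hou, hon]
      by_cases k2 : l = u
      · subst k2; simp [hou.symm]
      by_cases k3 : l = m
      · subst k3; simp [k1, k2, hm]
      by_cases k4 : l = n
      · subst k4; simp [k1, k2, hn]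
      simp [k1, k2, k3, k4, Diagram.union, Diagram.crossing]⟩
  have hrm : ∀ q, G m q = 0 := h.row_eq_zero hm
  have hrn : ∀ q, G n q = 0 := h.row_eq_zero hn
  have hcm : ∀ p, G p m = 0 := h.col_eq_zero hm
  have hcn : ∀ p, G p n = 0 := h.col_eq_zero hn
  have hG1 : stitchMatrix o m o (fun l l' => G l l' + crossingMatrix Y m n l l') = fun p q =>
      G p q + (if q = n then Y * ((if p = o then 1 else 0) + G p o - if p = n then 1 else 0)
        else 0) := by
    funext p q
    simp only [stitchMatrix, merge, crossingMatrix]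
    by_cases h1 : p = o <;> by_cases h2 : p = m <;> by_cases h3 : q = o <;> by_cases h4 : q = m <;>
      by_cases h5 : q = n <;> by_cases h6 : p = n <;> subst_vars <;>
      simp_all [hou.symm, hom.symm, hon.symm, hum.symm, hun.symm, hmn.symm] <;> ring
  have hG2 : stitchMatrix u n u (fun p q => G p q +
      (if q = n then Y * ((if p = o then 1 else 0) + G p o - if p = n then 1 else 0) else 0)) =
      crossForm Y o u G := by
    funext p q
    simp only [stitchMatrix, merge, crossForm]
    by_cases h1 : p = o <;> by_cases h2 : p = u <;> by_cases h3 : q = o <;> by_cases h4 : q = u <;>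
      by_cases h5 : q = n <;> by_cases h6 : p = n <;> subst_vars <;>
      simp_all [hou.symm, hon.symm, hun.symm, hmn.symm] <;> ring
  rw [hG1, hG2] at h3
  convert h3 using 1
  simp [hrm, hrn, crossingMatrix, hon, hun]

theorem HasValue.cup {D : Diagram} {ω : Base} {G : ℕ → ℕ → Base} (h : HasValue D ω G) {n : ℕ}
    (hn : D.strand n = none) (r : ℤ) :
    HasValue { D with strand := Function.update D.strand n (some (Strand.edge r)) }
      (ω * sqrtT ^ r) G := by
  have h1 := h.union (hasValue_alpha r n) ⟨fun l => by
    by_cases h1 : l = n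
    · exact Or.inl (h1 ▸ hn)
    exact Or.inr (by simp [Diagram.alpha, h1]), fun c => Or.inr rfl⟩
  simp only [add_zero] at h1
  convert h1 using 1
  ext1
  · funext l
    by_cases h1 : l = n
    · subst h1; simp [Diagram.union, hn, Diagram.alpha]
    · simp [Diagram.union, Diagram.alpha, h1]
  · simp [Diagram.union, Diagram.alpha]

/-- A maximum is added by a disjoint union with a single edge, whose label `n` is unused, and two
stitchings. -/
theorem HasValue.joinBy {D : Diagram} {ω : Base} {G : ℕ → ℕ → Base} (h : HasValue D ω G)
    {a b n : ℕ} {x y : Strand} (hab : a ≠ b) (ha : D.strand a = some x) (hb : D.strand b = some y)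
    (hn : D.strand n = none) (r : ℤ) :
    HasValue (D.joinBy a r b) (ω * sqrtT ^ r / (1 - G b a)) (stitchMatrix a b a G) := by
  have han : a ≠ n := by rintro rfl; simp [ha] at hn
  have hbn : b ≠ n := by rintro rfl; simp [hb] at hn
  have hrn : ∀ q, G n q = 0 := h.row_eq_zero hn
  have hcn : ∀ p, G p n = 0 := h.col_eq_zero hn
  have h1 := h.cup hn r
  have h2 := h1.stitch (i := a) (j := n) (k := a)
    (D' := ⟨Function.update D.strand a (some (x.append (Strand.edge r))), D.sign⟩)
    ⟨han, Or.inl rfl, x, Strand.edge r, by simp [ha, han], by simp, rfl, by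
      funext l
      by_cases k1 : l = a
      · simp [k1]
      by_cases k2 : l = n
      · subst k2; simp [k1, hn]
      simp [k1, k2]⟩
  have h3 := h2.stitch (i := a) (j := b) (k := a) (D' := D.joinBy a r b)
    ⟨hab, Or.inl rfl, x.append (Strand.edge r), y, by simp, by simp [hab.symm, hb], rfl, by
      funext l
      simp only [Diagram.joinBy, ha, hb]
      by_cases h1 : l = a
      · subst h1; simp [hab]
      by_cases h2 : l = b
      · subst h2; simp [h1]
      simp [h1, h2]⟩
  have hG : stitchMatrix a n a G = G := by
    funext p q
    simp only [stitchMatrix, merge]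
    by_cases h1 : p = a <;> by_cases h2 : p = n <;> by_cases h3 : q = a <;> by_cases h4 : q = n <;>
      subst_vars <;> simp_all
  rw [hG, hrn, sub_zero, div_one] at h3
  exact h3

/-! ### The effect of a slice on the value -/

/-- The bookkeeping of a stage is consistent. The components with a label at least `n₀` start at a
strand that is oriented downwards, the others start at the bottom of the diagram. -/
structure Stage.IsValid (n₀ : ℕ) (S : Stage) : Prop where
  le_nextLabel : n₀ ≤ S.nextLabel
  strand_eq_none : ∀ l, S.nextLabel ≤ l → S.diagram.strand l = none
  sign_eq_zero : ∀ c, S.nextCrossing ≤ c → S.diagram.sign c = 0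
  nodup : S.ends.Nodup
  mem_up : ∀ l, (l, true) ∈ S.ends ↔ S.diagram.strand l ≠ none
  mem_down : ∀ l, (l, false) ∈ S.ends ↔ S.diagram.strand l ≠ none ∧ n₀ ≤ l

theorem Stage.isValid_init (n : ℕ) : (Stage.init n).IsValid n where
  le_nextLabel := le_rfl
  strand_eq_none l hl := if_neg (not_lt.2 hl)
  sign_eq_zero _ _ := rfl
  nodup := List.nodup_range.map fun _ _ h => congrArg Prod.fst h
  mem_up l := by simp [Stage.init]
  mem_down l := by simp [Stage.init]

theorem hasValue_init (n : ℕ) (hn : n ≠ 0) :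
    HasValue (Stage.init n).diagram 1 (fun _ _ => 0) := by
  obtain ⟨n, rfl⟩ := Nat.exists_eq_succ_of_ne_zero hn
  clear hn
  induction n with
  | zero =>
    convert hasValue_alpha 0 0 using 1
    ext1
    · funext l
      simp [Stage.init, Diagram.alpha]
    · rfl
    · exact (zpow_zero _).symm
  | succ n ih =>
    convert ih.cup (n := n + 1) (by simp [Stage.init]) 0 using 1
    · ext1
      · funext l
        simp only [Stage.init, Function.update_apply]
        grind
      · rfl
    · simp

/-- The effect of a crossing on the ends and on the value. At a positive crossing the left strand `a`
is the over-strand, at a negative crossing the right strand `b`. -/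
theorem Stage.step_cross {n₀ k : ℕ} {S : Stage} {ω : Base} {G : ℕ → ℕ → Base} (hS : S.IsValid n₀)
    (h : HasValue S.diagram ω G) (σ : ℤˣ) {l₁ l₂ : List (ℕ × Bool)} {a b : ℕ}
    (hends : S.ends = l₁ ++ (a, true) :: (b, true) :: l₂) (hk : l₁.length = k) :
    ∃ S', S.step (.cross k σ) = some S' ∧ S'.ends = l₁ ++ (b, true) :: (a, true) :: l₂ ∧
      S'.nextLabel = S.nextLabel ∧ S'.IsValid n₀ ∧
      HasValue S'.diagram (ω * sqrtT ^ (σ : ℤ)) (crossForm (1 - t ^ (σ : ℤ))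
        (if σ = 1 then a else b) (if σ = 1 then b else a) G) := by
  have hab : a ≠ b := by
    rintro rfl
    have := hS.nodup
    simp [hends, List.nodup_append] at this
  obtain ⟨x, hx⟩ := Option.ne_none_iff_exists'.1 ((hS.mem_up a).1 (by simp [hends]))
  obtain ⟨y, hy⟩ := Option.ne_none_iff_exists'.1 ((hS.mem_up b).1 (by simp [hends]))
  have hdrop : S.ends.drop k = (a, true) :: (b, true) :: l₂ := by
    rw [hends, ← hk, List.drop_left]
  have htake : S.ends.take k = l₁ := by rw [hends, ← hk, List.take_left]
  have hne : ∀ l, ((S.diagram.extend a (Strand.ofPass ⟨S.nextCrossing, decide (σ = 1)⟩)).extend b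
      (Strand.ofPass ⟨S.nextCrossing, decide (σ = -1)⟩)).strand l = none ↔
      S.diagram.strand l = none := fun l => by
    simp only [Diagram.extend, Function.update_apply]
    by_cases h1 : l = b <;> by_cases h2 : l = a <;> simp [h1, h2, hx, hy, hab, hab.symm]
  have hperm : (l₁ ++ (b, true) :: (a, true) :: l₂).Perm S.ends := by
    rw [hends]
    exact (List.Perm.swap _ _ _).append_left l₁
  have hstep : S.step (.cross k σ) = some
      { diagram :=
          { (S.diagram.extend a (Strand.ofPass ⟨S.nextCrossing, decide (σ = 1)⟩)).extend b
              (Strand.ofPass ⟨S.nextCrossing, decide (σ = -1)⟩) with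
            sign := Function.update S.diagram.sign S.nextCrossing (σ : ℤ) }
        ends := l₁ ++ (b, true) :: (a, true) :: l₂
        nextLabel := S.nextLabel
        nextCrossing := S.nextCrossing + 1 } := by
    simp only [Stage.step, hdrop, htake]
    rfl
  refine ⟨_, hstep, rfl, rfl, ⟨hS.le_nextLabel, ?_, ?_, ?_, ?_, ?_⟩, ?_⟩
  · exact fun l hl => (hne l).2 (hS.strand_eq_none l hl)
  · intro c hc
    change S.nextCrossing + 1 ≤ c at hc
    change Function.update S.diagram.sign S.nextCrossing _ c = 0
    rw [Function.update_of_ne (by omega)]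
    exact hS.sign_eq_zero c (by omega)
  · exact hperm.nodup_iff.2 hS.nodup
  · intro l
    rw [hperm.mem_iff, hS.mem_up, ne_eq, ← hne]
  · intro l
    rw [hperm.mem_iff, hS.mem_down, ne_eq, ← hne]
  · have hsign : S.diagram.sign S.nextCrossing = 0 := hS.sign_eq_zero _ le_rfl
    have hn0 := hS.strand_eq_none S.nextLabel le_rfl
    have hn1 := hS.strand_eq_none (S.nextLabel + 1) (Nat.le_succ _)
    rcases Int.units_eq_one_or σ with rfl | rfl
    · convert h.cross 1 hab hx hy hn0 hn1 (Nat.succ_ne_self _).symm hsign using 1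
      · ext1
        · funext l
          by_cases h1 : l = a <;> by_cases h2 : l = b <;>
            simp_all [Diagram.extend, Function.update_apply]
        · rfl
      · simp
    · convert h.cross (-1) hab.symm hy hx hn0 hn1 (Nat.succ_ne_self _).symm hsign using 1
      · ext1
        · funext l
          by_cases h1 : l = a <;> by_cases h2 : l = b <;>
            simp_all [Diagram.extend, Function.update_apply]
        · rfl
      · rfl

/-- The effect of a minimum on the ends and on the value. -/
theorem Stage.step_cup {n₀ k : ℕ} {S : Stage} {ω : Base} {G : ℕ → ℕ → Base} (hS : S.IsValid n₀)
    (h : HasValue S.diagram ω G) (right : Bool) {l₁ l₂ : List (ℕ × Bool)}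
    (hends : S.ends = l₁ ++ l₂) (hk : l₁.length = k) :
    ∃ S', S.step (.cup k right) = some S' ∧
      S'.ends = l₁ ++ (S.nextLabel, !right) :: (S.nextLabel, right) :: l₂ ∧
      S'.nextLabel = S.nextLabel + 1 ∧ S'.IsValid n₀ ∧
      HasValue S'.diagram (ω * sqrtT ^ (if right then 1 else 0 : ℤ)) G := by
  have hdrop : S.ends.drop k = l₂ := by rw [hends, ← hk, List.drop_left]
  have htake : S.ends.take k = l₁ := by rw [hends, ← hk, List.take_left]
  have hle : k ≤ S.ends.length := by rw [hends, List.length_append]; omega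
  have hn0 := hS.strand_eq_none S.nextLabel le_rfl
  have hu := hS.mem_up
  have hd := hS.mem_down
  have hn := hS.nodup
  have hle := hS.le_nextLabel
  rw [hends] at hu hd hn
  refine ⟨_, by simp only [Stage.step]; rw [if_pos (by assumption)], by simp only [htake, hdrop],
    rfl, ⟨?_, ?_, ?_, ?_, ?_, ?_⟩, h.cup hn0 _⟩
  · exact hS.le_nextLabel.trans (Nat.le_succ _)
  · intro l hl
    change S.nextLabel + 1 ≤ l at hl
    change Function.update S.diagram.strand S.nextLabel _ l = none
    rw [Function.update_of_ne (by omega)]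
    exact hS.strand_eq_none l (by omega)
  · exact hS.sign_eq_zero
  · simp only [htake, hdrop]
    have h1 : (S.nextLabel, true) ∉ l₁ ++ l₂ := by rw [hu, not_not]; exact hn0
    have h2 : (S.nextLabel, false) ∉ l₁ ++ l₂ := by rw [hd]; exact fun h => h.1 hn0
    have h3 : (l₁ ++ (S.nextLabel, !right) :: (S.nextLabel, right) :: l₂).Perm
        ((S.nextLabel, !right) :: (S.nextLabel, right) :: (l₁ ++ l₂)) := by
      refine List.perm_middle.trans ((List.Perm.cons _ List.perm_middle))
    rw [h3.nodup_iff, List.nodup_cons, List.nodup_cons, List.mem_cons]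
    cases right <;> simp only [Bool.not_true, Bool.not_false] <;> refine ⟨?_, ?_, hn⟩ <;> simp_all
  · intro l
    simp only [htake, hdrop, Function.update_apply]
    have := hu l
    by_cases h1 : l = S.nextLabel
    · subst h1; cases right <;> simp
    · simp_all
  · intro l
    simp only [htake, hdrop, Function.update_apply]
    have := hd l
    by_cases h1 : l = S.nextLabel
    · subst h1; cases right <;> simp [hle]
    · simp_all

theorem mem_renameEnds {a b : ℕ} (hab : a ≠ b) (ends : List (ℕ × Bool)) (l : ℕ) (d : Bool) :
    (l, d) ∈ renameEnds a b ends ↔ (l ≠ b ∧ (l, d) ∈ ends) ∨ (l = a ∧ (b, d) ∈ ends) := by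
  rw [renameEnds, List.mem_map]
  constructor
  · rintro ⟨⟨l', d'⟩, h1, h2⟩
    simp only [Prod.mk.injEq] at h2
    obtain ⟨rfl, rfl⟩ := h2
    by_cases h3 : l' = b
    · subst h3
      simp [h1, hab]
    · simp [h3, h1]
  · rintro (⟨h1, h2⟩ | ⟨rfl, h2⟩)
    · exact ⟨_, h2, by simp [h1]⟩
    · exact ⟨_, h2, by simp⟩

/-- The effect of a maximum on the ends and on the value. -/
theorem Stage.step_cap {n₀ k : ℕ} {S : Stage} {ω : Base} {G : ℕ → ℕ → Base} (hS : S.IsValid n₀)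
    (h : HasValue S.diagram ω G) (right : Bool) {l₁ l₂ : List (ℕ × Bool)} {a b : ℕ} (hab : a ≠ b)
    (hends : S.ends = l₁ ++ (if right then a else b, right) :: (if right then b else a, !right) :: l₂)
    (hk : l₁.length = k) :
    ∃ S', S.step (.cap k right) = some S' ∧ S'.ends = renameEnds a b (l₁ ++ l₂) ∧
      S'.nextLabel = S.nextLabel ∧ S'.IsValid n₀ ∧
      HasValue S'.diagram (ω * sqrtT ^ (if right then -1 else 0 : ℤ) / (1 - G b a))
        (stitchMatrix a b a G) := by
  have hperm : S.ends.Perm ((a, true) :: (b, false) :: (l₁ ++ l₂)) := by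
    rw [hends]
    cases right
    · refine List.perm_middle.trans ((List.Perm.cons _ List.perm_middle).trans ?_)
      exact List.Perm.swap _ _ _
    · exact List.perm_middle.trans (List.Perm.cons _ List.perm_middle)
  have hu : ∀ l, (l, true) ∈ (a, true) :: (b, false) :: (l₁ ++ l₂) ↔ _ := fun l =>
    (hperm.mem_iff).symm.trans (hS.mem_up l)
  have hd : ∀ l, (l, false) ∈ (a, true) :: (b, false) :: (l₁ ++ l₂) ↔ _ := fun l =>
    (hperm.mem_iff).symm.trans (hS.mem_down l)
  have hn := hperm.nodup_iff.1 hS.nodup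
  obtain ⟨x, hx⟩ := Option.ne_none_iff_exists'.1 ((hu a).1 (by simp))
  obtain ⟨y, hy⟩ := Option.ne_none_iff_exists'.1 ((hd b).1 (by simp)).1
  have hnb := ((hd b).1 (by simp)).2
  have htake : S.ends.take k = l₁ := by rw [hends, ← hk, List.take_left]
  have hn0 := hS.strand_eq_none S.nextLabel le_rfl
  have hstep : S.step (.cap k right) = some
      { S with
        diagram := S.diagram.joinBy a (if right then -1 else 0) b
        ends := renameEnds a b (l₁ ++ l₂) } := by
    cases right
    · have hdrop : S.ends.drop k = (b, false) :: (a, true) :: l₂ := by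
        rw [hends, ← hk, List.drop_left]; simp
      simp [Stage.step, hdrop, hab, htake]
    · have hdrop : S.ends.drop k = (a, true) :: (b, false) :: l₂ := by
        rw [hends, ← hk, List.drop_left]; simp
      simp [Stage.step, hdrop, hab, htake]
  rw [List.nodup_cons, List.nodup_cons] at hn
  obtain ⟨hna, hnb', hn⟩ := hn
  have hmem := fun l d => mem_renameEnds hab (l₁ ++ l₂) l d
  have hstrand : ∀ l, (S.diagram.joinBy a (if right then -1 else 0) b).strand l = none ↔
      l = b ∨ S.diagram.strand l = none := by
    intro l
    simp only [Diagram.joinBy, Function.update_apply, hx, hy]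
    by_cases h1 : l = b <;> by_cases h2 : l = a <;> simp [h1, h2, hx]
  refine ⟨_, hstep, rfl, rfl, ⟨hS.le_nextLabel, ?_, hS.sign_eq_zero, ?_, ?_, ?_⟩,
    h.joinBy hab hx hy hn0 _⟩
  · exact fun l hl => (hstrand l).2 (Or.inr (hS.strand_eq_none l hl))
  · refine List.Nodup.map_on ?_ hn
    rintro ⟨p, d⟩ hp ⟨q, d'⟩ hq h1
    simp only [Prod.mk.injEq] at h1
    obtain ⟨h1, rfl⟩ := h1
    simp only [List.mem_cons, not_or] at hna
    cases d
    · have hpb : p ≠ b := by rintro rfl; exact hnb' hp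
      have hqb : q ≠ b := by rintro rfl; exact hnb' hq
      simpa [hpb, hqb] using h1
    · have hpa : p ≠ a := by rintro rfl; exact hna.2 hp
      have hqa : q ≠ a := by rintro rfl; exact hna.2 hq
      by_cases h2 : p = b <;> by_cases h3 : q = b <;> simp_all
  · intro l
    change (l, true) ∈ renameEnds a b (l₁ ++ l₂) ↔ ¬ _
    rw [hmem, hstrand, not_or]
    have h1 := hu l
    have h2 : (b, true) ∈ l₁ ++ l₂ := by
      have := (hu b).2 (by simp [hy])
      simpa [hab.symm] using this
    simp only [List.mem_cons, Prod.mk.injEq] at h1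
    by_cases h3 : l = a
    · subst h3
      simp_all
    · simp_all
  · intro l
    change (l, false) ∈ renameEnds a b (l₁ ++ l₂) ↔ ¬ _ ∧ _
    rw [hmem, hstrand, not_or]
    have h1 := hd l
    simp only [List.mem_cons, Prod.mk.injEq] at h1
    by_cases h3 : l = b
    · subst h3
      simp_all
    · simp_all

/-! ### Braids -/

theorem Stage.run_append (S : Stage) (w w' : List Slice) :
    S.run (w ++ w') = (S.run w).bind fun S' => S'.run w' := by
  induction w generalizing S with
  | nil => rfl
  | cons x w ih =>
    rw [List.cons_append, Stage.run, Stage.run, Option.bind_assoc]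
    simp only [ih]

theorem exists_eq_append_cons_cons {α : Type*} {l : List α} {k : ℕ} {a b : α}
    (ha : l[k]? = some a) (hb : l[k + 1]? = some b) :
    ∃ l₁ l₂, l = l₁ ++ a :: b :: l₂ ∧ l₁.length = k := by
  obtain ⟨h1, rfl⟩ := List.getElem?_eq_some_iff.1 ha
  obtain ⟨h2, rfl⟩ := List.getElem?_eq_some_iff.1 hb
  refine ⟨l.take k, l.drop (k + 2), ?_, ?_⟩
  · rw [← List.drop_eq_getElem_cons h2, ← List.drop_eq_getElem_cons h1, List.take_append_drop]
  · rw [List.length_take]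
    omega

/-- Multiplication by the Burau matrix of `σ_k^{± 1}` changes only the rows `k` and `k + 1`. -/
theorem burauUnit_zpow_mul {K : Type*} [Field K] {n : ℕ} (τ : Kˣ) (k : Fin n) (σ : ℤˣ)
    (B : Matrix (Fin (n + 1)) (Fin (n + 1)) K) (i p : Fin (n + 1)) :
    ((burauUnit τ k ^ (σ : ℤ)).val * B) i p =
      B i p + (if σ = 1 then 1 else (τ : K)⁻¹) * burauCol (τ : K) k i *
        (B k.castSucc p - B k.succ p) := by
  have h1 : (Matrix.vecMulVec (burauCol (τ : K) k) (burauRow k) * B) i p =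
      burauCol (τ : K) k i * (B k.castSucc p - B k.succ p) := by
    rw [Matrix.vecMulVec_mul, Matrix.vecMulVec_apply]
    simp [burauRow, Matrix.sub_vecMul]
  rcases Int.units_eq_one_or σ with rfl | rfl
  · have h2 : (burauUnit τ k ^ ((1 : ℤˣ) : ℤ)).val =
        1 + Matrix.vecMulVec (burauCol (τ : K) k) (burauRow k) := by
      rw [Units.val_one, zpow_one, ← burauMatrix_eq]
      rfl
    rw [h2, add_mul, one_mul, Matrix.add_apply, h1, if_pos rfl, one_mul]
  · have h2 : (burauUnit τ k ^ ((-1 : ℤˣ) : ℤ)).val =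
        1 + (τ : K)⁻¹ • Matrix.vecMulVec (burauCol (τ : K) k) (burauRow k) := by
      rw [Units.val_neg, Units.val_one, zpow_neg_one]
      rfl
    rw [h2, add_mul, one_mul, Matrix.add_apply, Matrix.smul_mul, Matrix.smul_apply, h1,
      if_neg (by decide), smul_eq_mul, mul_assoc]

/-- The braid of a word permutes the strands according to `π`, which is also recorded by the Burau
representation at `τ = 1`; the columns of `1 + G`, sorted by the positions at the top, are the rows
of the Burau representation at `τ = t`. -/
theorem run_braidSlices {n : ℕ} (w : List (Fin n × ℤˣ)) :
    ∃ (S : Stage) (π : Equiv.Perm (Fin (n + 1))) (G : ℕ → ℕ → Base),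
      (Stage.init (n + 1)).run (braidSlices w) = some S ∧
      (∀ i : Fin (n + 1), S.ends[(i : ℕ)]? = some ((π i : ℕ), true)) ∧
      S.IsValid (n + 1) ∧ S.nextLabel = n + 1 ∧ HasValue S.diagram (sqrtT ^ writhe w) G ∧
      (∀ i l, (burau n (1 : Baseˣ) (braidOfWord w)).val i l = if π i = l then 1 else 0) ∧
      ∀ i p : Fin (n + 1), (burau n tUnit (braidOfWord w)).val i p =
        (if p = π i then 1 else 0) + G p (π i) := by
  induction w with
  | nil =>
    refine ⟨Stage.init (n + 1), 1, fun _ _ => 0, rfl, fun i => ?_, Stage.isValid_init _, rfl,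
      hasValue_init _ n.succ_ne_zero, fun i l => ?_, fun i p => ?_⟩
    · simp [Stage.init, List.getElem?_range i.isLt]
    · simp only [braidOfWord, List.map_nil, List.prod_nil, map_one]
      exact Matrix.one_apply
    · simp [braidOfWord, Matrix.one_apply, eq_comm]
  | cons x w ih =>
    obtain ⟨k, σ⟩ := x
    obtain ⟨S, π, G, hrun, hends, hS, hnext, hG, h1, ht⟩ := ih
    obtain ⟨l₁, l₂, hl, hk⟩ := exists_eq_append_cons_cons (hends k.castSucc) (by
      simpa using hends k.succ)
    obtain ⟨S', hstep, hends', hnext', hS', hG'⟩ := Stage.step_cross hS hG σ hl hk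
    have hburau : ∀ τ : Baseˣ, (burau n τ (braidOfWord ((k, σ) :: w))).val =
        (burauUnit τ k ^ (σ : ℤ)).val * (burau n τ (braidOfWord w)).val := fun τ => by
      rw [braidOfWord, List.map_cons, List.prod_cons, map_mul, map_zpow]
      simp [burau, braidOfWord]
    have hne : k.castSucc ≠ k.succ := k.castSucc_lt_succ.ne
    have hval : ∀ i : Fin (n + 1), (i = k.castSucc ∨ i = k.succ ∨
        (i ≠ k.castSucc ∧ i ≠ k.succ)) := fun i => by tauto
    have hinj : ∀ i j, ((π i : ℕ) = π j) ↔ i = j := fun i j => by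
      rw [← Fin.ext_iff, π.injective.eq_iff]
    have hzpow : sqrtT ^ writhe w * sqrtT ^ (σ : ℤ) = sqrtT ^ writhe ((k, σ) :: w) := by
      rw [← zpow_add₀ sqrtT_ne_zero, add_comm]
      rfl
    rw [hzpow] at hG'
    refine ⟨S', π * Equiv.swap k.castSucc k.succ, _, ?_, fun i => ?_, hS', hnext'.trans hnext,
      hG', fun i l => ?_, fun i p => ?_⟩
    · rw [braidSlices, List.reverse_cons, List.map_append, Stage.run_append]
      change ((Stage.init (n + 1)).run (braidSlices w)).bind _ = _
      rw [hrun, Option.bind_some]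
      change (S.step (.cross k.castSucc σ)).bind (fun S' => S'.run []) = some S'
      rw [hstep]
      rfl
    · rw [hends', Equiv.Perm.mul_apply]
      rcases hval i with rfl | rfl | ⟨h2, h3⟩
      · rw [Equiv.swap_apply_left, ← hk]
        simp
      · rw [Equiv.swap_apply_right, Fin.val_succ, show (k : ℕ) = k.castSucc from rfl, ← hk]
        simp
      · rw [Equiv.swap_apply_of_ne_of_ne h2 h3, ← hends i, hl]
        have h4 : (i : ℕ) ≠ l₁.length := fun h => h2 (Fin.ext (h.trans hk))
        have h5 : (i : ℕ) ≠ l₁.length + 1 := fun h => h3 (Fin.ext (by rw [h, hk]; rfl))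
        rcases lt_or_ge (i : ℕ) l₁.length with h6 | h6
        · rw [List.getElem?_append_left h6, List.getElem?_append_left h6]
        · rw [List.getElem?_append_right h6, List.getElem?_append_right h6]
          obtain ⟨m, hm⟩ : ∃ m, (i : ℕ) - l₁.length = m + 2 :=
            ⟨(i : ℕ) - l₁.length - 2, by omega⟩
          rw [hm]
          rfl
    · rw [hburau, burauUnit_zpow_mul, h1, h1, h1, Equiv.Perm.mul_apply]
      simp only [Units.val_one, inv_one, ite_self, one_mul, burauCol, one_smul, Pi.sub_apply]
      rcases hval i with rfl | rfl | ⟨h2, h3⟩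
      · rw [Equiv.swap_apply_left, Pi.single_eq_same, Pi.single_eq_of_ne hne]
        ring
      · rw [Equiv.swap_apply_right, Pi.single_eq_same, Pi.single_eq_of_ne hne.symm]
        ring
      · rw [Equiv.swap_apply_of_ne_of_ne h2 h3, Pi.single_eq_of_ne h2, Pi.single_eq_of_ne h3]
        ring
    · have ht0 : (tUnit : Base) = t := rfl
      have ht1 : t ≠ 0 := t_ne_zero
      rw [hburau, burauUnit_zpow_mul, ht, ht, ht, Equiv.Perm.mul_apply]
      simp only [burauCol, Pi.sub_apply, Pi.smul_apply, smul_eq_mul, ht0, crossForm]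
      rcases hval i with rfl | rfl | ⟨h2, h3⟩
      · rw [Equiv.swap_apply_left, Pi.single_eq_same, Pi.single_eq_of_ne hne]
        rcases Int.units_eq_one_or σ with rfl | rfl
        · simp [← Fin.ext_iff]
          ring
        · simp [hinj, hne.symm]
          field_simp
          ring
      · rw [Equiv.swap_apply_right, Pi.single_eq_same, Pi.single_eq_of_ne hne.symm]
        rcases Int.units_eq_one_or σ with rfl | rfl
        · simp [hinj, hne]
        · simp [← Fin.ext_iff]
          ring
      · rw [Equiv.swap_apply_of_ne_of_ne h2 h3, Pi.single_eq_of_ne h2, Pi.single_eq_of_ne h3]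
        rcases Int.units_eq_one_or σ with rfl | rfl
        · simp [hinj, h3]
        · simp [hinj, h2]

/-- The value of the invariant on a braid. -/
theorem zValue_braid_iff {n : ℕ} (w : List (Fin n × ℤˣ)) :
    ∃ S : Stage, (Stage.init (n + 1)).run (braidSlices w) = some S ∧
      ∀ g : Series, ZValue S.diagram g ↔ g = MvPowerSeries.C (sqrtT ^ writhe w) *
        expQuadratic ((burau n tUnit (braidOfWord w)).val.transpose *
          (burau n 1 (braidOfWord w)).val - 1) := by
  obtain ⟨S, π, G, hrun, -, hS, hnext, ⟨g, hg, hG⟩, h1, ht⟩ := run_braidSlices w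
  refine ⟨S, hrun, ?_⟩
  set Q : Matrix (Fin (n + 1)) (Fin (n + 1)) Base :=
    (burau n tUnit (braidOfWord w)).val.transpose * (burau n 1 (braidOfWord w)).val - 1 with hQ'
  have hQ : ∀ i j, Q i j = G i j := fun i j => by
    rw [hQ', Matrix.sub_apply, Matrix.mul_apply, Finset.sum_eq_single (π.symm j)]
    · rw [Matrix.transpose_apply, h1, ht, Equiv.apply_symm_apply, Matrix.one_apply]
      simp
    · intro l _ hl
      rw [h1, if_neg (fun h => hl (by simp [← h])), mul_zero]
    · simp
  obtain ⟨L, -, hL⟩ := hG.exists_labels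
  have hrow : ∀ l l', l ∉ Finset.range (n + 1) → G l l' = 0 := fun l l' hl =>
    hG.row_eq_zero (hS.strand_eq_none l (by simpa [hnext] using hl)) l'
  have hcol : ∀ l l', l' ∉ Finset.range (n + 1) → G l l' = 0 := fun l l' hl =>
    hG.col_eq_zero (hS.strand_eq_none l' (by simpa [hnext] using hl)) l
  have hval := hL.unique' (isGaussian_exp (Finset.range (n + 1)) _ G hrow hcol)
  have hsum : ∑ l ∈ Finset.range (n + 1), e l * fForm (Finset.range (n + 1)) (G l) =
      ∑ i : Fin (n + 1), ∑ j : Fin (n + 1), MvPowerSeries.C (G i j) * e i * f j := by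
    rw [Finset.sum_range]
    refine Finset.sum_congr rfl fun i _ => ?_
    rw [fForm, Finset.sum_range, Finset.mul_sum]
    exact Finset.sum_congr rfl fun j _ => by ring
  have hg' : g = MvPowerSeries.C (sqrtT ^ writhe w) * expQuadratic Q := by
    rw [hval, hsum, expQuadratic]
    simp only [hQ]
  intro g'
  rw [← hg']
  exact ⟨fun h => h.unique hg, fun h => h ▸ hg⟩

/-! ### The involution `t ↦ t⁻¹` and a sesquilinear form on colourings -/

theorem transcendental_sqrtT_inv : Transcendental ℚ sqrtT⁻¹ := fun h => by
  refine RatFunc.transcendental_X (K := ℚ) ?_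
  convert IsAlgebraic.inv_iff.1 h
  · exact Subsingleton.elim _ _
  · rfl

/-- The involution of the base ring with `t^{1/2} ↦ t^{-1/2}`. -/
noncomputable def bar : Base →+* Base :=
  RatFunc.liftRingHom (Polynomial.aeval (R := ℚ) sqrtT⁻¹ : Polynomial ℚ →ₐ[ℚ] Base).toRingHom
    (nonZeroDivisors_le_comap_nonZeroDivisors_of_injective _
      (transcendental_iff_injective.1 transcendental_sqrtT_inv))

theorem bar_sqrtT : bar sqrtT = sqrtT⁻¹ := by
  rw [bar]
  exact (RatFunc.liftRingHom_X _ _).trans (Polynomial.aeval_X _)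

theorem bar_t : bar t = t⁻¹ := by rw [t, map_pow, bar_sqrtT, inv_pow]

theorem bar_sqrtT_zpow (r : ℤ) : bar (sqrtT ^ r) = sqrtT ^ (-r) := by
  rw [map_zpow₀, bar_sqrtT, inv_zpow']

/-- The state after reading a list of ends from left to right. -/
noncomputable def scanState (y : ℕ × Bool → Base) : Base → List (ℕ × Bool) → Base
  | Y, [] => Y
  | Y, z :: l => scanState y (if z.2 then t * (Y + y z) else t⁻¹ * Y - y z) l

/-- A form on pairs of colourings `x`, `y` of the strands at a given height. It is linear in `x` and
`y`, and it does not change when a slice is added and the colourings are continued, `x` according to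
the Burau representation at `t` and `y` according to the one at `t⁻¹`. -/
noncomputable def scanForm (x y : ℕ × Bool → Base) : Base → List (ℕ × Bool) → Base
  | _, [] => 0
  | Y, z :: l => x z * ((if z.2 then 1 else -t⁻¹) * (y z + (1 - t⁻¹) * Y)) +
      scanForm x y (if z.2 then t * (Y + y z) else t⁻¹ * Y - y z) l

section

variable {x x' y y' : ℕ × Bool → Base} {Y : Base} {l l₁ l₂ : List (ℕ × Bool)}

theorem scanForm_append (x y : ℕ × Bool → Base) (Y : Base) (l l' : List (ℕ × Bool)) :
    scanForm x y Y (l ++ l') = scanForm x y Y l + scanForm x y (scanState y Y l) l' := by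
  induction l generalizing Y with
  | nil => simp [scanForm, scanState]
  | cons z l ih => rw [List.cons_append, scanForm, scanForm, scanState, ih, add_assoc]

theorem scanState_congr (hy : ∀ z ∈ l, y z = y' z) : scanState y Y l = scanState y' Y l := by
  induction l generalizing Y with
  | nil => rfl
  | cons z l ih =>
    rw [scanState, scanState, hy z List.mem_cons_self, ih fun z hz => hy z (List.mem_cons_of_mem _ hz)]

theorem scanForm_congr (hx : ∀ z ∈ l, x z = x' z) (hy : ∀ z ∈ l, y z = y' z) :
    scanForm x y Y l = scanForm x' y' Y l := by
  induction l generalizing Y with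
  | nil => rfl
  | cons z l ih =>
    rw [scanForm, scanForm, hx z List.mem_cons_self, hy z List.mem_cons_self,
      ih (fun z hz => hx z (List.mem_cons_of_mem _ hz)) fun z hz => hy z (List.mem_cons_of_mem _ hz)]

theorem scanForm_map (r : ℕ → ℕ) : scanForm x y Y (l.map fun z => (r z.1, z.2)) =
    scanForm (fun z => x (r z.1, z.2)) (fun z => y (r z.1, z.2)) Y l := by
  induction l generalizing Y with
  | nil => rfl
  | cons z l ih => rw [List.map_cons, scanForm, scanForm, ih]

theorem scanForm_zero_left (hx : ∀ z ∈ l, x z = 0) : scanForm x y Y l = 0 := by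
  induction l generalizing Y with
  | nil => rfl
  | cons z l ih =>
    rw [scanForm, hx z List.mem_cons_self, ih fun z hz => hx z (List.mem_cons_of_mem _ hz), zero_mul,
      add_zero]

theorem scanState_zero (hy : ∀ z ∈ l, y z = 0) : scanState y 0 l = 0 := by
  induction l with
  | nil => rfl
  | cons z l ih =>
    rw [scanState, hy z List.mem_cons_self, add_zero, mul_zero, mul_zero, sub_zero, ite_self,
      ih fun z hz => hy z (List.mem_cons_of_mem _ hz)]

theorem scanForm_zero_right (hy : ∀ z ∈ l, y z = 0) : scanForm x y 0 l = 0 := by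
  induction l with
  | nil => rfl
  | cons z l ih =>
    rw [scanForm, hy z List.mem_cons_self]
    simp only [mul_zero, add_zero, sub_zero, ite_self, zero_add]
    exact ih fun z hz => hy z (List.mem_cons_of_mem _ hz)

theorem scanForm_add_smul_left (c : Base) :
    scanForm (fun z => x z + c * x' z) y Y l = scanForm x y Y l + c * scanForm x' y Y l := by
  induction l generalizing Y with
  | nil => simp [scanForm]
  | cons z l ih =>
    rw [scanForm, scanForm, scanForm, ih]
    ring

theorem scanForm_sum_left {α : Type*} (s : Finset α) (c : α → Base) (X : α → ℕ × Bool → Base) :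
    scanForm (fun z => ∑ i ∈ s, c i * X i z) y Y l = ∑ i ∈ s, c i * scanForm (X i) y Y l := by
  induction l generalizing Y with
  | nil => simp [scanForm]
  | cons z l ih =>
    simp only [scanForm, ih, mul_add, Finset.sum_add_distrib, Finset.sum_mul, mul_assoc]

theorem scanForm_add_smul_right (c Y' : Base) :
    scanForm x (fun z => y z + c * y' z) (Y + c * Y') l =
      scanForm x y Y l + c * scanForm x y' Y' l := by
  induction l generalizing Y Y' with
  | nil => simp [scanForm]
  | cons z l ih =>
    rw [scanForm, scanForm, scanForm]
    have h : (if z.2 then t * (Y + c * Y' + (y z + c * y' z)) else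
        t⁻¹ * (Y + c * Y') - (y z + c * y' z)) =
        (if z.2 then t * (Y + y z) else t⁻¹ * Y - y z) +
          c * (if z.2 then t * (Y' + y' z) else t⁻¹ * Y' - y' z) := by
      split_ifs <;> ring
    rw [h, ih]
    ring

/-- Two neighbouring strands of opposite directions with the same colours can be removed. -/
theorem scanForm_pair (x : ℕ × Bool → Base) (Y : Base) (l₁ l₂ : List (ℕ × Bool)) {z z' : ℕ × Bool}
    (hd : z'.2 = !z.2) (hy : y z' = y z) :
    scanForm x y Y (l₁ ++ z :: z' :: l₂) = scanForm x y Y (l₁ ++ l₂) +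
      (x z - x z') * ((if z.2 then 1 else -t⁻¹) * (y z + (1 - t⁻¹) * scanState y Y l₁)) := by
  have ht := t_ne_zero
  rw [scanForm_append, scanForm_append, scanForm, scanForm]
  generalize scanState y Y l₁ = Y'
  rcases z with ⟨a, _ | _⟩ <;> rcases z' with ⟨b, _ | _⟩ <;> simp only [Bool.not_true, Bool.not_false,
    reduceCtorEq] at hd
  · have h1 : t * (t⁻¹ * Y' - y (a, false) + y (a, false)) = Y' := by
      rw [sub_add_cancel, mul_inv_cancel_left₀ ht]
    simp only [if_true, Bool.false_eq_true, if_false, hy, h1]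
    ring
  · have h1 : t⁻¹ * (t * (Y' + y (a, true))) - y (a, true) = Y' := by
      rw [inv_mul_cancel_left₀ ht, add_sub_cancel_right]
    simp only [if_true, Bool.false_eq_true, if_false, hy, h1]
    field_simp
    ring

theorem scanForm_cross_pos {a b : ℕ} (h₁ : ∀ z ∈ l₁, x' z = x z ∧ y' z = y z)
    (h₂ : ∀ z ∈ l₂, x' z = x z ∧ y' z = y z) (hxa : x' (a, true) = x (a, true))
    (hya : y' (a, true) = y (a, true))
    (hxb : x' (b, true) = t * x (b, true) + (1 - t) * x (a, true))
    (hyb : y' (b, true) = t⁻¹ * y (b, true) + (1 - t⁻¹) * y (a, true)) :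
    scanForm x' y' Y (l₁ ++ (b, true) :: (a, true) :: l₂) =
      scanForm x y Y (l₁ ++ (a, true) :: (b, true) :: l₂) := by
  have ht := t_ne_zero
  simp only [scanForm_append, scanForm, scanState_congr fun z hz => (h₁ z hz).2,
    scanForm_congr (fun z hz => (h₁ z hz).1) (fun z hz => (h₁ z hz).2),
    scanForm_congr (fun z hz => (h₂ z hz).1) (fun z hz => (h₂ z hz).2), if_true, hxa, hya, hxb, hyb]
  generalize scanState y Y l₁ = Y'
  have h1 : t * (t * (Y' + (t⁻¹ * y (b, true) + (1 - t⁻¹) * y (a, true))) + y (a, true)) =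
      t * (t * (Y' + y (a, true)) + y (b, true)) := by
    field_simp
    ring
  rw [h1]
  field_simp
  ring

theorem scanForm_cross_neg {a b : ℕ} (h₁ : ∀ z ∈ l₁, x' z = x z ∧ y' z = y z)
    (h₂ : ∀ z ∈ l₂, x' z = x z ∧ y' z = y z) (hxb : x' (b, true) = x (b, true))
    (hyb : y' (b, true) = y (b, true))
    (hxa : x' (a, true) = t⁻¹ * x (a, true) + (1 - t⁻¹) * x (b, true))
    (hya : y' (a, true) = t * y (a, true) + (1 - t) * y (b, true)) :
    scanForm x' y' Y (l₁ ++ (b, true) :: (a, true) :: l₂) =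
      scanForm x y Y (l₁ ++ (a, true) :: (b, true) :: l₂) := by
  have ht := t_ne_zero
  refine (scanForm_cross_pos (fun z hz => ⟨(h₁ z hz).1.symm, (h₁ z hz).2.symm⟩)
    (fun z hz => ⟨(h₂ z hz).1.symm, (h₂ z hz).2.symm⟩) hxb.symm hyb.symm ?_ ?_).symm
  · rw [hxa, hxb]
    field_simp
    ring
  · rw [hya, hyb]
    field_simp
    ring

end

/-! ### The colouring of the ends of a diagram -/

section

/-- The colour of an end if the component `l` starts with the colour `1` and all other components
start with the colour `0`. -/
noncomputable def strandColour (G : ℕ → ℕ → Base) (l : ℕ) (z : ℕ × Bool) : Base :=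
  (if z.1 = l then 1 else 0) + if z.2 then G l z.1 else 0

/-- The entries of a form, under the involution of the base ring. -/
noncomputable def barForm (G : ℕ → ℕ → Base) : ℕ → ℕ → Base := fun p q => bar (G p q)

/-- The colouring after a crossing has been added, with over-strand `o` and under-strand `u`. -/
noncomputable def crossColour (c : Base) (o u : ℕ) (x : ℕ × Bool → Base) (z : ℕ × Bool) : Base :=
  if z = (u, true) then x z + c * (x (o, true) - x z) else x z

theorem strandColour_crossForm (c : Base) (o u : ℕ) (G : ℕ → ℕ → Base) (l : ℕ) :
    strandColour (crossForm c o u G) l = crossColour c o u (strandColour G l) := by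
  funext ⟨q, d⟩
  simp only [strandColour, crossForm, crossColour, Prod.mk.injEq]
  cases d
  · simp
  · by_cases h : q = u
    · subst h
      simp only [if_true, and_self, eq_comm (a := l)]
      ring
    · simp [h]

theorem bar_one_sub_t_zpow (σ : ℤ) : bar (1 - t ^ σ) = 1 - t ^ (-σ) := by
  rw [map_sub, map_one, map_zpow₀, bar_t, inv_zpow']

theorem barForm_crossForm (c : Base) (o u : ℕ) (G : ℕ → ℕ → Base) :
    barForm (crossForm c o u G) = crossForm (bar c) o u (barForm G) := by
  funext p q
  simp only [barForm, crossForm]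
  split_ifs <;> simp

theorem barForm_stitchMatrix (i j k : ℕ) (G : ℕ → ℕ → Base) :
    barForm (stitchMatrix i j k G) = stitchMatrix i j k (barForm G) := by
  funext p q
  simp only [barForm, stitchMatrix, merge]
  split_ifs <;> simp

/-- The form does not change at a crossing of either sign. -/
theorem scanForm_cross (σ : ℤˣ) {a b : ℕ} (hab : a ≠ b) {l₁ l₂ : List (ℕ × Bool)}
    (ha₁ : (a, true) ∉ l₁) (ha₂ : (a, true) ∉ l₂) (hb₁ : (b, true) ∉ l₁) (hb₂ : (b, true) ∉ l₂)
    (x y : ℕ × Bool → Base) (Y : Base) :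
    scanForm (crossColour (1 - t ^ (σ : ℤ)) (if σ = 1 then a else b) (if σ = 1 then b else a) x)
      (crossColour (1 - t ^ (-σ : ℤ)) (if σ = 1 then a else b) (if σ = 1 then b else a) y) Y
      (l₁ ++ (b, true) :: (a, true) :: l₂) =
    scanForm x y Y (l₁ ++ (a, true) :: (b, true) :: l₂) := by
  have hc : ∀ (c : Base) (o u : ℕ) (x : ℕ × Bool → Base) (l : List (ℕ × Bool)), (u, true) ∉ l →
      ∀ z ∈ l, crossColour c o u x z = x z := fun c o u x l hu z hz =>
    if_neg fun h => hu (by rwa [h] at hz)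
  have hc' : ∀ (c : Base) {o u : ℕ} (x : ℕ × Bool → Base), o ≠ u →
      crossColour c o u x (o, true) = x (o, true) := fun c o u x hou =>
    if_neg fun h => hou (congrArg Prod.fst h)
  have hc'' : ∀ (c : Base) (o u : ℕ) (x : ℕ × Bool → Base),
      crossColour c o u x (u, true) = (1 - c) * x (u, true) + c * x (o, true) := fun c o u x => by
    rw [crossColour, if_pos rfl]
    ring
  rcases Int.units_eq_one_or σ with rfl | rfl
  · simp only [if_true, Units.val_one, zpow_one, zpow_neg_one]
    refine scanForm_cross_pos (fun z hz => ⟨hc _ _ _ _ _ hb₁ z hz, hc _ _ _ _ _ hb₁ z hz⟩)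
      (fun z hz => ⟨hc _ _ _ _ _ hb₂ z hz, hc _ _ _ _ _ hb₂ z hz⟩) (hc' _ _ hab) (hc' _ _ hab)
      ?_ ?_ <;> rw [hc'', sub_sub_cancel]
  · simp only [if_neg (show (-1 : ℤˣ) ≠ 1 by decide), Units.val_neg, Units.val_one, zpow_neg_one,
      neg_neg, zpow_one]
    refine scanForm_cross_neg (fun z hz => ⟨hc _ _ _ _ _ ha₁ z hz, hc _ _ _ _ _ ha₁ z hz⟩)
      (fun z hz => ⟨hc _ _ _ _ _ ha₂ z hz, hc _ _ _ _ _ ha₂ z hz⟩) (hc' _ _ hab.symm)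
      (hc' _ _ hab.symm) ?_ ?_ <;> rw [hc'', sub_sub_cancel]

/-- The form on the ends at the given height equals the form on the strands at the bottom, if the
component `0` is the only one that starts at the bottom. -/
def PreservesForm (ends : List (ℕ × Bool)) (G : ℕ → ℕ → Base) : Prop :=
  ∀ l l', scanForm (strandColour G l) (strandColour (barForm G) l') 0 ends =
    if l = 0 ∧ l' = 0 then 1 else 0

/-- The matrix of the form, as a function of the colours `x` of the upward ends and of the colours `y`
of the starting points of the components. It is completed by rows of the identity matrix for the
numbers `u < N` that do not label an upward end. -/
noncomputable def scanMatrix (N : ℕ) (ends : List (ℕ × Bool)) (G : ℕ → ℕ → Base) :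
    Matrix (Fin N) (Fin N) Base := Matrix.of fun u l =>
  if ((u : ℕ), true) ∈ ends then
    scanForm (Pi.single ((u : ℕ), true) 1) (strandColour (barForm G) l) 0 ends
  else if u = l then 1 else 0

open Matrix

theorem det_one_add_vecMulVec {m : Type*} [Fintype m] [DecidableEq m] (u v : m → Base) :
    (1 + vecMulVec u v).det = 1 + v ⬝ᵥ u := by
  rw [vecMulVec_eq Unit, det_one_add_replicateCol_mul_replicateRow]

/-- Laplace expansion along a row with only one entry. -/
theorem det_eq_of_row {m : Type*} [Fintype m] [DecidableEq m] {A B : Matrix m m Base} (b : m)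
    (hA : ∀ j, j ≠ b → A b j = 0) (hB : ∀ j, j ≠ b → B b j = 0)
    (h : ∀ i j, i ≠ b → j ≠ b → A i j = B i j) : A.det * B b b = B.det * A b b := by
  have key : ∀ M : Matrix m m Base, (∀ j, j ≠ b → M b j = 0) →
      M.det = (M.toSquareBlockProp fun i => i ≠ b).det * M b b := by
    intro M hM
    rw [twoBlockTriangular_det M (fun i => i ≠ b) fun i hi j hj => by
      rw [not_not.1 hi]
      exact hM j hj]
    congr 1
    have : Subsingleton {i // ¬i ≠ b} := ⟨fun i j => Subtype.ext <|
      (not_not.1 i.2).trans (not_not.1 j.2).symm⟩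
    rw [det_eq_elem_of_subsingleton _ (⟨b, not_not.2 rfl⟩ : {i // ¬i ≠ b})]
    rfl
  have hAB : (A.toSquareBlockProp fun i => i ≠ b) = B.toSquareBlockProp fun i => i ≠ b := by
    ext i j
    exact h i j i.2 j.2
  rw [key A hA, key B hB, hAB]
  ring

/-- Laplace expansion along a column with only one entry. -/
theorem det_eq_of_col {m : Type*} [Fintype m] [DecidableEq m] {A B : Matrix m m Base} (b : m)
    (hA : ∀ i, i ≠ b → A i b = 0) (hB : ∀ i, i ≠ b → B i b = 0)
    (h : ∀ i j, i ≠ b → j ≠ b → A i j = B i j) : A.det * B b b = B.det * A b b := by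
  rw [← det_transpose A, ← det_transpose B]
  exact det_eq_of_row b hA hB fun i j hi hj => h j i hj hi

section Cross

variable {a b : ℕ} {l₁ l₂ : List (ℕ × Bool)} {G : ℕ → ℕ → Base}

theorem PreservesForm.cross (h : PreservesForm (l₁ ++ (a, true) :: (b, true) :: l₂) G)
    (hn : (l₁ ++ (a, true) :: (b, true) :: l₂).Nodup) (σ : ℤˣ) :
    PreservesForm (l₁ ++ (b, true) :: (a, true) :: l₂)
      (crossForm (1 - t ^ (σ : ℤ)) (if σ = 1 then a else b) (if σ = 1 then b else a) G) := by
  intro l l'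
  rw [barForm_crossForm, bar_one_sub_t_zpow, strandColour_crossForm, strandColour_crossForm,
    scanForm_cross, h]
  all_goals simp [List.nodup_append] at hn; grind

/-- A crossing of sign `σ` multiplies the determinant by `t^{-σ}`, the factor by which the colour `y` of
the under-strand is multiplied. -/
theorem det_scanMatrix_cross (hn : (l₁ ++ (a, true) :: (b, true) :: l₂).Nodup) (σ : ℤˣ) {N : ℕ}
    (ha : a < N) (hb : b < N) :
    (scanMatrix N (l₁ ++ (b, true) :: (a, true) :: l₂)
      (crossForm (1 - t ^ (σ : ℤ)) (if σ = 1 then a else b) (if σ = 1 then b else a) G)).det =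
    t ^ (-σ : ℤ) * (scanMatrix N (l₁ ++ (a, true) :: (b, true) :: l₂) G).det := by
  obtain ⟨hab, ha₁, ha₂, hb₁, hb₂⟩ : a ≠ b ∧ (a, true) ∉ l₁ ∧ (a, true) ∉ l₂ ∧ (b, true) ∉ l₁ ∧
      (b, true) ∉ l₂ := by
    simp [List.nodup_append] at hn
    grind
  have hx := fun x y => scanForm_cross σ hab ha₁ ha₂ hb₁ hb₂ x y 0
  have ho : (if σ = 1 then a else b) ≠ (if σ = 1 then b else a) := by split_ifs <;> grind
  have hu : (if σ = 1 then b else a) < N := by split_ifs <;> assumption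
  have hmem : ∀ z, z ∈ l₁ ++ (b, true) :: (a, true) :: l₂ ↔ z ∈ l₁ ++ (a, true) :: (b, true) :: l₂ :=
    fun z => ((List.Perm.swap _ _ _).append_left l₁).mem_iff
  have hmo : ((if σ = 1 then a else b), true) ∈ l₁ ++ (a, true) :: (b, true) :: l₂ := by
    split_ifs <;> simp
  have hmu : ((if σ = 1 then b else a), true) ∈ l₁ ++ (a, true) :: (b, true) :: l₂ := by
    split_ifs <;> simp
  revert hx ho hu hmo hmu
  generalize (if σ = 1 then a else b) = o
  generalize (if σ = 1 then b else a) = u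
  intro hx ho hu hmo hmu
  have ht : t ^ (σ : ℤ) ≠ 0 := zpow_ne_zero _ t_ne_zero
  -- The row operation that corresponds to the crossing.
  set k : Fin N → Base := fun w =>
    if (w : ℕ) = u then t ^ (-σ : ℤ) - 1 else if (w : ℕ) = o then 1 - t ^ (-σ : ℤ) else 0 with hk
  have hP : scanMatrix N (l₁ ++ (b, true) :: (a, true) :: l₂) (crossForm (1 - t ^ (σ : ℤ)) o u G) =
      (1 + vecMulVec k (Pi.single ⟨u, hu⟩ 1)) *
        scanMatrix N (l₁ ++ (a, true) :: (b, true) :: l₂) G := by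
    ext w l
    rw [add_mul, one_mul, Matrix.add_apply, vecMulVec_mul, vecMulVec_apply, single_one_vecMul]
    simp only [scanMatrix, row_apply, of_apply, hmem, if_pos hmu]
    by_cases hw : ((w : ℕ), true) ∈ l₁ ++ (a, true) :: (b, true) :: l₂
    · rw [if_pos hw, if_pos hw, barForm_crossForm, bar_one_sub_t_zpow, strandColour_crossForm,
        ← scanForm_add_smul_left, ← hx]
      congr 1
      funext z
      simp only [crossColour, Pi.single_apply, hk, _root_.zpow_neg]
      by_cases h1 : z = (u, true)
      · subst h1
        by_cases h2 : (w : ℕ) = u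
        · simp [h2, ho]
          field_simp
          ring
        · by_cases h3 : (w : ℕ) = o
          · simp [h3, ho, ho.symm]
            field_simp
            ring
          · simp [h2, h3, Ne.symm h2, Ne.symm h3]
      · simp [h1]
    · have h1 : (w : ℕ) ≠ u := by rintro h; exact hw (h ▸ hmu)
      have h2 : (w : ℕ) ≠ o := by rintro h; exact hw (h ▸ hmo)
      simp [hw, hk, h1, h2]
  rw [hP, det_mul, det_one_add_vecMulVec, single_one_dotProduct, hk]
  simp

end Cross

section Cup

variable {c : ℕ} {l₁ l₂ : List (ℕ × Bool)} {G : ℕ → ℕ → Base}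

theorem PreservesForm.cup (h : PreservesForm (l₁ ++ l₂) G) (right : Bool)
    (hc : ∀ l, G l c = 0) :
    PreservesForm (l₁ ++ (c, !right) :: (c, right) :: l₂) G := by
  have h1 : ∀ (G : ℕ → ℕ → Base), (∀ l, G l c = 0) → ∀ l d d',
      strandColour G l (c, d) = strandColour G l (c, d') := fun G hG l d d' => by
    simp [strandColour, hG]
  intro l l'
  rw [scanForm_pair _ _ _ _ (by simp) (h1 _ (fun l => by simp [barForm, hc]) _ _ _), h1 G hc _ _ right,
    sub_self, zero_mul, add_zero, h]

/-- A minimum that is run through from left to right multiplies the determinant by `t⁻¹`, one that is run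
through from right to left does not change it. -/
theorem det_scanMatrix_cup (hr : ∀ l, G c l = 0) (hc : ∀ l, G l c = 0) (right : Bool)
    (hc' : ∀ d, (c, d) ∉ l₁ ++ l₂) {N : ℕ} (hN : c < N) :
    (scanMatrix N (l₁ ++ (c, !right) :: (c, right) :: l₂) G).det =
      (scanMatrix N (l₁ ++ l₂) G).det * (if right then t⁻¹ else 1) := by
  have hmem : ∀ u, u ≠ c → ((u, true) ∈ l₁ ++ (c, !right) :: (c, right) :: l₂ ↔
      (u, true) ∈ l₁ ++ l₂) := fun u hu => by simp [hu]
  have hmem' : (c, true) ∈ l₁ ++ (c, !right) :: (c, right) :: l₂ := by cases right <;> simp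
  have hcol : ∀ l d d', strandColour (barForm G) l (c, d) = strandColour (barForm G) l (c, d') :=
    fun l d d' => by simp [strandColour, barForm, hc]
  have hzero : ∀ z ∈ l₁ ++ l₂, strandColour (barForm G) c z = 0 := fun z hz => by
    have : z.1 ≠ c := fun h => hc' z.2 (by rw [← h]; exact hz)
    simp [strandColour, barForm, hr, this]
  have hpair := fun x l => scanForm_pair (y := strandColour (barForm G) l) x 0 l₁ l₂
    (z := (c, !right)) (z' := (c, right)) (by simp) (hcol _ _ _)
  have hval : scanMatrix N (l₁ ++ (c, !right) :: (c, right) :: l₂) G ⟨c, hN⟩ ⟨c, hN⟩ =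
      if right then t⁻¹ else 1 := by
    simp only [scanMatrix, of_apply, if_pos hmem']
    rw [hpair, scanForm_zero_right hzero,
      scanState_zero fun z hz => hzero z (List.mem_append_left _ hz)]
    cases right <;> simp [strandColour, barForm, hc]
  have h1 := det_eq_of_col (A := scanMatrix N (l₁ ++ (c, !right) :: (c, right) :: l₂) G)
    (B := scanMatrix N (l₁ ++ l₂) G) ⟨c, hN⟩ (fun u hu => ?_) (fun u hu => ?_) fun u l hu hl => ?_
  · rw [hval] at h1
    rw [← h1]
    simp only [scanMatrix, of_apply, if_neg (hc' true), if_true, mul_one]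
  · have hu' : (u : ℕ) ≠ c := fun h => hu (Fin.ext h)
    simp only [scanMatrix, of_apply, hmem u hu', if_neg hu]
    rw [hpair, scanForm_zero_right hzero]
    simp [hu'.symm]
  · have hu' : (u : ℕ) ≠ c := fun h => hu (Fin.ext h)
    simp only [scanMatrix, of_apply, if_neg hu]
    rw [scanForm_zero_right hzero, ite_self]
  · have hu' : (u : ℕ) ≠ c := fun h => hu (Fin.ext h)
    simp only [scanMatrix, of_apply, hmem u hu']
    rw [hpair]
    simp [hu'.symm]

end Cup

end

/-! ### The form under a local maximum -/

section

open Matrix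

/-- The multiple of the colouring of `b` that has to be added to the colouring of `l` so that the end
of `a` and the start of `b` get the same colour. -/
noncomputable def capCoeff (G : ℕ → ℕ → Base) (a b l : ℕ) : Base :=
  strandColour G l (a, true) / (1 - G b a)

/-- The colouring before a maximum that joins the end of `a` to the start of `b`, if the component
`l ≠ b` starts with the colour `1` after the maximum. -/
noncomputable def capColour (G : ℕ → ℕ → Base) (a b l : ℕ) (z : ℕ × Bool) : Base :=
  strandColour G l z + capCoeff G a b l * strandColour G b z

section Cap

variable {a b : ℕ} {G : ℕ → ℕ → Base}

theorem capColour_start {l : ℕ} (hl : l ≠ b) :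
    capColour G a b l (b, false) = capCoeff G a b l := by
  simp [capColour, strandColour, hl.symm]

theorem capColour_end (hab : a ≠ b) (hg : 1 - G b a ≠ 0) (l : ℕ) :
    capColour G a b l (a, true) = capCoeff G a b l := by
  rw [capColour, capCoeff]
  have : strandColour G b (a, true) = G b a := by simp [strandColour, hab]
  rw [this]
  field_simp
  ring

/-- After the maximum, the remaining ends keep the colours that they had in the colouring for which the
start of `b` has the colour of the end of `a`. -/
theorem strandColour_stitchMatrix (hab : a ≠ b) (hg : 1 - G b a ≠ 0) {l : ℕ} (hl : l ≠ b) {z : ℕ × Bool}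
    (h₁ : z ≠ (a, true)) (h₂ : z ≠ (b, false)) :
    strandColour (stitchMatrix a b a G) l (if z.1 = b then a else z.1, z.2) =
      capColour G a b l z := by
  obtain ⟨q, d⟩ := z
  cases d
  · have hq : q ≠ b := fun h => h₂ (by rw [h])
    simp [capColour, strandColour, hq]
  · have hq : q ≠ a := fun h => h₁ (by rw [h])
    simp only [capColour, capCoeff, strandColour, stitchMatrix, merge, if_true]
    by_cases h1 : q = b <;> by_cases h2 : l = a <;> subst_vars
    · simp [hab.symm]
      field_simp
      ring
    · simp [h2, hl, hl.symm, Ne.symm h2]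
      field_simp
      ring
    · simp [h1, hq]
      field_simp
      ring
    · simp [h1, hq, h2, hl, Ne.symm h2]
      ring

theorem strandColour_stitchMatrix_self (hab : a ≠ b) (z : ℕ × Bool) :
    strandColour (stitchMatrix a b a G) b (if z.1 = b then a else z.1, z.2) = 0 := by
  have h1 : (if z.1 = b then a else z.1) ≠ b := by split_ifs <;> assumption
  simp [strandColour, h1, stitchMatrix, merge, hab.symm]

variable {l₁ l₂ : List (ℕ × Bool)} {right : Bool} {z z' : ℕ × Bool}

theorem scanForm_capColour (x : ℕ × Bool → Base) (l : ℕ) (ends : List (ℕ × Bool)) :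
    scanForm x (capColour (barForm G) a b l) 0 ends =
      scanForm x (strandColour (barForm G) l) 0 ends +
        capCoeff (barForm G) a b l * scanForm x (strandColour (barForm G) b) 0 ends := by
  rw [← scanForm_add_smul_right, mul_zero, add_zero]
  rfl

theorem one_sub_barForm_ne_zero (hg : 1 - G b a ≠ 0) : 1 - barForm G b a ≠ 0 := by
  have := (map_ne_zero bar).2 hg
  rwa [map_sub, map_one] at this

/-- The two ends that are joined have the same colour and opposite directions, so their contributions
to the form cancel. -/
theorem PreservesForm.cap (h : PreservesForm (l₁ ++ z :: z' :: l₂) G) (hab : a ≠ b) (hb : b ≠ 0)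
    (hg : 1 - G b a ≠ 0)
    (hz : z = (a, true) ∧ z' = (b, false) ∨ z = (b, false) ∧ z' = (a, true))
    (hn : (l₁ ++ z :: z' :: l₂).Nodup) :
    PreservesForm (renameEnds a b (l₁ ++ l₂)) (stitchMatrix a b a G) := by
  have hg' := one_sub_barForm_ne_zero hg
  have hmem : ∀ w ∈ l₁ ++ l₂, w ≠ (a, true) ∧ w ≠ (b, false) := by
    simp [List.nodup_append] at hn
    grind
  intro l l'
  rw [renameEnds, scanForm_map (fun q => if q = b then a else q), barForm_stitchMatrix]
  by_cases hl : l = b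
  · subst hl
    rw [scanForm_zero_left fun w _ => strandColour_stitchMatrix_self hab w, if_neg (by tauto)]
  by_cases hl' : l' = b
  · subst hl'
    rw [scanForm_zero_right fun w _ => strandColour_stitchMatrix_self hab w, if_neg (by tauto)]
  have hy : ∀ G : ℕ → ℕ → Base, 1 - G b a ≠ 0 → ∀ l ≠ b,
      capColour G a b l z' = capColour G a b l z := by
    intro G hg l hl
    rcases hz with ⟨rfl, rfl⟩ | ⟨rfl, rfl⟩ <;> rw [capColour_start hl, capColour_end hab hg]
  have hd : z'.2 = !z.2 := by rcases hz with ⟨rfl, rfl⟩ | ⟨rfl, rfl⟩ <;> rfl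
  have h1 := scanForm_pair (capColour G a b l) 0 l₁ l₂ hd (hy (barForm G) hg' l' hl')
  rw [hy G hg l hl, sub_self, zero_mul, add_zero] at h1
  rw [scanForm_congr
    (fun w hw => strandColour_stitchMatrix hab hg hl (hmem w hw).1 (hmem w hw).2)
    (fun w hw => strandColour_stitchMatrix hab hg' hl' (hmem w hw).1 (hmem w hw).2), ← h1,
    scanForm_capColour]
  change scanForm (fun w => strandColour G l w + capCoeff G a b l * strandColour G b w) _ _ _ +
    _ * scanForm (fun w => strandColour G l w + capCoeff G a b l * strandColour G b w) _ _ _ = _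
  rw [scanForm_add_smul_left, scanForm_add_smul_left, h, h, h, h]
  simp [hb]

/-- The determinant changes at a maximum like `bar ω / ω` does. After a row and a column operation, the
row of `a` has only one entry, which is in the column of `b`; it is found from the invariance of the
form, applied to the component `b`. -/
theorem det_scanMatrix_cap (h : PreservesForm (l₁ ++ z :: z' :: l₂) G) (hab : a ≠ b) (hb : b ≠ 0)
    (hg : 1 - G b a ≠ 0)
    (hz : right = true ∧ z = (a, true) ∧ z' = (b, false) ∨
      right = false ∧ z = (b, false) ∧ z' = (a, true))
    (hn : (l₁ ++ z :: z' :: l₂).Nodup) {N : ℕ} (hN : ∀ w ∈ l₁ ++ z :: z' :: l₂, w.1 < N)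
    (hb' : (b, true) ∈ l₁ ++ z :: z' :: l₂)
    (hG : ∀ w, (w, true) ∉ l₁ ++ z :: z' :: l₂ → G b w = 0) :
    (scanMatrix N (renameEnds a b (l₁ ++ l₂)) (stitchMatrix a b a G)).det *
        ((1 - barForm G b a) * (if right then t⁻¹ else 1)) =
      (scanMatrix N (l₁ ++ z :: z' :: l₂) G).det * (1 - G b a) := by
  have hg' := one_sub_barForm_ne_zero hg
  have hz' : z = (a, true) ∧ z' = (b, false) ∨ z = (b, false) ∧ z' = (a, true) := by tauto
  have hmem : ∀ w ∈ l₁ ++ l₂, w ≠ (a, true) ∧ w ≠ (b, false) := by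
    simp [List.nodup_append] at hn
    grind
  have hmem' : ∀ w, w ∈ l₁ ++ z :: z' :: l₂ ↔ w ∈ l₁ ++ l₂ ∨ w = (a, true) ∨ w = (b, false) := by
    intro w
    simp only [List.mem_append, List.mem_cons]
    grind
  have ha : a < N := hN (a, true) ((hmem' _).2 (by simp))
  have hbN : b < N := hN (b, false) ((hmem' _).2 (by simp))
  have hren : ∀ l d, (l, d) ∈ renameEnds a b (l₁ ++ l₂) ↔
      (l ≠ b ∧ (l, d) ∈ l₁ ++ l₂) ∨ (l = a ∧ (b, d) ∈ l₁ ++ l₂) := mem_renameEnds hab _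
  have hbm : (b, true) ∈ l₁ ++ l₂ := by
    have := (hmem' _).1 hb'
    simpa [hab.symm] using this
  have hd : z'.2 = !z.2 := by rcases hz' with ⟨rfl, rfl⟩ | ⟨rfl, rfl⟩ <;> rfl
  have hy : ∀ l ≠ b, capColour (barForm G) a b l z' = capColour (barForm G) a b l z := by
    intro l hl
    rcases hz' with ⟨rfl, rfl⟩ | ⟨rfl, rfl⟩ <;> rw [capColour_start hl, capColour_end hab hg']
  set ends := l₁ ++ z :: z' :: l₂ with hends
  set P := scanMatrix N ends G with hP
  set A : Fin N := ⟨a, ha⟩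
  set B : Fin N := ⟨b, hbN⟩
  have hAB : A ≠ B := fun h => hab (congrArg Fin.val h)
  -- The columns of `P`, restricted to colourings `y` that can be continued.
  set τ : Fin N → Base := fun l => if l = B then 0 else capCoeff (barForm G) a b l with hτ
  set X := P * (1 + vecMulVec (Pi.single B 1) τ) with hX
  have hXapply : ∀ u l, X u l = P u l + P u B * τ l := fun u l => by
    rw [hX, mul_add, mul_one, Matrix.add_apply, mul_vecMulVec, vecMulVec_apply, mulVec_single_one]
    rfl
  have hPapply : ∀ u : Fin N, ((u : ℕ), true) ∈ ends → ∀ l : Fin N,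
      P u l = scanForm (Pi.single ((u : ℕ), true) 1) (strandColour (barForm G) l) 0 ends :=
    fun u hu l => by
      simp only [hP, scanMatrix, of_apply, if_pos hu]
  have hPapply' : ∀ u : Fin N, ((u : ℕ), true) ∉ ends → ∀ l : Fin N,
      P u l = if u = l then 1 else 0 := fun u hu l => by
    simp only [hP, scanMatrix, of_apply, if_neg hu]
  have hXB : ∀ u, X u B = P u B := fun u => by
    rw [hXapply, hτ]
    simp
  have hXform : ∀ u : Fin N, ((u : ℕ), true) ∈ ends → ∀ l, l ≠ B →
      X u l = scanForm (Pi.single ((u : ℕ), true) 1) (capColour (barForm G) a b l) 0 ends := by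
    intro u hu l hl
    rw [hXapply, hPapply u hu, hPapply u hu, hτ, scanForm_capColour]
    simp only [if_neg hl]
    ring
  -- The row of `a` is a combination of the other rows, up to its entry in the column of `b`.
  set μ : Fin N → Base := fun u => if u = A then 0 else strandColour G b (u, true) / (1 - G b a)
    with hμ
  set R := (1 + vecMulVec (Pi.single A 1) (-μ)) * X with hR
  have hRne : ∀ u, u ≠ A → ∀ l, R u l = X u l := fun u hu l => by
    rw [hR, add_mul, one_mul, Matrix.add_apply, vecMulVec_mul, vecMulVec_apply,
      Pi.single_eq_of_ne hu, zero_mul, add_zero]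
  have hRA : ∀ l, R A l = X A l - ∑ u, μ u * X u l := fun l => by
    rw [hR, add_mul, one_mul, Matrix.add_apply, vecMulVec_mul, vecMulVec_apply, Pi.single_eq_same,
      one_mul, neg_vecMul, Pi.neg_apply, sub_eq_add_neg]
    rfl
  have hsum : ∀ y : ℕ × Bool → Base, scanForm (strandColour G b) y 0 ends =
      ∑ u : Fin N, strandColour G b (u, true) *
        scanForm (Pi.single ((u : ℕ), true) 1) y 0 ends +
      1 * scanForm (Pi.single (b, false) 1) y 0 ends := by
    intro y
    rw [← scanForm_sum_left, ← scanForm_add_smul_left]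
    refine scanForm_congr (fun w hw => ?_) fun _ _ => rfl
    obtain ⟨q, d⟩ := w
    have hq : q < N := hN _ hw
    rw [Finset.sum_eq_single (⟨q, hq⟩ : Fin N)]
    · cases d <;> simp [Pi.single_apply, strandColour]
    · intro u _ hu
      rw [Pi.single_apply, if_neg (fun h => hu (Fin.ext (congrArg Prod.fst h).symm)), mul_zero]
    · simp
  have hzero : ∀ u : Fin N, ((u : ℕ), true) ∉ ends → strandColour G b ((u : ℕ), true) = 0 := by
    intro u hu
    have h1 : (u : ℕ) ≠ b := fun h => hu (h ▸ hb')
    simp [strandColour, h1, hG u hu]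
  have hga : strandColour G b ((A : ℕ), true) = G b a := by simp [strandColour, A, hab]
  have hμsum : ∀ l, (∑ u, μ u * X u l) * (1 - G b a) =
      ∑ u : Fin N, strandColour G b (u, true) * X u l - G b a * X A l := by
    intro l
    rw [← Finset.add_sum_erase _ _ (Finset.mem_univ A),
      ← Finset.add_sum_erase (f := fun u : Fin N => strandColour G b (u, true) * X u l) _
        (Finset.mem_univ A), hga, add_sub_cancel_left, hμ]
    simp only [if_true, zero_mul, zero_add]
    rw [Finset.sum_mul]
    refine Finset.sum_congr rfl fun u hu => ?_
    rw [if_neg (Finset.ne_of_mem_erase hu)]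
    field_simp
  have hpair := fun x l => scanForm_pair (y := capColour (barForm G) a b l) x 0 l₁ l₂ hd
  have hAmem : ((A : ℕ), true) ∈ ends := (hmem' _).2 (by simp [A])
  have hRAl : ∀ l, l ≠ B → R A l = 0 := by
    intro l hl
    have hl' : (l : ℕ) ≠ b := fun h => hl (Fin.ext h)
    have h1 := hsum (capColour (barForm G) a b l)
    rw [scanForm_capColour, h, h, if_neg (by tauto), if_neg (by tauto), mul_zero, add_zero] at h1
    have h2 : ∑ u : Fin N, strandColour G b (u, true) *
        scanForm (Pi.single ((u : ℕ), true) 1) (capColour (barForm G) a b l) 0 ends =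
        ∑ u : Fin N, strandColour G b (u, true) * X u l := by
      refine Finset.sum_congr rfl fun u _ => ?_
      by_cases hu : ((u : ℕ), true) ∈ ends
      · rw [hXform u hu l hl]
      · rw [hzero u hu, zero_mul, zero_mul]
    have h3 : scanForm (Pi.single (b, false) 1) (capColour (barForm G) a b l) 0 ends = -X A l := by
      rw [hXform A hAmem l hl, hends, hpair _ _ (hy l hl'), hpair _ _ (hy l hl'),
        scanForm_zero_left fun w hw => Pi.single_eq_of_ne (hmem w hw).2 _,
        scanForm_zero_left fun w hw => Pi.single_eq_of_ne (hmem w hw).1 _]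
      rcases hz' with ⟨rfl, rfl⟩ | ⟨rfl, rfl⟩ <;> simp [A, hab]
    rw [h2, h3] at h1
    have h4 := hμsum l
    rw [hRA]
    refine (mul_eq_zero.1 ?_).resolve_right hg
    linear_combination h1 - h4
  have hRAB : R A B * (1 - G b a) = -((1 - barForm G b a) * (if right then t⁻¹ else 1)) := by
    have h1 := hsum (strandColour (barForm G) b)
    rw [h, if_neg (by tauto)] at h1
    have h2 : ∑ u : Fin N, strandColour G b (u, true) *
        scanForm (Pi.single ((u : ℕ), true) 1) (strandColour (barForm G) b) 0 ends =
        ∑ u : Fin N, strandColour G b (u, true) * X u B := by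
      refine Finset.sum_congr rfl fun u _ => ?_
      by_cases hu : ((u : ℕ), true) ∈ ends
      · rw [hXB, hPapply u hu]
      · rw [hzero u hu, zero_mul, zero_mul]
    have h3 : X A B + scanForm (Pi.single (b, false) 1) (strandColour (barForm G) b) 0 ends =
        -((1 - barForm G b a) * (if right then t⁻¹ else 1)) := by
      have hl₁ : ∀ w ∈ l₁, w ≠ (a, true) ∧ w ≠ (b, false) := fun w hw =>
        hmem w (List.mem_append_left _ hw)
      have hl₂ : ∀ w ∈ l₂, w ≠ (a, true) ∧ w ≠ (b, false) := fun w hw =>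
        hmem w (List.mem_append_right _ hw)
      have ht := t_ne_zero
      rw [hXB, hPapply A hAmem, hends, scanForm_append, scanForm_append,
        scanForm_zero_left (l := l₁) fun w hw => Pi.single_eq_of_ne (hl₁ w hw).1 _,
        scanForm_zero_left (l := l₁) fun w hw => Pi.single_eq_of_ne (hl₁ w hw).2 _]
      simp only [scanForm]
      rw [scanForm_zero_left (l := l₂) fun w hw => Pi.single_eq_of_ne (hl₂ w hw).1 _,
        scanForm_zero_left (l := l₂) fun w hw => Pi.single_eq_of_ne (hl₂ w hw).2 _]
      rcases hz with ⟨rfl, rfl, rfl⟩ | ⟨rfl, rfl, rfl⟩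
      · simp [A, B, hab, strandColour]
        field_simp
        ring
      · simp [A, B, hab, strandColour]
        ring
    have h4 := hμsum B
    rw [h2] at h1
    rw [hRA, ← h3]
    linear_combination h1 - h4
  have hdet : (R.submatrix (Equiv.swap A B) id).det = -P.det := by
    rw [det_permute, Equiv.Perm.sign_swap hAB, hR, hX, det_mul, det_mul, det_one_add_vecMulVec,
      det_one_add_vecMulVec, neg_dotProduct, dotProduct_single_one, dotProduct_single_one]
    simp [hμ, hτ]
  set P' := scanMatrix N (renameEnds a b (l₁ ++ l₂)) (stitchMatrix a b a G) with hP'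
  have hbren : (b, true) ∉ renameEnds a b (l₁ ++ l₂) := by
    rw [hren]
    simp [hab.symm]
  have hP'B : ∀ l, P' B l = if B = l then 1 else 0 := fun l => by
    simp only [hP', scanMatrix, of_apply, B, if_neg hbren]
  have key := det_eq_of_row (A := R.submatrix (Equiv.swap A B) id) (B := P') B (fun l hl => by
      rw [submatrix_apply, Equiv.swap_apply_right]
      exact hRAl l hl) (fun l hl => by rw [hP'B, if_neg hl.symm]) fun u l hu hl => by
    have hl' : (l : ℕ) ≠ b := fun h => hl (Fin.ext h)
    have hu' : (u : ℕ) ≠ b := fun h => hu (Fin.ext h)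
    have hP'form : ((u : ℕ), true) ∈ renameEnds a b (l₁ ++ l₂) → ∀ v : ℕ,
        (v, true) ∈ l₁ ++ l₂ → (if v = b then a else v) = u → (∀ v', (v', true) ∈ l₁ ++ l₂ →
          (if v' = b then a else v') = u → v' = v) →
        P' u l = scanForm (Pi.single (v, true) 1) (capColour (barForm G) a b l) 0 ends := by
      intro hmemu v hv hvu hvu'
      simp only [hP', scanMatrix, of_apply, if_pos hmemu]
      rw [renameEnds, scanForm_map (fun q => if q = b then a else q), barForm_stitchMatrix, hends,
        hpair _ _ (hy l hl')]
      have h1 : (Pi.single (v, true) 1 : ℕ × Bool → Base) z -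
          (Pi.single (v, true) 1 : ℕ × Bool → Base) z' = 0 := by
        have h2 := (hmem _ hv).1
        rcases hz' with ⟨rfl, rfl⟩ | ⟨rfl, rfl⟩ <;>
          rw [Pi.single_eq_of_ne h2.symm, Pi.single_eq_of_ne (by simp), sub_self]
      rw [h1, zero_mul, add_zero]
      refine scanForm_congr (fun w hw => ?_) fun w hw =>
        strandColour_stitchMatrix hab hg' hl' (hmem w hw).1 (hmem w hw).2
      obtain ⟨q, d⟩ := w
      simp only [Pi.single_apply, Prod.mk.injEq]
      cases d
      · simp
      · have : ((if q = b then a else q) = u) ↔ q = v :=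
          ⟨hvu' q hw, fun h => h ▸ hvu⟩
        simp [this]
    rw [submatrix_apply, id_eq]
    by_cases huA : u = A
    · subst huA
      rw [Equiv.swap_apply_left, hRne _ hAB.symm, hXform B hb' l hl]
      refine (hP'form ((hren _ _).2 (Or.inr ⟨rfl, hbm⟩)) b hbm (by simp [A]) fun v' h1 h2 => ?_).symm
      by_contra h3
      rw [if_neg h3] at h2
      exact (hmem _ h1).1 (by rw [h2])
    · have hua : (u : ℕ) ≠ a := fun h => huA (Fin.ext h)
      rw [Equiv.swap_apply_of_ne_of_ne huA hu, hRne _ huA]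
      by_cases hum : ((u : ℕ), true) ∈ l₁ ++ l₂
      · rw [hXform u ((hmem' _).2 (Or.inl hum)) l hl]
        refine (hP'form ((hren _ _).2 (Or.inl ⟨hu', hum⟩)) u hum (if_neg hu') fun v' h1 h2 => ?_).symm
        by_cases h3 : v' = b
        · rw [if_pos h3] at h2
          exact absurd h2.symm hua
        · rwa [if_neg h3] at h2
      · have h1 : ((u : ℕ), true) ∉ ends := by
          rw [hmem']
          simp [hum, hua]
        have h2 : ((u : ℕ), true) ∉ renameEnds a b (l₁ ++ l₂) := by
          rw [hren]
          tauto
        rw [hXapply, hPapply' u h1, hPapply' u h1, if_neg hu, zero_mul, add_zero]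
        simp only [hP', scanMatrix, of_apply, if_neg h2]
  rw [submatrix_apply, Equiv.swap_apply_right, hP'B, if_pos rfl, mul_one, hdet, id_eq] at key
  linear_combination P'.det * hRAB + (1 - G b a) * key

end Cap

end

/-! ### Symmetry of the value on long knots -/

/-- The properties of the value on a part of a diagram of a long knot that are preserved when a slice
is added. At the top of the knot, if `G = 0`, the matrix of the form is the identity matrix, so that
`bar_eq` becomes the symmetry of the constant term. -/
structure Stage.IsBalanced (S : Stage) (ω : Base) (G : ℕ → ℕ → Base) : Prop where
  isValid : S.IsValid 1
  hasValue : HasValue S.diagram ω G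
  preservesForm : PreservesForm S.ends G
  bar_eq : ∀ N, S.nextLabel ≤ N → bar ω = ω * (scanMatrix N S.ends G).det

theorem Stage.isBalanced_init : (Stage.init 1).IsBalanced 1 (fun _ _ => 0) where
  isValid := Stage.isValid_init 1
  hasValue := hasValue_init 1 one_ne_zero
  preservesForm l l' := by
    simp only [Stage.init, List.range_one, List.map_cons, List.map_nil, scanForm, strandColour,
      barForm, map_zero, ite_self, mul_zero, add_zero, if_true, one_mul, ite_and,
      eq_comm (a := 0)]
    split_ifs <;> simp
  bar_eq N hN := by
    have : scanMatrix N (Stage.init 1).ends (fun _ _ => 0) = 1 := by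
      ext u l
      simp only [scanMatrix, Matrix.of_apply, Stage.init, List.range_one, List.map_cons,
        List.map_nil, List.mem_singleton, Prod.mk.injEq, and_true, scanForm, strandColour, barForm,
        map_zero, ite_self, mul_zero, add_zero, if_true, one_mul, Matrix.one_apply, Pi.single_apply]
      by_cases h1 : (u : ℕ) = 0
      · simp [h1, Fin.ext_iff]
      · simp [h1]
    rw [this, Matrix.det_one, mul_one, map_one]

theorem Stage.IsValid.lt_nextLabel {n₀ : ℕ} {S : Stage} (hS : S.IsValid n₀) {z : ℕ × Bool}
    (hz : z ∈ S.ends) : z.1 < S.nextLabel := by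
  by_contra h
  have h1 := hS.strand_eq_none z.1 (not_lt.1 h)
  obtain ⟨l, d⟩ := z
  cases d
  · exact ((hS.mem_down l).1 hz).1 h1
  · exact (hS.mem_up l).1 hz h1

theorem bar_zpow_mul_zpow (r : ℤ) : sqrtT ^ (-r) * t ^ r = sqrtT ^ r := by
  have h : t ^ r = sqrtT ^ r * sqrtT ^ r := by rw [t, sq, mul_zpow]
  rw [h, ← mul_assoc, ← zpow_add₀ sqrtT_ne_zero, neg_add_cancel, zpow_zero, one_mul]

theorem exists_eq_append_of_drop_eq {α : Type*} {l l' : List α} {k : ℕ} {a : α}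
    (h : l.drop k = a :: l') : l = l.take k ++ a :: l' ∧ (l.take k).length = k := by
  refine ⟨by rw [← h, List.take_append_drop], List.length_take_of_le ?_⟩
  by_contra h1
  rw [List.drop_eq_nil_of_le (by omega)] at h
  cases h

theorem Stage.IsBalanced.cross {S : Stage} {ω : Base} {G : ℕ → ℕ → Base} (h : S.IsBalanced ω G)
    {k : ℕ} (σ : ℤˣ) {l₁ l₂ : List (ℕ × Bool)} {a b : ℕ}
    (hends : S.ends = l₁ ++ (a, true) :: (b, true) :: l₂) (hk : l₁.length = k) :
    ∃ S' ω' G', S.step (.cross k σ) = some S' ∧ S'.IsBalanced ω' G' := by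
  obtain ⟨S', hstep, hends', hnext, hS', hG'⟩ := Stage.step_cross h.isValid h.hasValue σ hends hk
  have hn := h.isValid.nodup
  have hp := h.preservesForm
  have hlt := fun z hz => h.isValid.lt_nextLabel (z := z) hz
  rw [hends] at hn hp hlt
  refine ⟨S', _, _, hstep, hS', hG', ?_, fun N hN => ?_⟩
  · rw [hends']
    exact hp.cross hn σ
  · rw [hnext] at hN
    rw [hends', det_scanMatrix_cross hn σ ((hlt (a, true) (by simp)).trans_le hN)
      ((hlt (b, true) (by simp)).trans_le hN), ← hends, map_mul, h.bar_eq N hN, bar_sqrtT_zpow]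
    have := bar_zpow_mul_zpow (-σ : ℤ)
    rw [neg_neg] at this
    rw [← this]
    ring

theorem Stage.IsBalanced.cup {S : Stage} {ω : Base} {G : ℕ → ℕ → Base} (h : S.IsBalanced ω G)
    {k : ℕ} (right : Bool) {l₁ l₂ : List (ℕ × Bool)}
    (hends : S.ends = l₁ ++ l₂) (hk : l₁.length = k) :
    ∃ S' ω' G', S.step (.cup k right) = some S' ∧ S'.IsBalanced ω' G' := by
  obtain ⟨S', hstep, hends', hnext, hS', hG'⟩ := Stage.step_cup h.isValid h.hasValue right hends hk
  have hp := h.preservesForm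
  have hlt := fun z hz => h.isValid.lt_nextLabel (z := z) hz
  rw [hends] at hp hlt
  have hn0 := h.isValid.strand_eq_none S.nextLabel le_rfl
  have hr := h.hasValue.row_eq_zero hn0
  have hc := h.hasValue.col_eq_zero hn0
  refine ⟨S', _, _, hstep, hS', hG', ?_, fun N hN => ?_⟩
  · rw [hends']
    exact hp.cup right hc
  · rw [hnext] at hN
    rw [hends', det_scanMatrix_cup hr hc right (fun d hd => lt_irrefl _ (hlt _ hd)) (by omega),
      ← hends, map_mul, h.bar_eq N (by omega), bar_sqrtT_zpow]
    cases right
    · simp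
    · have := bar_zpow_mul_zpow (-1)
      rw [neg_neg, zpow_neg_one t] at this
      simp only [if_true]
      rw [← this]
      ring

theorem Stage.IsBalanced.cap {S : Stage} {ω : Base} {G : ℕ → ℕ → Base} (h : S.IsBalanced ω G)
    {k : ℕ} (right : Bool) {l₁ l₂ : List (ℕ × Bool)} {a b : ℕ} (hab : a ≠ b)
    (hends : S.ends = l₁ ++ (if right then a else b, right) :: (if right then b else a, !right) :: l₂)
    (hk : l₁.length = k) :
    ∃ S' ω' G', S.step (.cap k right) = some S' ∧ S'.IsBalanced ω' G' := by
  obtain ⟨S', hstep, hends', hnext, hS', hG'⟩ :=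
    Stage.step_cap h.isValid h.hasValue right hab hends hk
  have hn := h.isValid.nodup
  have hp := h.preservesForm
  have hlt := fun z hz => h.isValid.lt_nextLabel (z := z) hz
  have hu := h.isValid.mem_up
  have hd := h.isValid.mem_down
  rw [hends] at hn hp hlt hu hd
  have hb := (hd b).1 (by cases right <;> simp)
  have hb0 : b ≠ 0 := Nat.one_le_iff_ne_zero.1 hb.2
  have hg := h.hasValue.one_sub_ne_zero b a
  have hg' := one_sub_barForm_ne_zero hg
  refine ⟨S', _, _, hstep, hS', hG', ?_, fun N hN => ?_⟩
  · rw [hends']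
    exact hp.cap hab hb0 hg (by cases right <;> simp) hn
  · rw [hnext] at hN
    have hdet := det_scanMatrix_cap (right := right) hp hab hb0 hg (by cases right <;> simp) hn
      (fun w hw => (hlt w hw).trans_le hN) ((hu b).2 hb.1) fun w hw =>
        h.hasValue.col_eq_zero (not_not.1 fun h1 => hw ((hu w).2 h1)) b
    rw [← hends] at hdet
    have h1 : bar (1 - G b a) = 1 - barForm G b a := by rw [map_sub, map_one]; rfl
    rw [hends', map_div₀, map_mul, h1, h.bar_eq N hN, bar_sqrtT_zpow, div_eq_iff hg']
    have h2 : sqrtT ^ (-(if right then -1 else 0) : ℤ) * (if right then t⁻¹ else 1) =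
        sqrtT ^ (if right then -1 else 0 : ℤ) := by
      cases right
      · simp
      · have := bar_zpow_mul_zpow (-1)
        simpa [zpow_neg_one] using this
    rw [← h2]
    generalize (if right then t⁻¹ else 1 : Base) = θ at hdet ⊢
    field_simp
    linear_combination (-ω * sqrtT ^ (-(if right then -1 else 0) : ℤ)) * hdet

theorem Stage.IsBalanced.step {S S' : Stage} {ω : Base} {G : ℕ → ℕ → Base} (h : S.IsBalanced ω G)
    {x : Slice} (hx : S.step x = some S') : ∃ ω' G', S'.IsBalanced ω' G' := by
  suffices ∃ S'' ω' G', S.step x = some S'' ∧ S''.IsBalanced ω' G' by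
    obtain ⟨S'', ω', G', h1, h2⟩ := this
    obtain rfl := Option.some.inj (h1.symm.trans hx)
    exact ⟨ω', G', h2⟩
  cases x with
  | cross k σ =>
    simp only [Stage.step] at hx
    split at hx
    · next a b l hd =>
      obtain ⟨h1, h2⟩ := exists_eq_append_of_drop_eq hd
      exact h.cross σ h1 h2
    · cases hx
  | cup k right =>
    simp only [Stage.step] at hx
    split at hx
    · next hk => exact h.cup right (List.take_append_drop k _).symm (List.length_take_of_le hk)
    · cases hx
  | cap k right =>
    simp only [Stage.step] at hx
    split at hx
    · next a b l hd =>
      obtain ⟨h1, h2⟩ := exists_eq_append_of_drop_eq hd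
      split at hx
      · cases hx
      · next hab => exact h.cap true hab h1 h2
    · next b a l hd =>
      obtain ⟨h1, h2⟩ := exists_eq_append_of_drop_eq hd
      split at hx
      · cases hx
      · next hab => exact h.cap false hab h1 h2
    · cases hx

theorem Stage.IsBalanced.run {S S' : Stage} {ω : Base} {G : ℕ → ℕ → Base} (h : S.IsBalanced ω G)
    {w : List Slice} (hw : S.run w = some S') : ∃ ω' G', S'.IsBalanced ω' G' := by
  induction w generalizing S ω G with
  | nil =>
    obtain rfl := Option.some.inj hw
    exact ⟨ω, G, h⟩
  | cons x w ih =>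
    obtain ⟨S₁, h1, h2⟩ := Option.bind_eq_some_iff.1 hw
    obtain ⟨ω₁, G₁, h3⟩ := h.step h1
    exact ih h3 h2

/-- On a long knot, the invariant exists, and its constant term is invariant under `t ↦ t⁻¹` if its
quadratic form vanishes. -/
theorem IsLongKnot.exists_hasValue {D : Diagram} (hD : IsLongKnot D) :
    (∃ a, D.strand 0 = some a) ∧ (∀ l, l ≠ 0 → D.strand l = none) ∧
      ∃ ω G, HasValue D ω G ∧ (G 0 0 = 0 → bar ω = ω) := by
  obtain ⟨w, S, hw, hends, rfl⟩ := hD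
  obtain ⟨ω, G, h⟩ := Stage.isBalanced_init.run hw
  have hu := h.isValid.mem_up
  rw [hends] at hu
  have hnone : ∀ l, l ≠ 0 → S.diagram.strand l = none := fun l hl =>
    not_not.1 fun h1 => hl (by simpa using (hu l).2 h1)
  refine ⟨Option.ne_none_iff_exists'.1 ((hu 0).1 (by simp)), hnone, ω, G, h.hasValue, fun hG => ?_⟩
  have hG0 : ∀ l l', G l l' = 0 := fun l l' => by
    by_cases hl : l = 0
    · by_cases hl' : l' = 0
      · rw [hl, hl', hG]
      · exact h.hasValue.col_eq_zero (hnone l' hl') l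
    · exact h.hasValue.row_eq_zero (hnone l hl) l'
  have hinit := Stage.isBalanced_init.bar_eq (S.nextLabel + 1) (by simp [Stage.init])
  obtain rfl : G = fun _ _ => 0 := by
    funext l l'
    exact hG0 l l'
  rw [h.bar_eq (S.nextLabel + 1) (Nat.le_succ _), hends]
  change bar 1 = 1 * (scanMatrix (S.nextLabel + 1) [(0, true)] fun _ _ => 0).det at hinit
  rw [map_one, one_mul] at hinit
  rw [← hinit, mul_one]

/-! ### Laurent polynomials -/

open LaurentPolynomial in
theorem atT_T (n : ℤ) : atT (T n) = t ^ n := by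
  rw [atT, eval₂_T, Units.val_zpow_eq_zpow_val]
  rfl

theorem t_pow_eq (n : ℤ) : t ^ n = sqrtT ^ (2 * n) := by
  rw [t, zpow_mul]
  rfl

open LaurentPolynomial in
/-- The involution of the base ring extends `T ↦ T⁻¹`. -/
theorem bar_atT (p : ℤ[T;T⁻¹]) : bar (atT p) = atT (invert p) := by
  induction p using LaurentPolynomial.induction_on' with
  | add p q hp hq => rw [map_add, map_add, map_add, map_add, hp, hq]
  | C_mul_T n a =>
    rw [map_mul, map_mul, map_mul, map_mul, invert_C, invert_T, atT_T, atT_T, map_zpow₀, bar_t,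
      inv_zpow', atT, eval₂_C]
    simp

open LaurentPolynomial in
/-- Laurent polynomials are determined by their values at `t`, because `t` is transcendental. -/
theorem atT_injective : Function.Injective atT := by
  rw [injective_iff_map_eq_zero]
  intro p hp
  obtain ⟨n, q, hq⟩ := exists_T_pow p
  have h1 : atT (Polynomial.toLaurent q) = 0 := by rw [hq, map_mul, hp, zero_mul]
  have h2 : atT (Polynomial.toLaurent q) = algebraMap (Polynomial ℚ) Base
      (Polynomial.expand ℚ 2 (q.map (Int.castRingHom ℚ))) := by
    rw [atT, eval₂_toLaurent, Polynomial.expand_eq_sum, Polynomial.eval₂_eq_sum]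
    simp only [Polynomial.sum_def, map_sum]
    rw [Polynomial.support_map_of_injective _ Int.cast_injective]
    refine Finset.sum_congr rfl fun i _ => ?_
    rw [Polynomial.coeff_map, map_mul, map_pow, map_pow, RatFunc.algebraMap_X,
      RatFunc.algebraMap_C]
    simp [tUnit, t, sqrtT]
  rw [h2, map_eq_zero_iff _ (IsFractionRing.injective (Polynomial ℚ) Base),
    Polynomial.expand_eq_zero two_pos,
    Polynomial.map_eq_zero_iff Int.cast_injective] at h1
  rw [h1, map_zero] at hq
  have h3 := congrArg (· * (T (-n) : ℤ[T;T⁻¹])) hq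
  simp only [zero_mul] at h3
  rwa [mul_assoc, ← T_add, add_neg_cancel, T_zero, mul_one, eq_comm] at h3

open LaurentPolynomial in
/-- The units are `± T^n`, and only `± 1` are symmetric. -/
theorem eq_one_of_isUnit_of_invert_eq {u : ℤ[T;T⁻¹]} (hu : IsUnit u) (hinv : invert u = u)
    (h1 : eval₂ (RingHom.id ℤ) 1 u = 1) : u = 1 := by
  obtain ⟨v, huv⟩ := hu.exists_right_inv
  obtain ⟨n, p, hp⟩ := exists_T_pow u
  obtain ⟨m, q, hq⟩ := exists_T_pow v
  have hpq : p * q = Polynomial.X ^ (n + m) := by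
    apply Polynomial.toLaurent_injective
    rw [map_mul, hp, hq, Polynomial.toLaurent_X_pow, mul_mul_mul_comm, huv, one_mul, ← T_add,
      Nat.cast_add]
  obtain ⟨i, -, hi⟩ := (dvd_prime_pow Polynomial.prime_X _).1 (Dvd.intro _ hpq)
  obtain ⟨w, hw⟩ := hi.symm
  obtain ⟨c, hc, hcw⟩ := Polynomial.isUnit_iff.1 w.isUnit
  have hu' : u = C c * T (i - n) := by
    rw [T_sub, ← mul_assoc, ← Polynomial.toLaurent_C, ← Polynomial.toLaurent_X_pow, ← map_mul, hcw,
      mul_comm (w : Polynomial ℤ), hw, hp, mul_assoc, ← T_add, add_neg_cancel, T_zero, mul_one]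
  rw [hu', map_mul, invert_C, invert_T] at hinv
  have h2 := congrArg degree hinv
  rw [degree_C_mul_T _ _ hc.ne_zero, degree_C_mul_T _ _ hc.ne_zero] at h2
  have h3 : (i : ℤ) - n = 0 := by
    have := WithBot.coe_injective h2
    omega
  rw [hu', h3, T_zero, mul_one] at h1 ⊢
  rw [eval₂_C, RingHom.id_apply] at h1
  rw [h1, map_one]

open LaurentPolynomial in
/-- A generator of an ideal can be normalized in a unique way, if it takes the value `1` at `1` and is
symmetric up to a unit. The exponent of the unit is even, because the value at `-1` is odd. -/
theorem exists_normalized {I : Ideal ℤ[T;T⁻¹]} {d : ℤ[T;T⁻¹]} {h : ℤ} (hI : I = Ideal.span {d})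
    (hd : eval₂ (RingHom.id ℤ) 1 d = 1) (hinv : d = T h * invert d) :
    ∃ Δ, (I = Ideal.span {Δ} ∧ invert Δ = Δ ∧ eval₂ (RingHom.id ℤ) 1 Δ = 1) ∧
      (∀ Δ', I = Ideal.span {Δ'} ∧ invert Δ' = Δ' ∧ eval₂ (RingHom.id ℤ) 1 Δ' = 1 → Δ' = Δ) ∧
      atT Δ = sqrtT ^ (-h) * atT d := by
  have heven : Even h := by
    have h1 : ∀ p : ℤ[T;T⁻¹], eval₂ (RingHom.id ℤ) (-1) (invert p) = eval₂ (RingHom.id ℤ) (-1) p := by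
      intro p
      induction p using LaurentPolynomial.induction_on' with
      | add p q hp hq => rw [map_add, map_add, map_add, hp, hq]
      | C_mul_T n a =>
        rw [map_mul, invert_C, invert_T, map_mul, map_mul, eval₂_T, eval₂_T, zpow_neg, ← inv_zpow,
          inv_neg, inv_one]
    have h2 : ∀ p : ℤ[T;T⁻¹], ((eval₂ (RingHom.id ℤ) (-1) p : ℤ) : ZMod 2) =
        ((eval₂ (RingHom.id ℤ) 1 p : ℤ) : ZMod 2) := by
      intro p
      induction p using LaurentPolynomial.induction_on' with
      | add p q hp hq => rw [map_add, map_add, Int.cast_add, Int.cast_add, hp, hq]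
      | C_mul_T n a =>
        rw [map_mul, map_mul, eval₂_T, eval₂_T, one_zpow, eval₂_C, eval₂_C]
        rcases Int.even_or_odd n with hn | hn
        · rw [hn.neg_one_zpow]
        · rw [hn.neg_one_zpow, Int.cast_mul, Int.cast_mul]
          congr 1
    have h3 := congrArg (eval₂ (RingHom.id ℤ) (-1)) hinv
    rw [map_mul, h1, eval₂_T] at h3
    by_contra hodd
    rw [Int.not_even_iff_odd] at hodd
    rw [hodd.neg_one_zpow] at h3
    have h4 := h2 d
    rw [hd] at h4
    have h5 : eval₂ (RingHom.id ℤ) (-1) d = 0 := by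
      simp only [Units.val_neg, Units.val_one] at h3
      omega
    rw [h5] at h4
    exact absurd h4 (by decide)
  obtain ⟨k, rfl⟩ := heven
  have hΔ : I = Ideal.span {T (-k) * d} := by
    rw [hI, Ideal.span_singleton_mul_left_unit (isUnit_T _)]
  have hΔinv : invert (T (-k) * d) = T (-k) * d := by
    rw [map_mul, invert_T, neg_neg]
    conv_rhs => rw [hinv, ← mul_assoc, ← T_add, neg_add_cancel_left]
  have hΔ1 : eval₂ (RingHom.id ℤ) 1 (T (-k) * d) = 1 := by
    rw [map_mul, eval₂_T, hd, one_zpow]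
    rfl
  refine ⟨T (-k) * d, ⟨hΔ, hΔinv, hΔ1⟩, ?_, ?_⟩
  · rintro Δ' ⟨h1, h2, h3⟩
    obtain ⟨u, hu⟩ := Ideal.span_singleton_eq_span_singleton.1 (hΔ.symm.trans h1)
    have hne : T (-k) * d ≠ 0 := by
      intro h0
      rw [h0, map_zero] at hΔ1
      exact zero_ne_one hΔ1
    rw [← hu, map_mul, hΔinv] at h2
    rw [← hu, map_mul, hΔ1, one_mul] at h3
    rw [← hu, eq_one_of_isUnit_of_invert_eq u.isUnit (mul_left_cancel₀ hne h2) h3, mul_one]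
  · rw [map_mul, atT_T, t_pow_eq]
    congr 2
    ring

/-! ### The Alexander matrix -/

section AlexanderMatrix

open Matrix

variable {R : Type*} [CommRing R] {m : ℕ}

theorem sum_ite_succ_mul (y : R) {b : ℕ} (hb : b ≤ m) (i : Fin m) :
    ∑ j : Fin m, (if (j.succ : ℕ) = b then y else 0) * (if i ≤ j then 1 else 0) =
      if (i : ℕ) < b then y else 0 := by
  rcases b with _ | b
  · simp
  · rw [Finset.sum_eq_single (⟨b, hb⟩ : Fin m)]
    · simp [Fin.le_def]
    · intro j _ hj
      rw [if_neg fun h => hj (Fin.ext (by simpa using h)), zero_mul]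
    · simp

variable (arc : Fin m → ℕ) (x : Fin m → R)

/-- The Fox Jacobian of the relations `x_{r+1} = x_a^σ x_r x_a^{-σ}`, where `a` is the arc over the
`r`-th under-passage. -/
def foxMatrix : Matrix (Fin m) (Fin (m + 1)) R := fun r j =>
  (if (j : ℕ) = arc r then 1 - x r else 0) + (if j = r.castSucc then x r else 0) -
    (if j = r.succ then 1 else 0)

/-- The contractions between the crossings along a long knot, numbered by their under-passages: the
`r'`-th under-passage precedes the over-passage of the crossing `r` if and only if `r' < arc r`. -/
def arcMatrix : Matrix (Fin m) (Fin m) R := fun r' r =>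
  (1 - x r) * ((if (r' : ℕ) < arc r then 1 else 0) - if r' < r then 1 else 0)

variable {arc}

/-- Adding up the columns of the Fox Jacobian, starting from the last one. -/
theorem foxMatrix_mul (harc : ∀ r, arc r ≤ m) :
    (foxMatrix arc x).submatrix id Fin.succ * (of fun j i : Fin m => if i ≤ j then (1 : R) else 0) =
      -(1 - arcMatrix arc x)ᵀ := by
  ext r i
  have h1 : ∀ j : Fin m, (foxMatrix arc x).submatrix id Fin.succ r j =
      (if (j.succ : ℕ) = arc r then 1 - x r else 0) + (if (j.succ : ℕ) = r then x r else 0) -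
        (if (j.succ : ℕ) = r + 1 then 1 else 0) := fun j => by
    simp [foxMatrix, Fin.ext_iff]
  rw [mul_apply]
  simp only [h1, of_apply, add_mul, sub_mul, Finset.sum_add_distrib, Finset.sum_sub_distrib,
    sum_ite_succ_mul _ (harc r), sum_ite_succ_mul _ r.isLt.le,
    sum_ite_succ_mul _ (Nat.succ_le_of_lt r.isLt)]
  rw [Matrix.neg_apply, transpose_apply, Matrix.sub_apply, one_apply]
  simp only [arcMatrix, Fin.lt_def, Fin.ext_iff, Nat.lt_succ_iff, le_iff_lt_or_eq]
  rcases lt_trichotomy (i : ℕ) r with h | h | h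
  · simp only [h, h.ne, true_or, if_true, if_false]
    split_ifs <;> ring
  · simp only [h, lt_irrefl, or_true, if_true, if_false]
    split_ifs <;> ring
  · simp only [h.not_gt, h.ne', or_false, if_false]
    split_ifs <;> ring

theorem det_foxMatrix (harc : ∀ r, arc r ≤ m) :
    ((foxMatrix arc x).submatrix id Fin.succ).det = (-1) ^ m * (1 - arcMatrix arc x).det := by
  have h1 : (of fun j i : Fin m => if i ≤ j then (1 : R) else 0).det = 1 := by
    rw [det_of_isLowerTriangular _ fun i j hij => by
      rw [of_apply, if_neg]
      exact not_le.2 (OrderDual.toDual_lt_toDual.1 hij)]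
    simp
  have h2 := congrArg det (foxMatrix_mul x harc)
  rw [det_mul, h1, mul_one, det_neg, det_transpose, Fintype.card_fin] at h2
  exact h2

/-- The entries of every row of the Fox Jacobian add up to zero, so all maximal minors are multiples of
the one without the first column. -/
theorem span_minors_foxMatrix (harc : ∀ r, arc r ≤ m) :
    Ideal.span (Set.range fun s : Fin m → Fin (m + 1) => ((foxMatrix arc x).submatrix id s).det) =
      Ideal.span {(1 - arcMatrix arc x).det} := by
  set d := (1 - arcMatrix arc x).det
  have hd := det_foxMatrix x harc
  have hsum : ∀ (y : R) (b : ℕ), b ≤ m →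
      ∑ k : Fin (m + 1), (if (k : ℕ) = b then y else 0) = y := fun y b hb => by
    rw [Finset.sum_eq_single (⟨b, Nat.lt_succ_of_le hb⟩ : Fin (m + 1))]
    · simp
    · exact fun k _ hk => if_neg fun h => hk (Fin.ext h)
    · simp
  have hrow : ∀ r, ∑ k, foxMatrix arc x r k = 0 := fun r => by
    simp only [foxMatrix, Fin.ext_iff, Fin.val_castSucc, Fin.val_succ, Finset.sum_add_distrib,
      Finset.sum_sub_distrib]
    rw [hsum _ _ (harc r), hsum _ _ r.isLt.le, hsum _ _ (Nat.succ_le_of_lt r.isLt)]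
    ring
  set C : Matrix (Fin m) (Fin (m + 1)) R := of fun j k => Fin.cases (-1) (fun k => if k = j then 1 else 0) k
    with hC
  have hA : foxMatrix arc x = (foxMatrix arc x).submatrix id Fin.succ * C := by
    ext r k
    rw [mul_apply]
    refine Fin.cases ?_ (fun k => ?_) k
    · have := hrow r
      rw [Fin.sum_univ_succ] at this
      simp only [hC, of_apply, Fin.cases_zero, mul_neg, mul_one, Finset.sum_neg_distrib]
      exact eq_neg_of_add_eq_zero_left this
    · simp [hC]
  apply le_antisymm
  · rw [Ideal.span_le]
    rintro _ ⟨s, rfl⟩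
    have h1 : (foxMatrix arc x).submatrix id s =
        (foxMatrix arc x).submatrix id Fin.succ * C.submatrix id s := by
      conv_lhs => rw [hA]
      rfl
    simp only [SetLike.mem_coe, h1, det_mul, hd]
    exact Ideal.mem_span_singleton.2 (Dvd.intro_left ((-1) ^ m * (C.submatrix id s).det) (by ring))
  · rw [Ideal.span_singleton_le_iff_mem]
    have h1 : d = (-1) ^ m * ((foxMatrix arc x).submatrix id Fin.succ).det := by
      rw [hd, ← mul_assoc, ← mul_pow, neg_one_mul, neg_neg, one_pow, one_mul]
    rw [h1]
    exact Ideal.mul_mem_left _ _ (Ideal.subset_span ⟨Fin.succ, rfl⟩)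

end AlexanderMatrix

section Passes

variable {l : List Pass}

/-- If no passage is repeated, `pairCount p q` tells whether `p` precedes `q`. -/
theorem pairCount_of_nodup (hl : l.Nodup) {p q : Pass} (hq : q ∈ l) :
    pairCount p q l = if p ∈ l.takeWhile (fun x => decide (x ≠ q)) then 1 else 0 := by
  induction l with
  | nil => cases hq
  | cons x l ih =>
    rw [List.nodup_cons] at hl
    by_cases hx : x = q
    · subst hx
      rw [pairCount, List.count_eq_zero_of_not_mem hl.1, pairCount_eq_zero_of_right hl.1]
      simp
    · have hq' : q ∈ l := (List.mem_cons.1 hq).resolve_left (Ne.symm hx)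
      rw [pairCount, ih hl.2 hq', List.count_eq_one_of_mem hl.2 hq',
        List.takeWhile_cons_of_pos (by simpa using hx)]
      simp only [List.mem_cons]
      by_cases hp : x = p
      · subst hp
        have : x ∉ l.takeWhile fun x => decide (x ≠ q) := fun h =>
          hl.1 ((List.takeWhile_subset _) h)
        rw [if_pos rfl, if_neg this, if_pos (Or.inl rfl), Nat.cast_one, add_zero]
      · simp [hp, Ne.symm hp]

theorem mem_underCrossings {c : ℕ} : c ∈ underCrossings l ↔ (⟨c, false⟩ : Pass) ∈ l := by
  rw [underCrossings, List.mem_map]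
  constructor
  · rintro ⟨⟨c', o⟩, h, rfl⟩
    rw [List.mem_filter] at h
    cases o
    · exact h.1
    · simp at h
  · exact fun h => ⟨_, List.mem_filter.2 ⟨h, rfl⟩, rfl⟩

theorem underCrossings_append (l l' : List Pass) :
    underCrossings (l ++ l') = underCrossings l ++ underCrossings l' := by
  rw [underCrossings, List.filter_append, List.map_append]
  rfl

theorem length_underCrossings (l : List Pass) : (underCrossings l).length = underCount l := by
  rw [underCrossings, List.length_map, underCount, List.countP_eq_length_filter]

theorem nodup_underCrossings (hl : l.Nodup) : (underCrossings l).Nodup := by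
  refine List.Nodup.map_on ?_ (hl.filter _)
  rintro ⟨c, o⟩ h ⟨c', o'⟩ h' hc
  rw [List.mem_filter] at h h'
  cases o <;> cases o' <;> simp_all

/-- The under-passages of an initial segment are those with the smallest indices. -/
theorem mem_prefix_iff (hl : l.Nodup) {w : List Pass} (hw : w <+: l)
    (r : Fin (underCrossings l).length) :
    (⟨(underCrossings l).get r, false⟩ : Pass) ∈ w ↔ (r : ℕ) < underCount w := by
  obtain ⟨v, rfl⟩ := hw
  have hn := nodup_underCrossings hl
  rw [← mem_underCrossings, ← length_underCrossings, List.get_eq_getElem]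
  constructor
  · intro h
    obtain ⟨i, hi, hi'⟩ := List.getElem_of_mem h
    have h1 : (underCrossings (w ++ v))[i]'(by
        rw [underCrossings_append, List.length_append]; omega) =
        (underCrossings (w ++ v))[(r : ℕ)] := by
      rw [← hi']
      simp only [underCrossings_append]
      rw [List.getElem_append_left]
    rw [← (hn.getElem_inj_iff).1 h1]
    exact hi
  · intro h
    simp only [underCrossings_append]
    rw [List.getElem_append_left h]
    exact List.getElem_mem h

theorem underCount_takeWhile (hl : l.Nodup) (r : Fin (underCrossings l).length) :
    underCount (l.takeWhile fun x => decide (x ≠ ⟨(underCrossings l).get r, false⟩)) = r := by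
  set q : Pass := ⟨(underCrossings l).get r, false⟩ with hq
  have hmem : q ∈ l := mem_underCrossings.1 (List.get_mem _ _)
  obtain ⟨s, v, hs, hqs⟩ := List.eq_append_cons_of_mem hmem
  have hw : l.takeWhile (fun x => decide (x ≠ q)) = s := by
    rw [hs, List.takeWhile_append_of_pos fun x hx => by
      simpa using fun h : x = q => hqs (h ▸ hx)]
    simp
  rw [hw]
  apply le_antisymm
  · have h1 := (mem_prefix_iff hl ⟨_, hs.symm⟩ r).not.1 hqs
    omega
  · have h1 := (mem_prefix_iff hl (w := s ++ [q]) ⟨v, by rw [hs]; simp⟩ r).1 (by simp [hq])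
    have h2 : underCount (s ++ [q]) = underCount s + 1 := by
      rw [underCount, List.countP_append]
      simp [hq, underCount]
    omega

theorem overArc_le (l : List Pass) (c : ℕ) : overArc l c ≤ (underCrossings l).length := by
  rw [length_underCrossings]
  exact (List.takeWhile_sublist _).countP_le

end Passes

/-! ### Long knots -/

theorem IsGaussian.coeff_single {L : Finset ℕ} {ω : Base} {G : ℕ → ℕ → Base} {g : Series}
    (h : IsGaussian L ω G g) (l l' : ℕ) : MvPowerSeries.coeff
      (Finsupp.single (Sum.inr l') 1 + Finsupp.single (Sum.inl l) 1 : ℕ ⊕ ℕ →₀ ℕ) g = G l l' * ω := by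
  rw [h.coeff_add_single, Finset.sum_eq_single l']
  · simp [h.coeff_zero]
  · intro x _ hx
    simp [hx.symm]
  · intro hl
    rw [h.col_eq_zero l l' hl, zero_mul]

/-- The value of the invariant on a diagram with one component. The `r`-th under-passage precedes the
over-passage of a crossing `c` if and only if `r` is smaller than the number of the arc over `c`, so
the matrix of contractions is that of the arcs, and `d` is a maximal minor of the Fox Jacobian. The
quadratic form vanishes, because the component runs through every crossing once over and once
under. -/
theorem ZValue.exists_arcMatrix {D : Diagram} {g : Series} {a : Strand} (h : ZValue D g)
    (ha : D.strand 0 = some a) (ha' : ∀ l, l ≠ 0 → D.strand l = none) :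
    ∃ (k : ℤ) (d : ℤ[T;T⁻¹]), alexanderIdeal a.passes D.sign = Ideal.span {d} ∧
      LaurentPolynomial.eval₂ (RingHom.id ℤ) 1 d = 1 ∧ atT d ≠ 0 ∧
      IsGaussianOn D (sqrtT ^ k / atT d) (fun _ _ => 0) g := by
  set l := a.passes with hl
  have htotal : ∀ F, D.total F = F a := Diagram.total_of_single ha ha'
  have hcount : ∀ p, (l.count p : ℤ) = if D.sign p.crossing = 0 then 0 else 1 := fun p => by
    rw [← h.total_count p, htotal]
    rfl
  have hnodup : l.Nodup := List.nodup_iff_count_le_one.2 fun p => by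
    have := hcount p
    split_ifs at this <;> omega
  have hmem : ∀ p : Pass, D.sign p.crossing ≠ 0 → p ∈ l := fun p hp => by
    have := hcount p
    rw [if_neg hp] at this
    exact List.count_pos_iff.1 (by omega)
  have hsign : ∀ p ∈ l, D.sign p.crossing ≠ 0 := fun p hp => h.sign_ne_zero ha hp
  set name : Fin (underCrossings l).length → ℕ := (underCrossings l).get with hname
  have hinj : Function.Injective name := List.nodup_iff_injective_get.1 (nodup_underCrossings hnodup)
  have hcover : ∀ c, D.sign c ≠ 0 → c ∈ Set.range name := fun c hc => by
    obtain ⟨r, hr⟩ := List.mem_iff_get.1 (mem_underCrossings.2 (hmem ⟨c, false⟩ hc))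
    exact ⟨r, hr⟩
  obtain ⟨hdet, hG⟩ := h.isGaussianOn hinj hcover
  set arc : Fin (underCrossings l).length → ℕ := fun r => overArc l (name r)
  set x : Fin (underCrossings l).length → ℤ[T;T⁻¹] := fun r =>
    LaurentPolynomial.T (D.sign (name r))
  have harc : ∀ r, arc r ≤ (underCrossings l).length := fun r => overArc_le l _
  have hlink : linkingMatrix name D = (arcMatrix arc x).map atT := by
    ext r' r
    have hover : (⟨name r, true⟩ : Pass) ∈ l := hmem _ (hsign ⟨name r, false⟩ (mem_underCrossings.1
      (List.get_mem (underCrossings l) r)))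
    have hunder : (⟨name r, false⟩ : Pass) ∈ l := mem_underCrossings.1
      (List.get_mem (underCrossings l) r)
    have hpre : ∀ q : Pass, ((⟨name r', false⟩ : Pass) ∈ l.takeWhile fun x => decide (x ≠ q)) ↔
        (r' : ℕ) < underCount (l.takeWhile fun x => decide (x ≠ q)) := fun q =>
      mem_prefix_iff hnodup (List.takeWhile_prefix _) r'
    rw [linkingMatrix_apply, crossingWeight, linkingCount, htotal, htotal,
      pairCount_of_nodup hnodup hover, pairCount_of_nodup hnodup hunder, Matrix.map_apply, arcMatrix,
      map_mul, map_sub, map_one, atT_T]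
    simp only [hpre]
    rw [underCount_takeWhile hnodup r]
    congr 1
    simp only [map_sub, apply_ite atT, map_one, map_zero, Fin.lt_def]
    push_cast
    rfl
  have hdet' : (1 - linkingMatrix name D).det = atT (1 - arcMatrix arc x).det := by
    rw [hlink, RingHom.map_det, RingHom.mapMatrix_apply, Matrix.map_sub _ (map_sub atT),
      Matrix.map_one _ (map_zero _) (map_one _)]
  -- Every crossing contributes `e_0 - e_0` to the exponent.
  have heV : ∀ l', eVector name D l' = 0 := fun l' => by
    funext r
    rw [eVector]
    by_cases hl' : l' = 0
    · have h1 : ∀ p, D.eval (Strand.count p) l' = (l.count p : ℤ) := fun p => by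
        rw [hl', Diagram.eval_of_some ha]
        rfl
      rw [h1, h1, hcount, hcount, sub_self, mul_zero]
      rfl
    · rw [Diagram.eval_of_none (ha' l' hl'), Diagram.eval_of_none (ha' l' hl'), sub_self, mul_zero]
      rfl
  have hform : diagramForm name D = fun _ _ => 0 := by
    funext p q
    rw [diagramForm, heV, zero_dotProduct]
  refine ⟨framing name D, (1 - arcMatrix arc x).det, span_minors_foxMatrix x harc, ?_, ?_, ?_⟩
  · have h1 : (arcMatrix arc x).map (LaurentPolynomial.eval₂ (RingHom.id ℤ) 1) = 0 := by
      ext r' r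
      rw [Matrix.map_apply, arcMatrix, map_mul, map_sub, map_one, LaurentPolynomial.eval₂_T, one_zpow,
        Units.val_one, sub_self, zero_mul]
      rfl
    rw [RingHom.map_det, RingHom.mapMatrix_apply, Matrix.map_sub _ (map_sub _),
      Matrix.map_one _ (map_zero _) (map_one _), h1, sub_zero, Matrix.det_one]
  · rwa [← hdet']
  · rw [← hdet', ← hform]
    exact hG

/-- On a long knot, the invariant is the inverse of the normalized Alexander polynomial. -/
theorem IsLongKnot.existsUnique_and_zValue_iff {D : Diagram} (hD : IsLongKnot D) :
    (∃! Δ : ℤ[T;T⁻¹], IsAlexanderPolynomial D Δ) ∧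
      ∀ Δ : ℤ[T;T⁻¹], IsAlexanderPolynomial D Δ →
        ∀ g : Series, ZValue D g ↔ g = MvPowerSeries.C (atT Δ)⁻¹ := by
  obtain ⟨⟨a, ha⟩, ha', ω, G, ⟨g, hg, hG⟩, hbar⟩ := hD.exists_hasValue
  obtain ⟨k, d, hspan, hd1, hd0, hval⟩ := hg.exists_arcMatrix ha ha'
  have hs : ∀ n : ℤ, sqrtT ^ n ≠ 0 := fun n => zpow_ne_zero n sqrtT_ne_zero
  obtain ⟨L, -, hL⟩ := hG.exists_labels
  obtain ⟨L', -, hL'⟩ := hval.exists_labels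
  have hω : ω = sqrtT ^ k / atT d := hL.coeff_zero.symm.trans hL'.coeff_zero
  have hω0 : ω ≠ 0 := by
    rw [hω]
    exact div_ne_zero (hs k) hd0
  have hG0 : G 0 0 = 0 := by
    have h1 := (hL.coeff_single 0 0).symm.trans (hL'.coeff_single 0 0)
    rw [zero_mul] at h1
    exact (mul_eq_zero.1 h1).resolve_right hω0
  have hsymm := hbar hG0
  have hinv0 : atT (LaurentPolynomial.invert d) ≠ 0 := by
    rw [← bar_atT]
    exact (map_ne_zero bar).2 hd0
  rw [hω, map_div₀, bar_sqrtT_zpow, bar_atT, div_eq_div_iff hinv0 hd0] at hsymm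
  -- The symmetry of `ω = t^{k/2} / d` says that `d` is symmetric up to the unit `T ^ k`.
  have hinv : d = LaurentPolynomial.T k * LaurentPolynomial.invert d := by
    apply atT_injective
    rw [map_mul, atT_T, t_pow_eq, two_mul, zpow_add₀ sqrtT_ne_zero]
    have h1 : sqrtT ^ k * sqrtT ^ (-k) = 1 := by
      rw [← zpow_add₀ sqrtT_ne_zero, add_neg_cancel, zpow_zero]
    linear_combination (-atT d) * h1 + sqrtT ^ k * hsymm
  obtain ⟨Δ, hΔ, huniq, hat⟩ := exists_normalized hspan hd1 hinv
  have hiff : ∀ Δ', IsAlexanderPolynomial D Δ' ↔ Δ' = Δ := by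
    intro Δ'
    constructor
    · rintro ⟨⟨b, hb, h1⟩, h2, h3⟩
      obtain rfl := Option.some.inj (ha.symm.trans hb)
      exact huniq Δ' ⟨h1, h2, h3⟩
    · rintro rfl
      exact ⟨⟨a, ha, hΔ.1⟩, hΔ.2.1, hΔ.2.2⟩
  refine ⟨⟨Δ, (hiff Δ).2 rfl, fun Δ' h => (hiff Δ').1 h⟩, fun Δ' h g' => ?_⟩
  obtain rfl := (hiff Δ').1 h
  have hgval : g = MvPowerSeries.C (atT Δ')⁻¹ := by
    rw [hL'.eq_C, hat, mul_inv, ← zpow_neg, neg_neg, div_eq_mul_inv]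
  rw [← hgval]
  exact ⟨fun h => h.unique hg, fun h => h ▸ hg⟩

end Snarl

/-- Part 1: the value of the Weyl algebra snarl invariant on a braid. Part 2: its value on a long
knot is the inverse of the normalized Alexander polynomial. That the invariant of a diagram is
well-defined and exists is part of the claim. -/
theorem theorem4 :
    (∀ (n : ℕ) (b : Snarl.BraidGroup n) (w : List (Fin n × ℤˣ)), Snarl.braidOfWord w = b →
      ∃ S : Snarl.Stage,
        (Snarl.Stage.init (n + 1)).run (Snarl.braidSlices w) = some S ∧
        ∀ g : Snarl.Series, Snarl.ZValue S.diagram g ↔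
          g = MvPowerSeries.C (Snarl.sqrtT ^ Snarl.writhe w) *
            Snarl.expQuadratic
              ((Snarl.burau n Snarl.tUnit b).val.transpose * (Snarl.burau n 1 b).val - 1)) ∧
    (∀ D : Snarl.Diagram, Snarl.IsLongKnot D →
      (∃! Δ : LaurentPolynomial ℤ, Snarl.IsAlexanderPolynomial D Δ) ∧
      ∀ Δ : LaurentPolynomial ℤ, Snarl.IsAlexanderPolynomial D Δ →
        ∀ g : Snarl.Series, Snarl.ZValue D g ↔ g = MvPowerSeries.C (Snarl.atT Δ)⁻¹) := by
  refine ⟨?_, fun D hD => hD.existsUnique_and_zValue_iff⟩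
  rintro n _ w rfl
  exact Snarl.zValue_braid_iff w
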